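/- Let $M$ be a non-empty smooth manifold without boundary, of dimension $d\ge 1$, embedded as a smooth submanifold of some $\mathbb R^m$. Write $\underline n=\{1,\dots,n\}$ and let $C_n(M)\subset M^n$ be the space of $n$-tuples of distinct points of $M$; $\Sigma_n$ acts on it by permuting indices. Let $C_n[M]$ be the closure of the image of $$\alpha_n\colon C_n(M)\to A_n[M]=M^n\times (S^{m-1})^{C_2(\underline n)}\times[0,\infty]^{C_3(\underline n)},\qquad (x_i)\mapsto\Big((x_i),\Big(\tfrac{x_i-x_j}{|x_i-x_j|}\Big)_{ij},\Big(\tfrac{|x_i-x_j|}{|x_i-x_k|}\Big)_{ijk}\Big),$$ with the smooth structure induced from $A_n[M]$, where it is a manifold with corners of dimension $nd$. An $f$-tree is a finite rooted tree with no bivalent vertex other than possibly the root, whose leaves (univalent non-root vertices) are labelled bijectively by $\underline n$; its internal vertices are the vertices other than the root and the leaves. $\Sigma_n$ acts on $f$-trees by relabelling. To $p=((x_i),(u_{ij}),(d_{ijk}))\in C_n[M]$ associate the $f$-tree $T(p)$ for which the label sets of the leaves lying over the internal vertices are exactly the sets $\{i\}\cup\{j: d_{ijk}=0\}$, for all $i\ne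 k$ such that $d_{ijk}=0$ for some $j$, together with $\underline n$ if $n\ge2$ and all $x_i$ are equal. For an $f$-tree $T$ let $C_T(M)$ be the stratum $\{p\in C_n[M]: T(p)\cong T\}$, a smooth submanifold whose codimension is the number of internal vertices of $T$. **Theorem.** The $\Sigma_n$-action on $C_n(M)$ extends to a smooth action on $C_n[M]$. This action is free, and each $\sigma\in\Sigma_n$ restricts, for every $f$-tree $T$, to a diffeomorphism $C_T(M)\to C_{\sigma T}(M)$. Hence $C_n[M]/\Sigma_n$ is a (Hausdorff, second countable) manifold with corners such that the projection $C_n[M]\to C_n[M]/\Sigma_n$ is a local diffeomorphism. It is stratified by the images of the $C_T(M)$, and the image of $C_T(M)$ consists of points lying on corners whose codimension is the number of internal vertices of $T$. The category of these strata (with a unique morphism from a stratum to each stratum whose closure contains it) is isomorphic to the category of unlabelled $f$-trees with $n$ leaves (isomorphism classes, with a unique morphism from $T$ to $T'$ when $T'$ is isomorphic to a contraction of $T$ along a set of non-leaf edges), the class of an $f$-tree $T$ with its labels forgotten corresponding to the image of $C_T(M)$. -/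

import Mathlib

open scoped Manifold ContDiff ENNReal

namespace FM

/-! ### Configurations and their canonical compactification -/

/-- `Conf k X` is the configuration space `C_k(X)` of ordered `k`-tuples of distinct points of
`X`.  It is also used for the index sets `C_2({1,…,n})` and `C_3({1,…,n})`. -/
abbrev Conf (k : ℕ) (X : Type*) : Type _ := {x : Fin k → X // Function.Injective x}

theorem Conf.ne {k : ℕ} {X : Type*} (x : Conf k X) {i j : Fin k} (h : i ≠ j) : x.1 i ≠ x.1 j :=
  fun e => h (x.2 e)

/-- The symmetric group acts on configurations by permuting the indices:
`(σ • x) i = x (σ⁻¹ i)`. -/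
instance Conf.permAction (k : ℕ) (X : Type*) : MulAction (Equiv.Perm (Fin k)) (Conf k X) where
  smul σ x := ⟨fun i => x.1 (σ⁻¹ i), x.2.comp (σ⁻¹).injective⟩
  one_smul _ := rfl
  mul_smul _ _ _ := rfl

/-- The main ambient space `A_n[M] = M^n × (S^{m-1})^{C_2(n)} × [0,∞]^{C_3(n)}`. -/
abbrev Ambient (n m : ℕ) (M : Type*) : Type _ :=
  (Fin n → M) × (Conf 2 (Fin n) → Metric.sphere (0 : EuclideanSpace ℝ (Fin m)) 1) ×
    (Conf 3 (Fin n) → ℝ≥0∞)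

section

variable {n m : ℕ} {M : Type*}

/-- The unit vector pointing from `y` to `x`, for `x ≠ y`. -/
noncomputable def direction (x y : EuclideanSpace ℝ (Fin m)) (h : x ≠ y) :
    Metric.sphere (0 : EuclideanSpace ℝ (Fin m)) 1 :=
  ⟨‖x - y‖⁻¹ • (x - y), by
    have h0 : ‖x - y‖ ≠ 0 := norm_ne_zero_iff.mpr (sub_ne_zero.mpr h)
    rw [mem_sphere_zero_iff_norm, norm_smul, norm_inv, norm_norm, inv_mul_cancel₀ h0]⟩

/-- The map `α_n : C_n(M) → A_n[M]` whose components are the points `x_i`, the directions of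
`x_i - x_j` and the ratios `|x_i - x_j| / |x_i - x_k|`, where `M` is embedded in `ℝ^m`
through `ε`. -/
noncomputable def alpha (n : ℕ) (ε : M ↪ EuclideanSpace ℝ (Fin m)) (x : Conf n M) :
    Ambient n m M :=
  (x.1,
    fun p => direction (ε (x.1 (p.1 0))) (ε (x.1 (p.1 1)))
      (fun e => x.ne (p.ne (i := 0) (j := 1) (by decide)) (ε.injective e)),
    fun t => edist (ε (x.1 (t.1 0))) (ε (x.1 (t.1 1))) / edist (ε (x.1 (t.1 0))) (ε (x.1 (t.1 2))))

/-- The canonical compactification `C_n[M]`: the closure of the image of `α_n` in `A_n[M]`. -/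
abbrev CompactConf [TopologicalSpace M] (n : ℕ) (ε : M ↪ EuclideanSpace ℝ (Fin m)) : Type _ :=
  ↥(closure (Set.range (alpha n ε)))

/-- The inclusion of `C_n(M)` in `C_n[M]`. -/
noncomputable def inclusion [TopologicalSpace M] (ε : M ↪ EuclideanSpace ℝ (Fin m))
    (x : Conf n M) : CompactConf n ε :=
  ⟨alpha n ε x, subset_closure ⟨x, rfl⟩⟩

/-- The smooth coordinate `a ↦ a / (1 + a)`, written as `1 - 1 / (1 + a)`, which identifies the
interval `[0,∞]` with `[0,1]` and sends `∞` to `1`. -/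
noncomputable def intervalCoord (a : ℝ≥0∞) : ℝ := 1 - ((1 + a)⁻¹).toReal

/-- The Euclidean space containing `A_n[M]`. -/
abbrev CoordSpace (n m : ℕ) : Type :=
  (Fin n → EuclideanSpace ℝ (Fin m)) × (Conf 2 (Fin n) → EuclideanSpace ℝ (Fin m)) ×
    (Conf 3 (Fin n) → ℝ)

/-- The standard coordinates on `A_n[M]`, that is, the product of the embedding `ε` of `M`, the
inclusion of the sphere, and the coordinate `[0,∞] ≅ [0,1] ⊆ ℝ`. A smooth structure on a subspace
`Y` of `A_n[M]` is the one induced from `A_n[M]` when this map restricted to `Y` is a smooth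
embedding. -/
noncomputable def coords (ε : M ↪ EuclideanSpace ℝ (Fin m)) (p : Ambient n m M) :
    CoordSpace n m :=
  (fun i => ε (p.1 i), fun q => (p.2.1 q : EuclideanSpace ℝ (Fin m)),
    fun t => intervalCoord (p.2.2 t))

end

/-! ### `f`-trees -/

/-- A finite rooted tree in which no vertex other than the root is bivalent. -/
structure TreeWithRoot where
  /-- the vertices -/
  V : Type
  finite : Finite V
  /-- the underlying graph -/
  G : SimpleGraph V
  isTree : G.IsTree
  /-- the root vertex -/
  root : V
  no_bivalent : ∀ v, v ≠ root → (G.neighborSet v).ncard ≠ 2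

namespace TreeWithRoot

/-- The leaves are the univalent vertices other than the root. -/
def leaves (T : TreeWithRoot) : Set T.V := {v | v ≠ T.root ∧ (T.G.neighborSet v).ncard = 1}

/-- The internal vertices are the vertices other than the root and the leaves. -/
def internal (T : TreeWithRoot) : Set T.V := {v | v ≠ T.root ∧ v ∉ T.leaves}

/-- `u` lies over `v` when `v` is on the path from `u` to the root. -/
def Over (T : TreeWithRoot) (u v : T.V) : Prop :=
  ∃ p : T.G.Walk u T.root, p.IsPath ∧ v ∈ p.support

/-- An isomorphism of rooted trees is a graph isomorphism preserving the root. -/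
def IsIso (T T' : TreeWithRoot) : Prop := ∃ φ : T.G ≃g T'.G, φ T.root = T'.root

/-- `T'` is isomorphic, through `c`, to the contraction of `T` by the set `E` of non-leaf edges:
`c` identifies exactly the vertices joined by edges in `E`, and the edges of `T'` are the
images of the edges of `T` which are not in `E`. -/
structure IsContraction (T T' : TreeWithRoot) (E : Set (Sym2 T.V)) (c : T.V → T'.V) : Prop where
  subset_edges : E ⊆ T.G.edgeSet
  nonleaf : ∀ e ∈ E, ∀ v ∈ e, v ∉ T.leaves
  surjective : Function.Surjective c
  identify : ∀ u v, c u = c v ↔ (SimpleGraph.fromEdgeSet E).Reachable u v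
  adj : ∀ a b, T'.G.Adj a b ↔ ∃ u v, T.G.Adj u v ∧ s(u, v) ∉ E ∧ c u = a ∧ c v = b
  root : c T.root = T'.root

end TreeWithRoot

/-- An `f`-tree with `n` leaves: the leaves are labelled bijectively by `{1,…,n}`. -/
structure FTree (n : ℕ) extends TreeWithRoot where
  label : Fin n ≃ toTreeWithRoot.leaves

namespace FTree

variable {n : ℕ}

/-- The number of internal vertices. -/
noncomputable def numInternal (T : FTree n) : ℕ := T.internal.ncard

/-- The set of labels of the leaves which lie over `v`. -/
def labelsOver (T : FTree n) (v : T.V) : Set (Fin n) := {i | T.Over (T.label i).1 v}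

/-- The parenthesization associated to a tree: the collection of the label sets of its internal
vertices. It determines the tree up to isomorphism of labelled trees. -/
def parenthesization (T : FTree n) : Set (Set (Fin n)) := T.labelsOver '' T.internal

/-- The symmetric group acts on `f`-trees by permuting the labels: the leaf labelled `i` in `T` is
labelled `σ i` in `σ • T`. -/
instance : MulAction (Equiv.Perm (Fin n)) (FTree n) where
  smul σ T := { T with label := (σ⁻¹).trans T.label }
  one_smul _ := rfl
  mul_smul _ _ _ := rfl

end FTree

/-- Unlabelled `f`-trees with `n` leaves. -/
abbrev UFTree (n : ℕ) : Type 1 := {T : TreeWithRoot // T.leaves.ncard = n}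

/-- The isomorphism relation on unlabelled `f`-trees. -/
instance UFTree.setoid (n : ℕ) : Setoid (UFTree n) where
  r T T' := T.1.IsIso T'.1
  iseqv :=
    { refl := fun _ => ⟨SimpleGraph.Iso.refl, rfl⟩
      symm := by
        rintro T T' ⟨φ, h⟩
        exact ⟨φ.symm, by rw [← h]; exact φ.symm_apply_apply _⟩
      trans := by
        rintro T T' T'' ⟨φ, h⟩ ⟨ψ, h'⟩
        exact ⟨φ.trans ψ, by rw [← h', ← h]; rfl⟩ }

/-- The objects of the category of unlabelled `f`-trees with `n` leaves: isomorphism classes. -/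
def UnlabelledFTree (n : ℕ) : Type 1 := Quotient (UFTree.setoid n)

/-- There is a (unique) morphism from `a` to `b` in the category of unlabelled `f`-trees if `b`
is isomorphic to a contraction of `a` along some set of non-leaf edges. -/
def UnlabelledFTree.Hom {n : ℕ} (a b : UnlabelledFTree n) : Prop :=
  ∃ T T' : UFTree n, Quotient.mk _ T = a ∧ Quotient.mk _ T' = b ∧
    ∃ E c, TreeWithRoot.IsContraction T.1 T'.1 E c

/-- The unlabelled `f`-tree underlying an `f`-tree. -/
def FTree.unlabelled {n : ℕ} (T : FTree n) : UnlabelledFTree n :=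
  Quotient.mk _ ⟨T.toTreeWithRoot, by
    rw [← Nat.card_coe_set_eq, ← Nat.card_congr T.label, Nat.card_fin]⟩

/-! ### Strata -/

section

variable {n m : ℕ} {M : Type*}

/-- The exclusion relation `R(p)`: `(i,j)` excludes `k` when `d_{ijk} = 0`. -/
def Excludes (p : Ambient n m M) (i j k : Fin n) : Prop :=
  ∃ t : Conf 3 (Fin n), t.1 0 = i ∧ t.1 1 = j ∧ t.1 2 = k ∧ p.2.2 t = 0

/-- The parenthesization associated to `p`. It consists of the sets
`{i} ∪ {j | (i,j) excludes k}` for all `i`, `k` for which such a `j` exists, together with the set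
of all indices if all the points `x_i` are equal (and there are at least two indices), which
corresponds to adding a new root to the tree. -/
def parenthesization (p : Ambient n m M) : Set (Set (Fin n)) :=
  {A | (∃ i k, (∃ j, Excludes p i j k) ∧ A = {j | j = i ∨ Excludes p i j k}) ∨
    (2 ≤ n ∧ (∀ i j, p.1 i = p.1 j) ∧ A = Set.univ)}

/-- The stratum `C_T(M)`: the points of `C_n[M]` whose associated `f`-tree is `T`, that is,
whose associated parenthesization is the one of `T`. -/
def stratum [TopologicalSpace M] (ε : M ↪ EuclideanSpace ℝ (Fin m)) (T : FTree n) :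
    Set (CompactConf n ε) :=
  {p | parenthesization p.1 = T.parenthesization}

end

/-- A stratification: a finite collection of disjoint locally closed subspaces which cover the
space, such that the closure of each of them is a union of members of the collection. -/
structure IsStratification {X : Type*} [TopologicalSpace X] (S : Set (Set X)) : Prop where
  finite : S.Finite
  nonempty : ∀ A ∈ S, A.Nonempty
  disjoint : S.PairwiseDisjoint id
  cover : ⋃₀ S = Set.univ
  isLocallyClosed : ∀ A ∈ S, IsLocallyClosed A
  closure_eq : ∀ A ∈ S, ∃ S' ⊆ S, closure A = ⋃₀ S'

/-- The morphisms of the category of strata: there is a (unique) morphism from one stratum to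
another if the first is contained in the closure of the second. -/
def StrataHom {X : Type*} [TopologicalSpace X] (S : Set (Set X)) (A B : S) : Prop :=
  A.1 ⊆ closure B.1

/-- The orbit space `X / Σ_n`, with the quotient topology. -/
abbrev OrbitSpace (n : ℕ) (X : Type*) [MulAction (Equiv.Perm (Fin n)) X] : Type _ :=
  Quotient (MulAction.orbitRel (Equiv.Perm (Fin n)) X)

/-- The projection from `X` to `X / Σ_n`. -/
def orbitMap (n : ℕ) {X : Type*} [MulAction (Equiv.Perm (Fin n)) X] (x : X) : OrbitSpace n X :=
  Quotient.mk _ x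

/-- The image in `C_n[M] / Σ_n` of the stratum `C_T(M)`. -/
def orbitStratum {n m : ℕ} {M : Type*} [TopologicalSpace M]
    (ε : M ↪ EuclideanSpace ℝ (Fin m)) [MulAction (Equiv.Perm (Fin n)) (CompactConf n ε)]
    (T : FTree n) : Set (OrbitSpace n (CompactConf n ε)) :=
  orbitMap n '' stratum ε T

/-- The strata of `C_n[M] / Σ_n` are the images of the strata of `C_n[M]`. -/
def orbitStrata {n m : ℕ} {M : Type*} [TopologicalSpace M]
    (ε : M ↪ EuclideanSpace ℝ (Fin m)) [MulAction (Equiv.Perm (Fin n)) (CompactConf n ε)] :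
    Set (Set (OrbitSpace n (CompactConf n ε))) :=
  Set.range (orbitStratum (n := n) ε)

/-- The model with corners `[0,∞)^k ⊆ ℝ^k`. -/
noncomputable abbrev Corners (k : ℕ) :
    ModelWithCorners ℝ (EuclideanSpace ℝ (Fin k)) (EuclideanQuadrant k) :=
  modelWithCornersEuclideanQuadrant k

/-- The codimension of the corner on which `x` lies, in a manifold with corners: the number of
coordinates vanishing at `x` in a chart to `[0,∞)^k` around `x`. -/
noncomputable def cornerCodim (k : ℕ) {X : Type*} [TopologicalSpace X]
    [ChartedSpace (EuclideanQuadrant k) X] (x : X) : ℕ :=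
  {i : Fin k | (chartAt (EuclideanQuadrant k) x x).1 i = 0}.ncard

end FM

open FM

/-!
Around a point `p` of `C_n[M]` the compactification is described by explicit polynomial blow-up
coordinates, one scale for each member of the parenthesization `P` of `p`.

By the definition of the closure, `p` is a limit of configurations, and `d_{ijk} = 0` means that
`|x_i - x_j| = o(|x_i - x_k|)`. Hence `P` is a laminar family (`isLaminar_parenthesization`), and the
sets `A ∈ P` are the clusters of points which come together faster than they approach the others. In
each cluster the least element `a` and a second element `b` are chosen (`Frame`), and, in a chart of
`M`, one coordinate `c` of `u_b - u_a` which is comparable to `|x_b - x_a|`; up to sign, this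
coordinate is the size of the cluster. The quotients `t_A` of the sizes of successive clusters, and
the displacements of the points from their predecessors divided by the sizes of their clusters, form
`n * d` coordinates `CornerData.read`: for each cluster one of the displacement coordinates is
normalized to `± 1`, and its place is taken by the scale `t_A`. The map `blowup` recovers the points,
with `u_i - u_j = (∏ t_A) • blowupDiff`, the product over the clusters `A` which contain `i` and `j`.

Both directions extend smoothly to the boundary. The coordinates `read` are smooth functions of the
coordinates of `A_n[M]` because, by Hadamard's lemma, the differences in a chart are obtained from
the differences in `ℝ^m` by a smooth family of linear maps, so that only directions and ratios are
needed. Conversely the points, directions and ratios are smooth functions `CornerData.param` of the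
corner coordinates, since the common scales cancel and the rescaled differences do not vanish
(`CornerData.diff_read_p_ne_zero`). So `read` and `param` restrict to inverse homeomorphisms between
a neighbourhood of `p` and an open subset of a quadrant, in which a point has as parenthesization the
clusters `A` with `t_A = 0` (`nonempty_cornerChart`). As `param` is an immersion, these charts make
`C_n[M]` an embedded manifold with corners (`isSmoothEmbedding_of_isAdaptedChart`), the stratum of
`P` is locally the corner `t = 0` of codimension the number of clusters, and the closure of the
stratum of `P` consists of the points with parenthesization containing `P`. Each laminar family is
realized by points which move together at polynomial rates (`exists_parenthesization_eq`).

A permutation acts linearly on the ambient coordinates, hence smoothly on every embedded submanifold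
which it preserves. The action is free because the directions along a nontrivial cycle of a
permutation fixing `p` would be equal, although the corresponding differences add up to zero
(`eq_one_of_relabel_eq`). A free action of a finite group on a locally compact Hausdorff space is a
covering, and the charts descend to the quotient (`isManifold_quotient`).

On the side of the trees, the laminar family of an `f`-tree determines it up to isomorphism, all
laminar families occur (`IsLaminar.exists_tree`), the number of internal vertices is the number of
members, and contractions of a tree correspond to the parts of its family (`FTree.hom_iff`). Modulo
the symmetric group, this is the relation of closure between the strata
(`orbitStratum_subset_closure_iff`).
-/

namespace FM

open Set Topology

/-! ### Embedded manifolds with corners -/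

section EmbeddedManifold

variable {V F : Type*} {E : Type} [NormedAddCommGroup V] [NormedSpace ℝ V] [FiniteDimensional ℝ V]
  [NormedAddCommGroup F] [NormedSpace ℝ F] [FiniteDimensional ℝ F]
  [NormedAddCommGroup E] [NormedSpace ℝ E] [FiniteDimensional ℝ E]

/-- A smooth map whose derivative at `v₀` is injective is straightened to the linear inclusion
`v ↦ (v, 0)` by a chart of the target. The complement `F` is prescribed, since Mathlib's notion of
an immersion asks for the same complement at all points. -/
theorem exists_straightening (hdim : Module.finrank ℝ V + Module.finrank ℝ F = Module.finrank ℝ E)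
    {f : V → E} {O : Set V} (hO : IsOpen O) (hf : ContDiffOn ℝ ∞ f O) {v₀ : V} (hv₀ : v₀ ∈ O)
    (hinj : Function.Injective (fderiv ℝ f v₀)) :
    ∃ (L : (V × F) ≃L[ℝ] E) (Ψ : OpenPartialHomeomorph E E) (U : Set V),
      ContDiffOn ℝ ∞ Ψ Ψ.source ∧ ContDiffOn ℝ ∞ Ψ.symm Ψ.target ∧ IsOpen U ∧ v₀ ∈ U ∧ U ⊆ O ∧
        ∀ v ∈ U, f v ∈ Ψ.source ∧ Ψ (f v) = L (v, 0) := by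
  set f' := fderiv ℝ f v₀ with hf'
  -- a complement of the range of the derivative, identified with `F`
  obtain ⟨C, hC⟩ := Submodule.exists_isCompl (LinearMap.range (f' : V →ₗ[ℝ] E))
  have hr : Module.finrank ℝ (LinearMap.range (f' : V →ₗ[ℝ] E)) = Module.finrank ℝ V :=
    LinearMap.finrank_range_of_inj hinj
  have hCF : Module.finrank ℝ F = Module.finrank ℝ C := by
    have := Submodule.finrank_add_eq_of_isCompl hC
    omega
  let j : F ≃ₗ[ℝ] C := LinearEquiv.ofFinrankEq F C hCF
  let L₀ : (V × F) ≃ₗ[ℝ] E :=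
    (LinearEquiv.prodCongr (LinearEquiv.ofInjective (f' : V →ₗ[ℝ] E) hinj) j).trans
      (Submodule.prodEquivOfIsCompl _ _ hC)
  let L : (V × F) ≃L[ℝ] E := L₀.toContinuousLinearEquiv
  have hL : ∀ v c, L (v, c) = f' v + (j c : E) := fun v c => by
    simp [L, L₀]
  let Φ : E → E := fun e => f (L.symm e).1 + L (0, (L.symm e).2)
  let S : Set E := (fun e => (L.symm e).1) ⁻¹' O
  have hS : IsOpen S := hO.preimage (by fun_prop)
  have hΦ : ContDiffOn ℝ ∞ Φ S := by
    refine ContDiffOn.add (hf.comp (t := O) (by fun_prop) fun x hx => hx) ?_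
    have : ContDiff ℝ ∞ fun e => L (0, (L.symm e).2) := by fun_prop
    exact this.contDiffOn
  have hx₀ : L (v₀, 0) ∈ S := by simpa [S] using hv₀
  have hfd : HasFDerivAt Φ ((ContinuousLinearEquiv.refl ℝ E : E ≃L[ℝ] E) : E →L[ℝ] E)
      (L (v₀, 0)) := by
    have h1 : HasFDerivAt f f' ((fun e => (L.symm e).1) (L (v₀, 0))) := by
      simpa using ((hf.contDiffAt (hO.mem_nhds hv₀)).differentiableAt (by simp)).hasFDerivAt
    have h2 : HasFDerivAt (fun e : E => (L.symm e).1)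
        ((ContinuousLinearMap.fst ℝ V F).comp (L.symm : E →L[ℝ] V × F)) (L (v₀, 0)) :=
      ((ContinuousLinearMap.fst ℝ V F).comp (L.symm : E →L[ℝ] V × F)).hasFDerivAt
    have h3 : HasFDerivAt (fun e : E => L (0, (L.symm e).2))
        ((L : V × F →L[ℝ] E).comp ((ContinuousLinearMap.inr ℝ V F).comp
          ((ContinuousLinearMap.snd ℝ V F).comp (L.symm : E →L[ℝ] V × F)))) (L (v₀, 0)) :=
      ((L : V × F →L[ℝ] E).comp ((ContinuousLinearMap.inr ℝ V F).comp
          ((ContinuousLinearMap.snd ℝ V F).comp (L.symm : E →L[ℝ] V × F)))).hasFDerivAt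
    refine ((HasFDerivAt.comp (g := f) (f := fun e : E => (L.symm e).1) _ h1 h2).add h3).congr_fderiv ?_
    ext e
    obtain ⟨⟨v, c⟩, rfl⟩ := L.surjective e
    simp only [add_apply, ContinuousLinearMap.comp_apply,
      ContinuousLinearEquiv.coe_coe, ContinuousLinearEquiv.symm_apply_apply,
      ContinuousLinearMap.coe_fst', ContinuousLinearMap.coe_snd', ContinuousLinearMap.inr_apply,
      ContinuousLinearEquiv.coe_refl', id_eq]
    simp [hL]
  have hΦ₀ : ContDiffAt ℝ ∞ Φ (L (v₀, 0)) := hΦ.contDiffAt (hS.mem_nhds hx₀)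
  let e₀ := hΦ₀.toOpenPartialHomeomorph Φ hfd (by simp)
  have he₀ : (e₀ : E → E) = Φ := rfl
  let S' : Set E := S ∩ fderiv ℝ Φ ⁻¹' range ((↑) : (E ≃L[ℝ] E) → E →L[ℝ] E)
  have hS' : IsOpen S' :=
    (hΦ.continuousOn_fderiv_of_isOpen hS (by simp)).isOpen_inter_preimage hS
      ContinuousLinearEquiv.isOpen
  let e₁ := e₀.restrOpen S' hS'
  have hsrc : e₁.source = e₀.source ∩ S' := rfl
  have hx₁ : L (v₀, 0) ∈ e₁.source :=
    ⟨hΦ₀.mem_toOpenPartialHomeomorph_source hfd (by simp), hx₀, ⟨_, hfd.fderiv.symm⟩⟩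
  refine ⟨L, e₁.symm, (fun v => L (v, (0 : F))) ⁻¹' e₁.source, ?_, ?_,
    e₁.open_source.preimage (by fun_prop), hx₁, ?_, ?_⟩
  · intro y hy
    have hy' : e₁.symm y ∈ e₁.source := e₁.map_target hy
    obtain ⟨A, hA⟩ := hy'.2.2
    refine ContDiffAt.contDiffWithinAt (e₁.contDiffAt_symm (f₀' := A) hy ?_ ?_)
    · rw [hA]
      exact ((hΦ.contDiffAt (hS.mem_nhds hy'.2.1)).differentiableAt (by simp)).hasFDerivAt
    · exact hΦ.contDiffAt (hS.mem_nhds hy'.2.1)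
  · exact hΦ.mono fun x hx => hx.2.1
  · intro v hv
    simpa [S] using hv.2.1
  · intro v hv
    have h1 : e₁ (L (v, 0)) = f v := by
      change Φ (L (v, 0)) = f v
      simp only [Φ, ContinuousLinearEquiv.symm_apply_apply]
      rw [show ((0 : V), (0 : F)) = 0 from rfl, map_zero, add_zero]
    rw [← h1]
    exact ⟨e₁.map_source hv, e₁.left_inv hv⟩

variable {H : Type*} [TopologicalSpace H] (I : ModelWithCorners ℝ V H)
  {X : Type*} [TopologicalSpace X]

/-- A chart `χ` of `X` is adapted to the map `e` into a vector space when `e ∘ χ⁻¹` extends to a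
smooth immersion of an open subset of the vector space `V`. -/
def IsAdaptedChart (e : X → E) (χ : OpenPartialHomeomorph X H) : Prop :=
  ∃ (O : Set V) (f : V → E), IsOpen O ∧ ContDiffOn ℝ ∞ f O ∧
    ∀ h ∈ χ.target, I h ∈ O ∧ Function.Injective (fderiv ℝ f (I h)) ∧ e (χ.symm h) = f (I h)

variable {I}

omit [FiniteDimensional ℝ V] in
theorem finrank_add_complement {f : V →L[ℝ] E} (hf : Function.Injective f) :
    Module.finrank ℝ V + Module.finrank ℝ
      (EuclideanSpace ℝ (Fin (Module.finrank ℝ E - Module.finrank ℝ V))) = Module.finrank ℝ E := by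
  have := LinearMap.finrank_le_finrank_of_injective (f := (f : V →ₗ[ℝ] E)) hf
  simp only [finrank_euclideanSpace, Fintype.card_fin]
  omega

/-- An adapted chart has, locally, a smooth left inverse defined on the ambient space. -/
theorem IsAdaptedChart.exists_leftInverse {e : X → E} {χ : OpenPartialHomeomorph X H}
    (hχ : IsAdaptedChart I e χ) {x : X} (hx : x ∈ χ.source) :
    ∃ ℓ : E → V, ContDiffAt ℝ ∞ ℓ (e x) ∧ ∀ᶠ y in 𝓝 x, ℓ (e y) = I (χ y) := by
  obtain ⟨O, f, hO, hf, h⟩ := hχ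
  obtain ⟨h1, h2, h3⟩ := h _ (χ.map_source hx)
  obtain ⟨L, Ψ, U, hΨ, -, hU, hxU, -, hΨU⟩ :=
    exists_straightening (finrank_add_complement h2) hO hf h1 h2
  rw [χ.left_inv hx] at h3
  refine ⟨fun y => (L.symm (Ψ y)).1, ?_, ?_⟩
  · have h4 : ContDiffAt ℝ ∞ Ψ (e x) := by
      rw [h3]
      exact hΨ.contDiffAt (Ψ.open_source.mem_nhds (hΨU _ hxU).1)
    have h5 : ContDiff ℝ ∞ fun y : E => (L.symm y).1 := by fun_prop
    exact h5.contDiffAt.comp _ h4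
  · have hc : ContinuousAt (fun y => I (χ y)) x :=
      I.continuous.continuousAt.comp (χ.continuousAt hx)
    filter_upwards [hc.preimage_mem_nhds (hU.mem_nhds hxU), χ.open_source.mem_nhds hx] with y hy hys
    have := (h _ (χ.map_source hys)).2.2
    rw [χ.left_inv hys] at this
    rw [this, (hΨU _ hy).2]
    simp

/-- The charted space given by a family of charts. -/
@[reducible]
def chartedSpaceOfCharts (χ : X → OpenPartialHomeomorph X H) (hχ : ∀ x, x ∈ (χ x).source) :
    ChartedSpace H X where
  atlas := range χ
  chartAt := χ
  mem_chart_source := hχ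
  chart_mem_atlas x := ⟨x, rfl⟩

theorem isManifold_of_isAdaptedChart {e : X → E} (χ : X → OpenPartialHomeomorph X H)
    (hχ : ∀ x, x ∈ (χ x).source) (ha : ∀ x, IsAdaptedChart I e (χ x)) :
    letI := chartedSpaceOfCharts χ hχ
    IsManifold I ∞ X := by
  let := chartedSpaceOfCharts χ hχ
  refine isManifold_of_contDiffOn I ∞ X ?_
  rintro _ _ ⟨a, rfl⟩ ⟨b, rfl⟩ _ ⟨hz, ⟨h, rfl⟩⟩
  simp only [mem_preimage, I.left_inv, OpenPartialHomeomorph.trans_source,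
    OpenPartialHomeomorph.symm_source, mem_inter_iff] at hz
  obtain ⟨O, f, hO, hf, hfa⟩ := ha a
  obtain ⟨ℓ, hℓ, hℓe⟩ := (ha b).exists_leftInverse hz.2
  have h1 := hfa h hz.1
  rw [h1.2.2] at hℓ
  have hsm : ContDiffAt ℝ ∞ (ℓ ∘ f) (I h) :=
    hℓ.comp _ (hf.contDiffAt (hO.mem_nhds h1.1))
  refine hsm.contDiffWithinAt.congr_of_eventuallyEq ?_ ?_
  · have hc : ContinuousAt (fun z => (χ a).symm (I.symm z)) (I h) := by
      refine ContinuousAt.comp ?_ I.continuous_symm.continuousAt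
      rw [I.left_inv]
      exact (χ a).continuousAt_symm hz.1
    have hs : I.symm ⁻¹' (χ a).target ∈ 𝓝 (I h) := by
      refine I.continuous_symm.continuousAt.preimage_mem_nhds ?_
      rw [I.left_inv]
      exact (χ a).open_target.mem_nhds hz.1
    rw [← I.left_inv h] at hℓe
    filter_upwards [mem_nhdsWithin_of_mem_nhds (hc.eventually hℓe),
      mem_nhdsWithin_of_mem_nhds hs, self_mem_nhdsWithin] with z hz1 hz2 hz3
    obtain ⟨_, h', rfl⟩ := hz3
    simp only [mem_preimage, I.left_inv] at hz2 hz1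
    have := (hfa h' hz2).2.2
    simp [← hz1, this]
  · have := hℓe.self_of_nhds
    simp [← this, h1.2.2]

theorem isSmoothEmbedding_of_isAdaptedChart {e : X → E} (he : IsEmbedding e)
    (χ : X → OpenPartialHomeomorph X H)
    (hχ : ∀ x, x ∈ (χ x).source) (ha : ∀ x, IsAdaptedChart I e (χ x)) :
    letI := chartedSpaceOfCharts χ hχ
    Manifold.IsSmoothEmbedding I 𝓘(ℝ, E) ∞ e := by
  let := chartedSpaceOfCharts χ hχ
  have := isManifold_of_isAdaptedChart χ hχ ha
  refine ⟨?_, he⟩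
  have key : Manifold.IsImmersionOfComplement
      (EuclideanSpace ℝ (Fin (Module.finrank ℝ E - Module.finrank ℝ V))) I 𝓘(ℝ, E) ∞ e := by
    intro x
    obtain ⟨O, f, hO, hf, h⟩ := ha x
    obtain ⟨h1, h2, h3⟩ := h _ ((χ x).map_source (hχ x))
    obtain ⟨L, Ψ, U, hΨ, hΨs, hU, hxU, -, hΨU⟩ :=
      exists_straightening (finrank_add_complement h2) hO hf h1 h2
    rw [(χ x).left_inv (hχ x)] at h3
    let W : Set X := (χ x).source ∩ (fun y => I (χ x y)) ⁻¹' U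
    have hW : IsOpen W := (I.continuous.comp_continuousOn (χ x).continuousOn).isOpen_inter_preimage
      (χ x).open_source hU
    refine Manifold.IsImmersionAtOfComplement.mk_of_continuousAt he.continuous.continuousAt L
      ((χ x).restrOpen W hW) Ψ ⟨hχ x, hχ x, hxU⟩ ?_ ?_ ?_ ?_
    · rw [h3]
      exact (hΨU _ hxU).1
    · have := restr_mem_maximalAtlas (contDiffGroupoid ∞ I)
        ((contDiffGroupoid ∞ I).chart_mem_maximalAtlas x) hW
      have h5 : (χ x).restr W = (χ x).restrOpen W hW := by
        ext1 <;> simp [hW.interior_eq]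
      rw [← h5]
      exact this
    · exact Ψ.mem_maximalAtlas_of_contMDiffOn hΨ.contMDiffOn hΨs.contMDiffOn
    · intro z hz
      rw [OpenPartialHomeomorph.extend_target_eq_image_source] at hz
      obtain ⟨y, hy, rfl⟩ := hz
      have hy' : y ∈ W := hy.2
      have h6 := (h _ ((χ x).map_source hy'.1)).2.2
      rw [(χ x).left_inv hy'.1] at h6
      simp only [Function.comp_apply]
      rw [OpenPartialHomeomorph.extend_left_inv _ hy, h6]
      exact (hΨU _ hy'.2).2
  exact ⟨_, inferInstance, inferInstance, key⟩

end EmbeddedManifold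

end FM

namespace FM

open Set Topology

/-! ### Quotients of manifolds by free actions -/

section QuotientManifold

variable {V : Type*} [NormedAddCommGroup V] [NormedSpace ℝ V]
  {H : Type*} [TopologicalSpace H] {I : ModelWithCorners ℝ V H}
  {X : Type*} [TopologicalSpace X] [ChartedSpace H X] [IsManifold I ∞ X]
  {G : Type*} [Group G] [MulAction G X]

omit [IsManifold I ∞ X] in
/-- A local inverse of the projection, composed with the projection, agrees locally with the action
of a group element. -/
theorem contMDiffAt_localInverse_comp_quotientMk
    (hsm : ∀ g : G, ContMDiff I I ∞ (fun x : X => g • x))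
    (e : OpenPartialHomeomorph (Quotient (MulAction.orbitRel G X)) X)
    (he : ⇑e.symm = Quotient.mk (MulAction.orbitRel G X)) {x : X}
    (hx : Quotient.mk (MulAction.orbitRel G X) x ∈ e.source) :
    ContMDiffAt I I ∞ (fun y => e (Quotient.mk (MulAction.orbitRel G X) y)) x := by
  have h1 : Quotient.mk (MulAction.orbitRel G X) (e (Quotient.mk _ x)) = Quotient.mk _ x := by
    rw [← he]
    exact e.left_inv (by rwa [he])
  obtain ⟨g, hg⟩ : ∃ g : G, g • x = e (Quotient.mk _ x) := Quotient.exact h1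
  refine (hsm g x).congr_of_eventuallyEq ?_
  have h2 : e.target ∈ 𝓝 (g • x) := by
    rw [hg]
    exact e.open_target.mem_nhds (e.map_source hx)
  filter_upwards [(hsm g).continuous.continuousAt.preimage_mem_nhds h2] with y hy
  have h3 : Quotient.mk (MulAction.orbitRel G X) y = e.symm (g • y) := by
    rw [he]
    exact (Quotient.sound ⟨g, rfl⟩ : Quotient.mk (MulAction.orbitRel G X) (g • y) = _).symm
  rw [h3, e.right_inv hy]

/-- The orbit space of a smooth action for which the projection is a local homeomorphism is a
manifold, with the charts of `X` composed with local inverses of the projection. -/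
theorem isManifold_quotient (hsm : ∀ g : G, ContMDiff I I ∞ (fun x : X => g • x))
    (hπ : IsLocalHomeomorph (Quotient.mk (MulAction.orbitRel G X))) :
    letI := hπ.chartedSpace (H := H) Quotient.mk_surjective
    IsManifold I ∞ (Quotient (MulAction.orbitRel G X)) := by
  let := hπ.chartedSpace (H := H) Quotient.mk_surjective
  refine isManifold_of_contDiffOn I ∞ (Quotient (MulAction.orbitRel G X)) ?_
  suffices key : ∀ a b : X, ContDiffOn ℝ ∞
      (I ∘ ((hπ.localInverseAt a).trans (chartAt H a)).symm.trans
        ((hπ.localInverseAt b).trans (chartAt H b)) ∘ I.symm)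
      (I.symm ⁻¹' (((hπ.localInverseAt a).trans (chartAt H a)).symm.trans
        ((hπ.localInverseAt b).trans (chartAt H b))).source ∩ range I) by
    rintro _ _ ⟨p, rfl⟩ ⟨q, rfl⟩
    exact key _ _
  intro a b
  rw [← contMDiffOn_iff_contDiffOn]
  rintro _ ⟨hz, ⟨h, rfl⟩⟩
  simp only [mem_preimage, I.left_inv, OpenPartialHomeomorph.trans_source,
    OpenPartialHomeomorph.symm_source, OpenPartialHomeomorph.trans_target,
    OpenPartialHomeomorph.coe_trans_symm, Function.comp_apply, mem_inter_iff,
    IsLocalHomeomorph.localInverseAt_symm] at hz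
  obtain ⟨⟨h1, h2⟩, h3, h4⟩ := hz
  have hA : ContMDiffWithinAt 𝓘(ℝ, V) I ∞ (fun z => (chartAt H a).symm (I.symm z)) (range I)
      (I h) := by
    refine contMDiffWithinAt_extChartAt_symm_range a (y := I h) ?_
    simpa [extChartAt_target] using h1
  have hB := contMDiffAt_localInverse_comp_quotientMk hsm _
    (hπ.localInverseAt_symm b) h3
  have hC := contMDiffAt_extChartAt' (I := I) (n := ∞) h4
  have hAB := ContMDiffAt.comp_contMDiffWithinAt_of_eq (x := I h) (hg := hB) hA (by simp)
  have hABC := ContMDiffAt.comp_contMDiffWithinAt_of_eq (x := I h) (hg := hC) hAB (by simp)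
  refine (hABC.mono inter_subset_right).congr (fun z _ => ?_) ?_ <;>
  simp

theorem isLocalDiffeomorph_quotientMk (hsm : ∀ g : G, ContMDiff I I ∞ (fun x : X => g • x))
    (hπ : IsLocalHomeomorph (Quotient.mk (MulAction.orbitRel G X))) :
    letI := hπ.chartedSpace (H := H) Quotient.mk_surjective
    IsLocalDiffeomorph I I ∞ (Quotient.mk (MulAction.orbitRel G X)) := by
  let := hπ.chartedSpace (H := H) Quotient.mk_surjective
  have := isManifold_quotient hsm hπ
  intro x
  let e := hπ.localInverseAt x
  have he : ⇑e.symm = Quotient.mk (MulAction.orbitRel G X) := hπ.localInverseAt_symm x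
  let g := (Quotient.mk_surjective (s := MulAction.orbitRel G X)).hasRightInverse.choose
  have hg : ∀ q, Quotient.mk (MulAction.orbitRel G X) (g q) = q :=
    (Quotient.mk_surjective (s := MulAction.orbitRel G X)).hasRightInverse.choose_spec
  have hchart : ∀ q, chartAt H q = (hπ.localInverseAt (g q)).trans (chartAt H (g q)) :=
    fun q => rfl
  have hself : ∀ q, q ∈ (hπ.localInverseAt (g q)).source := fun q => by
    have := hπ.apply_self_mem_localInverseAt_source (x := g q)
    rwa [hg] at this
  have hself' : ∀ q, hπ.localInverseAt (g q) q = g q := fun q => by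
    have := hπ.localInverseAt_apply_self (x := g q)
    rwa [hg] at this
  refine ⟨⟨e.symm.toPartialEquiv, e.open_target, e.open_source, ?_, ?_⟩,
    hπ.self_mem_localInverseAt_target, ?_⟩
  · suffices ContMDiff I I ∞ (Quotient.mk (MulAction.orbitRel G X)) by
      have h := this.contMDiffOn (s := e.target)
      rw [← he] at h
      exact h
    intro y
    rw [contMDiffAt_iff_target]
    refine ⟨hπ.continuous.continuousAt, ?_⟩
    have hB := contMDiffAt_localInverse_comp_quotientMk hsm _
      (hπ.localInverseAt_symm (g ⟦y⟧)) (hself ⟦y⟧)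
    have hC := contMDiffAt_extChartAt' (I := I) (n := ∞) (mem_chart_source H (g ⟦y⟧))
    have := ContMDiffAt.comp_of_eq (x := y) hC hB (hself' _)
    exact this
  · intro q hq
    refine ContMDiffAt.contMDiffWithinAt ?_
    rw [contMDiffAt_iff_source]
    have hq' : q ∈ e.source := hq
    have h0 : extChartAt I q q = extChartAt I (g q) (g q) := by
      simp [extChartAt, hchart, hself']
    have hA : ContMDiffWithinAt 𝓘(ℝ, V) I ∞ (extChartAt I (g q)).symm (range I)
        (extChartAt I q q) := by
      rw [h0]
      exact contMDiffWithinAt_extChartAt_symm_range (g q) (mem_extChartAt_target _)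
    have hE : ∀ z, (e.symm.invFun ∘ (extChartAt I q).symm) z =
        ((fun y => e (Quotient.mk (MulAction.orbitRel G X) y)) ∘ (extChartAt I (g q)).symm) z := by
      intro z
      change e ((hπ.localInverseAt (g q)).symm ((extChartAt I (g q)).symm z)) = _
      rw [hπ.localInverseAt_symm]
      rfl
    have hB := contMDiffAt_localInverse_comp_quotientMk hsm e he (x := g q) (by rwa [hg])
    have := ContMDiffAt.comp_contMDiffWithinAt_of_eq (x := extChartAt I q q) (hg := hB) hA
      (by rw [h0]; exact extChartAt_to_inv (g q))
    refine this.congr_of_eventuallyEq (Filter.Eventually.of_forall hE) (hE _)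
  · intro y hy
    exact (congrFun he y).symm

end QuotientManifold

end FM

namespace FM

open Set Topology

/-! ### Local parametrizations of the submanifold -/

section Hadamard

/-- Differentiation under the integral sign for a smooth integrand on `[0,1]`. -/
theorem hasFDerivAt_integral_of_contDiff {P B : Type} [NormedAddCommGroup P] [NormedSpace ℝ P]
    [FiniteDimensional ℝ P] [NormedAddCommGroup B] [NormedSpace ℝ B] [CompleteSpace B]
    {G : P × ℝ → B} (hG : ContDiff ℝ ∞ G) (p : P) :
    HasFDerivAt (fun p => ∫ t in (0 : ℝ)..1, G (p, t))
      (∫ t in (0 : ℝ)..1, (fderiv ℝ G (p, t)).comp (ContinuousLinearMap.inl ℝ P ℝ)) p := by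
  have hF : Continuous fun q : P × ℝ => (fderiv ℝ G q).comp (ContinuousLinearMap.inl ℝ P ℝ) :=
    (hG.continuous_fderiv (by simp)).clm_comp continuous_const
  obtain ⟨C, hC⟩ := ((isCompact_closedBall p (1 : ℝ)).prod
    (isCompact_Icc (a := (0 : ℝ)) (b := 1))).exists_bound_of_continuousOn hF.continuousOn
  refine intervalIntegral.hasFDerivAt_integral_of_dominated_of_fderiv_le (bound := fun _ => C)
    (Metric.closedBall_mem_nhds p one_pos) (F' := fun p t => (fderiv ℝ G (p, t)).comp
      (ContinuousLinearMap.inl ℝ P ℝ)) ?_ ?_ ?_ ?_ ?_ ?_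
  · exact Filter.Eventually.of_forall fun q =>
      (hG.continuous.comp (by fun_prop)).aestronglyMeasurable
  · exact (hG.continuous.comp (by fun_prop)).intervalIntegrable _ _
  · exact (hF.comp (by fun_prop : Continuous fun t : ℝ => (p, t))).aestronglyMeasurable
  · refine Filter.Eventually.of_forall fun t ht x hx => hC (x, t) ⟨hx, ?_⟩
    rw [uIoc_of_le zero_le_one] at ht
    exact ⟨ht.1.le, ht.2⟩
  · exact intervalIntegrable_const
  · refine Filter.Eventually.of_forall fun t _ x _ => ?_
    have h1 := (hG.differentiable (by simp) (x, t)).hasFDerivAt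
    have h2 : HasFDerivAt (fun x : P => (x, t)) (ContinuousLinearMap.inl ℝ P ℝ) x :=
      hasFDerivAt_prodMk_left x t
    exact HasFDerivAt.comp (g := G) x h1 h2

theorem contDiff_nat_integral {P : Type} [NormedAddCommGroup P] [NormedSpace ℝ P]
    [FiniteDimensional ℝ P] (k : ℕ) : ∀ {B : Type} [NormedAddCommGroup B] [NormedSpace ℝ B]
    [CompleteSpace B] {G : P × ℝ → B}, ContDiff ℝ ∞ G →
    ContDiff ℝ k (fun p => ∫ t in (0 : ℝ)..1, G (p, t)) := by
  induction k with
  | zero =>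
    intro B _ _ _ G hG
    simp only [CharP.cast_eq_zero, contDiff_zero]
    exact continuous_iff_continuousAt.2 fun p =>
      (hasFDerivAt_integral_of_contDiff hG p).continuousAt
  | succ k ih =>
    intro B _ _ _ G hG
    push_cast
    rw [contDiff_succ_iff_fderiv]
    refine ⟨fun p => (hasFDerivAt_integral_of_contDiff hG p).differentiableAt, by simp, ?_⟩
    rw [show fderiv ℝ (fun p => ∫ t in (0 : ℝ)..1, G (p, t)) = _ from
      funext fun p => (hasFDerivAt_integral_of_contDiff hG p).fderiv]
    exact ih ((hG.fderiv_right (by simp)).clm_comp contDiff_const)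

/-- Hadamard's lemma: the increment of a smooth map depends on the increment of its variable
through a smooth family of linear maps. -/
theorem exists_hadamard {A B : Type} [NormedAddCommGroup A] [NormedSpace ℝ A]
    [FiniteDimensional ℝ A] [NormedAddCommGroup B] [NormedSpace ℝ B] [CompleteSpace B]
    {φ : A → B} (hφ : ContDiff ℝ ∞ φ) :
    ∃ D : A × A → A →L[ℝ] B, ContDiff ℝ ∞ D ∧ ∀ u v, φ u - φ v = D (u, v) (u - v) := by
  let G : (A × A) × ℝ → A →L[ℝ] B := fun q => fderiv ℝ φ (q.1.2 + q.2 • (q.1.1 - q.1.2))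
  have hG : ContDiff ℝ ∞ G := (hφ.fderiv_right (by simp)).comp (by fun_prop)
  refine ⟨fun p => ∫ t in (0 : ℝ)..1, G (p, t), contDiff_infty.2 fun k =>
    contDiff_nat_integral k hG, fun u v => ?_⟩
  have h1 : ∀ t : ℝ, HasDerivAt (fun t : ℝ => φ (v + t • (u - v)))
      (fderiv ℝ φ (v + t • (u - v)) (u - v)) t := by
    intro t
    have h2 : HasDerivAt (fun t : ℝ => v + t • (u - v)) (u - v) t := by
      simpa using ((hasDerivAt_id t).smul_const (u - v)).const_add v
    exact (hφ.differentiable (by simp) _).hasFDerivAt.comp_hasDerivAt t h2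
  have hc : Continuous fun t : ℝ => G ((u, v), t) := hG.continuous.comp (by fun_prop)
  have h3 := intervalIntegral.integral_eq_sub_of_hasDerivAt (a := 0) (b := 1) (fun t _ => h1 t)
    ((hc.clm_apply continuous_const).intervalIntegrable _ _)
  simp only [one_smul, zero_smul, add_zero, add_sub_cancel] at h3
  rw [← h3, ContinuousLinearMap.intervalIntegral_apply (hc.intervalIntegrable _ _)]

end Hadamard

/-- A map which is smooth near a point agrees near that point with a smooth map defined
everywhere. -/
theorem exists_contDiff_eventuallyEq {A B : Type*} [NormedAddCommGroup A] [NormedSpace ℝ A]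
    [FiniteDimensional ℝ A] [NormedAddCommGroup B] [NormedSpace ℝ B]
    {f : A → B} {U : Set A} (hU : IsOpen U) (hf : ContDiffOn ℝ ∞ f U) {a : A} (ha : a ∈ U) :
    ∃ g : A → B, ContDiff ℝ ∞ g ∧ ∀ᶠ y in 𝓝 a, g y = f y := by
  obtain ⟨r, hr, hrU⟩ := Metric.isOpen_iff.1 hU a ha
  let b : ContDiffBump a := ⟨r / 3, r / 2, by positivity, by linarith⟩
  refine ⟨fun x => b x • f x, ?_, ?_⟩
  · rw [contDiff_iff_contDiffAt]
    intro x
    by_cases hx : x ∈ Metric.ball a r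
    · exact b.contDiffAt.smul (hf.contDiffAt (hU.mem_nhds (hrU hx)))
    · have h1 : x ∉ tsupport b := by
        rw [b.tsupport_eq]
        intro h
        exact hx (Metric.closedBall_subset_ball (by change r / 2 < r; linarith) h)
      have h2 : (fun x => b x • f x) =ᶠ[𝓝 x] fun _ => 0 := by
        filter_upwards [(isClosed_tsupport b).isOpen_compl.mem_nhds h1] with y hy
        rw [image_eq_zero_of_notMem_tsupport hy, zero_smul]
      exact contDiffAt_const.congr_of_eventuallyEq h2
  · filter_upwards [b.eventuallyEq_one] with y hy
    simp only [Pi.one_apply] at hy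
    rw [hy, one_smul]

/-- Around every point, an embedded manifold has a chart whose inverse and which itself extend to
smooth maps defined on the whole vector spaces. -/
theorem exists_globalized_chart {d m : ℕ} {M : Type*} [TopologicalSpace M]
    [ChartedSpace (EuclideanSpace ℝ (Fin d)) M] [IsManifold (𝓡 d) ∞ M]
    {ε : M → EuclideanSpace ℝ (Fin m)} (hε : Manifold.IsSmoothEmbedding (𝓡 d) (𝓡 m) ∞ ε) (a : M) :
    ∃ (ψ : OpenPartialHomeomorph M (EuclideanSpace ℝ (Fin d)))
      (φ : EuclideanSpace ℝ (Fin d) → EuclideanSpace ℝ (Fin m))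
      (χ : EuclideanSpace ℝ (Fin m) → EuclideanSpace ℝ (Fin d)),
      a ∈ ψ.source ∧ ContDiff ℝ ∞ φ ∧ ContDiff ℝ ∞ χ ∧
        ∀ x ∈ ψ.source, φ (ψ x) = ε x ∧ χ (ε x) = ψ x := by
  have h := hε.isImmersion.isImmersionAt a
  let ψ := h.domChart
  let Ψ := h.codChart
  let L := h.equiv
  have hw : ∀ x ∈ ψ.source, Ψ (ε x) = L (ψ x, 0) := by
    intro x hx
    have h0 : ψ x ∈ (ψ.extend (𝓡 d)).target := by simpa using ψ.map_source hx
    have := h.writtenInCharts h0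
    have h1 : h.domChart.symm (ψ x) = x := ψ.left_inv hx
    simpa [h1] using this
  have hΨ : ∀ x ∈ ψ.source, ε x ∈ Ψ.source := fun x hx => h.source_subset_preimage_source hx
  have hΨ1 : ContDiffOn ℝ ∞ Ψ Ψ.source :=
    (contMDiffOn_of_mem_maximalAtlas h.codChart_mem_maximalAtlas).contDiffOn
  have hΨ2 : ContDiffOn ℝ ∞ Ψ.symm Ψ.target :=
    (contMDiffOn_symm_of_mem_maximalAtlas h.codChart_mem_maximalAtlas).contDiffOn
  have ha : a ∈ ψ.source := h.mem_domChart_source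
  have hL : ContDiff ℝ ∞ fun u => L (u, 0) := by fun_prop
  obtain ⟨φ, hφ, hφe⟩ := exists_contDiff_eventuallyEq (f := fun u => Ψ.symm (L (u, 0)))
    (U := (fun u => L (u, 0)) ⁻¹' Ψ.target) (Ψ.open_target.preimage hL.continuous)
    (hΨ2.comp hL.contDiffOn fun u hu => hu) (a := ψ a) (by
      rw [mem_preimage, ← hw a ha]; exact Ψ.map_source (hΨ a ha))
  have hL' : ContDiff ℝ ∞ fun y => (L.symm y).1 := by fun_prop
  obtain ⟨χ, hχ, hχe⟩ := exists_contDiff_eventuallyEq (f := fun y => (L.symm (Ψ y)).1)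
    Ψ.open_source (hL'.comp_contDiffOn hΨ1) (hΨ a ha)
  have h1 : ∀ᶠ x in 𝓝 a, φ (ψ x) = Ψ.symm (L (ψ x, 0)) :=
    (ψ.continuousAt ha).eventually hφe
  have h2 : ∀ᶠ x in 𝓝 a, χ (ε x) = (L.symm (Ψ (ε x))).1 :=
    hε.isEmbedding.continuous.continuousAt.eventually hχe
  obtain ⟨W, hW, hWo, haW⟩ := eventually_nhds_iff.1 (h1.and h2)
  refine ⟨ψ.restrOpen W hWo, φ, χ, ⟨ha, haW⟩, hφ, hχ, ?_⟩
  rintro x ⟨hx, hxW⟩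
  obtain ⟨h3, h4⟩ := hW x hxW
  refine ⟨?_, ?_⟩
  · change φ (ψ x) = ε x
    rw [h3, ← hw x hx, Ψ.left_inv (hΨ x hx)]
  · change χ (ε x) = ψ x
    rw [h4, hw x hx]
    simp

end FM

namespace FM

open Set Topology

/-! ### Laminar families and polynomial blow-up coordinates -/

section Laminar

open scoped Classical in
/-- A laminar family of subsets of `{1,…,n}`: each member has at least two elements, and two
members which meet are nested. -/
structure IsLaminar {n : ℕ} (P : Finset (Set (Fin n))) : Prop where
  nontrivial : ∀ A ∈ P, A.Nontrivial
  nested : ∀ A ∈ P, ∀ B ∈ P, ∀ i, i ∈ A → i ∈ B → A ⊆ B ∨ B ⊆ A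

variable {n : ℕ} (P : Finset (Set (Fin n)))

open scoped Classical in
/-- The members of `P` in which `k` is not the least element. -/
noncomputable def up (k : Fin n) : Finset (Set (Fin n)) := {B ∈ P | k ∈ B ∧ ∃ j ∈ B, j < k}

open scoped Classical in
/-- The index `i` together with the least elements of the members of `P` which contain `i`. -/
noncomputable def anc (i : Fin n) : Finset (Fin n) := {k | k = i ∨ ∃ B ∈ P, i ∈ B ∧ IsLeast B k}

open scoped Classical in
/-- The members of `P` which contain both `i` and `j`. -/
noncomputable def common (i j : Fin n) : Finset (Set (Fin n)) := {B ∈ P | i ∈ B ∧ j ∈ B}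

open scoped Classical in
/-- The members of `P` which contain `A`. -/
noncomputable def above (A : Set (Fin n)) : Finset (Set (Fin n)) := {B ∈ P | A ⊆ B}

open scoped Classical in
/-- The members of `P` which contain `A` strictly. -/
noncomputable def sabove (A : Set (Fin n)) : Finset (Set (Fin n)) := {B ∈ P | A ⊂ B}

variable {P} {i j k : Fin n} {A B : Set (Fin n)}

theorem mem_up : B ∈ up P k ↔ B ∈ P ∧ k ∈ B ∧ ∃ j ∈ B, j < k := by simp [up]

theorem mem_anc : k ∈ anc P i ↔ k = i ∨ ∃ B ∈ P, i ∈ B ∧ IsLeast B k := by simp [anc]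

theorem mem_common : B ∈ common P i j ↔ B ∈ P ∧ i ∈ B ∧ j ∈ B := by simp [common]

theorem mem_above : B ∈ above P A ↔ B ∈ P ∧ A ⊆ B := by simp [above]

theorem mem_sabove : B ∈ sabove P A ↔ B ∈ P ∧ A ⊂ B := by simp [sabove]

theorem common_comm : common P i j = common P j i := by
  ext B
  simp only [mem_common]
  tauto

theorem exists_isLeast (hA : A.Nonempty) : ∃ k, IsLeast A k := by
  obtain ⟨k, hk, h⟩ := A.toFinite.exists_minimal hA
  exact ⟨k, hk, fun j hj => (le_total k j).elim id fun h' => h hj h'⟩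

namespace IsLaminar

variable (hP : IsLaminar P)
include hP

theorem sabove_eq_above_min (hA : A ∈ P) (h : (sabove P A).Nonempty) :
    ∃ B ∈ P, A ⊂ B ∧ sabove P A = above P B := by
  obtain ⟨B, hB, hmin⟩ := (sabove P A).exists_minimal h
  obtain ⟨hB, hAB⟩ := mem_sabove.1 hB
  obtain ⟨i, hi⟩ := (hP.nontrivial A hA).nonempty
  refine ⟨B, hB, hAB, Finset.ext fun C => ?_⟩
  rw [mem_sabove, mem_above]
  refine and_congr_right fun hC => ⟨fun hAC => ?_, fun hBC => hAB.trans_subset hBC⟩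
  rcases hP.nested B hB C hC i (hAB.1 hi) (hAC.1 hi) with h1 | h1
  · exact h1
  · exact hmin (mem_sabove.2 ⟨hC, hAC⟩) h1

theorem up_eq_above_min (h : (up P k).Nonempty) :
    ∃ A ∈ P, k ∈ A ∧ (∃ j ∈ A, j < k) ∧ up P k = above P A := by
  obtain ⟨A, hA, hmin⟩ := (up P k).exists_minimal h
  obtain ⟨hA, hkA, j, hj, hjk⟩ := mem_up.1 hA
  refine ⟨A, hA, hkA, ⟨j, hj, hjk⟩, Finset.ext fun C => ?_⟩
  rw [mem_up, mem_above]
  refine and_congr_right fun hC => ⟨fun ⟨hkC, hjC⟩ => ?_, fun h => ⟨h hkA, j, h hj, hjk⟩⟩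
  rcases hP.nested A hA C hC k hkA hkC with h1 | h1
  · exact h1
  · exact hmin (mem_up.2 ⟨hC, hkC, hjC⟩) h1

omit hP in
theorem above_eq_cons (hA : A ∈ P) :
    above P A = Finset.cons A (sabove P A) (fun h => (mem_sabove.1 h).2.ne rfl) := by
  refine Finset.ext fun C => ?_
  rw [Finset.mem_cons, mem_above, mem_sabove, ssubset_iff_subset_ne]
  constructor
  · rintro ⟨h1, h2⟩
    by_cases h : C = A
    · exact Or.inl h
    · exact Or.inr ⟨h1, h2, Ne.symm h⟩
  · rintro (rfl | ⟨h1, h2, -⟩)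
    · exact ⟨hA, Subset.rfl⟩
    · exact ⟨h1, h2⟩

/-- The chain of least elements above `k` starts with `k` and continues with the chain above the
least element of the smallest member of `P` in which `k` is not the least element. -/
theorem anc_eq_insert {a : Fin n} (hA : A ∈ P) (hkA : k ∈ A) (hup : up P k = above P A)
    (ha : IsLeast A a) (hak : a < k) : k ∉ anc P a ∧ anc P k = insert k (anc P a) := by
  constructor
  · rw [mem_anc]
    rintro (h | ⟨B, -, haB, hB⟩)
    · exact hak.ne h.symm
    · exact (hB.2 haB).not_gt hak
  · ext l
    rw [Finset.mem_insert, mem_anc, mem_anc]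
    constructor
    · rintro (rfl | ⟨B, hB, hkB, hl⟩)
      · exact Or.inl rfl
      · rcases (hl.2 hkB).eq_or_lt with h | h
        · exact Or.inl h
        · have : B ∈ above P A := by
            rw [← hup, mem_up]
            exact ⟨hB, hkB, l, hl.1, h⟩
          exact Or.inr (Or.inr ⟨B, hB, (mem_above.1 this).2 ha.1, hl⟩)
    · rintro (rfl | rfl | ⟨B, hB, haB, hl⟩)
      · exact Or.inl rfl
      · exact Or.inr ⟨A, hA, hkA, ha⟩
      · rcases hP.nested A hA B hB a ha.1 haB with h | h
        · exact Or.inr ⟨B, hB, h hkA, hl⟩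
        · have : l = a := le_antisymm (hl.2 haB) (ha.2 (h hl.1))
          exact Or.inr ⟨A, hA, hkA, this ▸ ha⟩

omit hP in
theorem anc_eq_singleton (hup : up P k = ∅) : anc P k = {k} := by
  ext l
  rw [Finset.mem_singleton, mem_anc]
  refine ⟨?_, Or.inl⟩
  rintro (h | ⟨B, hB, hkB, hl⟩)
  · exact h
  · by_contra hne
    have : B ∈ up P k := mem_up.2 ⟨hB, hkB, l, hl.1, lt_of_le_of_ne (hl.2 hkB) hne⟩
    simp [hup] at this

theorem common_subset_up (hi : k ∈ anc P i) (hj : k ∉ anc P j) : common P i j ⊆ up P k := by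
  intro B hB
  obtain ⟨hB, hiB, hjB⟩ := mem_common.1 hB
  have key : k ∈ B → B ∈ up P k := by
    intro hkB
    refine mem_up.2 ⟨hB, hkB, ?_⟩
    by_contra h
    push Not at h
    exact hj (mem_anc.2 (Or.inr ⟨B, hB, hjB, hkB, h⟩))
  rcases mem_anc.1 hi with rfl | ⟨C, hC, hiC, hk⟩
  · exact key hiB
  · rcases hP.nested B hB C hC i hiB hiC with h | h
    · exact absurd (mem_anc.2 (Or.inr ⟨C, hC, h hjB, hk⟩)) hj
    · exact key (h hk.1)

/-- In every member `A` of a laminar family there is an element whose smallest member in which it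
is not the least element is `A` itself. -/
theorem exists_up_eq_above (hA : A ∈ P) : ∃ b ∈ A, (∃ j ∈ A, j < b) ∧ up P b = above P A := by
  obtain ⟨a, ha⟩ := exists_isLeast (hP.nontrivial A hA).nonempty
  -- the elements of `A` which lie in another child of `A` than the least element `a`
  let S : Set (Fin n) := {b | b ∈ A ∧ b ≠ a ∧ ∀ B ∈ P, B ⊂ A → a ∈ B → b ∉ B}
  have hS : S.Nonempty := by
    by_contra hS
    rw [Set.not_nonempty_iff_eq_empty] at hS
    have h1 : ∀ b ∈ A, b ≠ a → ∃ B ∈ P, B ⊂ A ∧ a ∈ B ∧ b ∈ B := by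
      intro b hb hba
      by_contra h
      have : b ∈ S := ⟨hb, hba, fun B h1 h2 h3 h4 => h ⟨B, h1, h2, h3, h4⟩⟩
      rw [hS] at this
      exact this
    obtain ⟨x, hx, hxa⟩ := (hP.nontrivial A hA).exists_ne a
    obtain ⟨B, hB, hmax⟩ := Set.Finite.exists_maximal
      (s := {B | B ∈ P ∧ B ⊂ A ∧ a ∈ B}) (Set.toFinite _)
      (by obtain ⟨B, h2, h3, h4, -⟩ := h1 x hx hxa; exact ⟨B, h2, h3, h4⟩)
    refine hB.2.1.2 fun b hb => ?_
    by_cases hba : b = a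
    · exact hba ▸ hB.2.2
    obtain ⟨C, hC, hCA, haC, hbC⟩ := h1 b hb hba
    rcases hP.nested B hB.1 C hC a hB.2.2 haC with h | h
    · exact hmax ⟨hC, hCA, haC⟩ h hbC
    · exact h hbC
  obtain ⟨b, hb⟩ := exists_isLeast hS
  have hab : a < b := lt_of_le_of_ne (ha.2 hb.1.1) hb.1.2.1.symm
  refine ⟨b, hb.1.1, ⟨a, ha.1, hab⟩, Finset.ext fun B => ?_⟩
  rw [mem_up, mem_above]
  refine and_congr_right fun hB => ⟨?_, fun h => ⟨h hb.1.1, a, h ha.1, hab⟩⟩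
  rintro ⟨hbB, j, hj, hjb⟩
  rcases hP.nested A hA B hB b hb.1.1 hbB with h | h
  · exact h
  by_contra hAB
  have haB : a ∉ B := fun h' => hb.1.2.2 B hB ⟨h, hAB⟩ h' hbB
  refine (hb.2 (⟨h hj, fun e => haB (e ▸ hj), fun C hC hCA haC hjC => ?_⟩ : j ∈ S)).not_gt hjb
  rcases hP.nested B hB C hC j hj hjC with h' | h'
  · exact hb.1.2.2 C hC hCA haC (h' hbB)
  · exact haB (h' haC)

end IsLaminar


/-- A choice, for every member `A` of a family, of its least element `a A` and of an element `b A`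
for which `A` is the smallest member in which it is not the least element. The difference
`x_{b A} - x_{a A}` measures the size of the cluster of points with labels in `A`. -/
structure Frame (P : Finset (Set (Fin n))) where
  /-- the least element -/
  a : Set (Fin n) → Fin n
  /-- a second element -/
  b : Set (Fin n) → Fin n
  isLeast : ∀ A ∈ P, IsLeast A (a A)
  b_mem : ∀ A ∈ P, b A ∈ A
  lt : ∀ A ∈ P, a A < b A
  up_b : ∀ A ∈ P, up P (b A) = above P A

theorem IsLaminar.nonempty_frame [NeZero n] (hP : IsLaminar P) : Nonempty (Frame P) := by
  have h1 : ∀ A : Set (Fin n), ∃ a, A ∈ P → IsLeast A a := fun A => by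
    by_cases hA : A ∈ P
    · obtain ⟨a, ha⟩ := exists_isLeast (hP.nontrivial A hA).nonempty
      exact ⟨a, fun _ => ha⟩
    · exact ⟨0, fun h => absurd h hA⟩
  have h2 : ∀ A : Set (Fin n), ∃ b, A ∈ P → b ∈ A ∧ (∃ j ∈ A, j < b) ∧ up P b = above P A :=
    fun A => by
    by_cases hA : A ∈ P
    · obtain ⟨b, hb⟩ := hP.exists_up_eq_above hA
      exact ⟨b, fun _ => hb⟩
    · exact ⟨0, fun h => absurd h hA⟩
  choose a ha using h1
  choose b hb using h2
  refine ⟨⟨a, b, ha, fun A hA => (hb A hA).1, fun A hA => ?_, fun A hA => (hb A hA).2.2⟩⟩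
  obtain ⟨j, hj, hjb⟩ := (hb A hA).2.1
  exact ((ha A hA).2 hj).trans_lt hjb

namespace Frame

variable (F : Frame P)

theorem b_injOn (hA : A ∈ P) (hB : B ∈ P) (h : F.b A = F.b B) : A = B := by
  have h1 : above P A = above P B := by rw [← F.up_b A hA, ← F.up_b B hB, h]
  have h2 : A ∈ above P B := h1 ▸ mem_above.2 ⟨hA, Subset.rfl⟩
  have h3 : B ∈ above P A := h1 ▸ mem_above.2 ⟨hB, Subset.rfl⟩
  exact (mem_above.1 h3).2.antisymm (mem_above.1 h2).2

theorem common_a_b (hA : A ∈ P) : common P (F.a A) (F.b A) = above P A := by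
  ext B
  rw [mem_common, mem_above]
  refine and_congr_right fun hB => ⟨fun ⟨h1, h2⟩ => ?_, fun h =>
    ⟨h (F.isLeast A hA).1, h (F.b_mem A hA)⟩⟩
  have : B ∈ above P A := F.up_b A hA ▸ mem_up.2 ⟨hB, h2, _, h1, F.lt A hA⟩
  exact (mem_above.1 this).2

end Frame

/-! ### The blow-up map and its inverse -/

section Blowup

variable {V : Type*} [AddCommGroup V] [Module ℝ V]

variable (P) in
/-- The points `u_i` with scales `t` and shapes `y`: the point `u_k` is displaced by `y_k`, scaled
by the product of the `t_B` over `B ∈ up P k`, from its predecessor in the chain `anc P k`. -/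
noncomputable def blowup (t : Set (Fin n) → ℝ) (y : Fin n → V) (i : Fin n) : V :=
  ∑ k ∈ anc P i, (∏ B ∈ up P k, t B) • y k

open scoped Classical in
variable (P) in
/-- The difference `u_i - u_j` of two points of `blowup P t y`, divided by its scale. -/
noncomputable def blowupDiff (t : Set (Fin n) → ℝ) (y : Fin n → V) (i j : Fin n) : V :=
  ∑ k ∈ anc P i \ anc P j, (∏ B ∈ up P k \ common P i j, t B) • y k -
    ∑ k ∈ anc P j \ anc P i, (∏ B ∈ up P k \ common P i j, t B) • y k

theorem blowup_sub_blowup (hP : IsLaminar P) (t : Set (Fin n) → ℝ) (y : Fin n → V) (i j : Fin n) :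
    blowup P t y i - blowup P t y j = (∏ B ∈ common P i j, t B) • blowupDiff P t y i j := by
  classical
  rw [blowup, blowup, ← Finset.sum_sdiff_sub_sum_sdiff, blowupDiff, smul_sub, Finset.smul_sum,
    Finset.smul_sum]
  congr 1 <;> refine Finset.sum_congr rfl fun k hk => ?_ <;>
    rw [Finset.mem_sdiff] at hk <;> rw [smul_smul]
  · rw [mul_comm, Finset.prod_sdiff (hP.common_subset_up hk.1 hk.2)]
  · rw [mul_comm, Finset.prod_sdiff]
    rw [common_comm]
    exact hP.common_subset_up hk.1 hk.2

/-- The displacement of `u_k` from its predecessor is its scaled shape. -/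
theorem blowup_sub_of_up (hP : IsLaminar P) (t : Set (Fin n) → ℝ) (y : Fin n → V) {a : Fin n}
    (hA : A ∈ P) (hkA : k ∈ A) (hup : up P k = above P A) (ha : IsLeast A a) (hak : a < k) :
    blowup P t y k - blowup P t y a = (∏ B ∈ up P k, t B) • y k := by
  obtain ⟨h1, h2⟩ := hP.anc_eq_insert hA hkA hup ha hak
  rw [blowup, h2, Finset.sum_insert h1, blowup]
  abel

theorem blowup_of_up_eq_empty (t : Set (Fin n) → ℝ) (y : Fin n → V) (hup : up P k = ∅) :
    blowup P t y k = y k := by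
  rw [blowup, IsLaminar.anc_eq_singleton hup]
  simp [hup]

open scoped Classical in
/-- The displacement of `u_k` from its predecessor, or `u_k` if there is none. The smallest member
of the chain `up P k` is written as the intersection of the chain. -/
noncomputable def Frame.disp (F : Frame P) (u : Fin n → V) (k : Fin n) : V :=
  if up P k = ∅ then u k else u k - u (F.a (⋂₀ (up P k : Set (Set (Fin n)))))

open scoped Classical in
/-- The value of `σ` at the smallest member of a chain of sets, and `1` for the empty chain. -/
noncomputable def chainScale (σ : Set (Fin n) → ℝ) (Q : Finset (Set (Fin n))) : ℝ :=
  if Q = ∅ then 1 else σ (⋂₀ (Q : Set (Set (Fin n))))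

theorem sInter_above (hA : A ∈ P) : ⋂₀ (above P A : Set (Set (Fin n))) = A := by
  apply Subset.antisymm
  · exact sInter_subset_of_mem (by simpa using mem_above.2 ⟨hA, Subset.rfl⟩)
  · refine subset_sInter fun B hB => ?_
    exact (mem_above.1 (by simpa using hB)).2

theorem above_nonempty (hA : A ∈ P) : above P A ≠ ∅ :=
  Finset.ne_empty_of_mem (mem_above.2 ⟨hA, Subset.rfl⟩)

theorem chainScale_above (σ : Set (Fin n) → ℝ) (hA : A ∈ P) : chainScale σ (above P A) = σ A := by
  rw [chainScale, if_neg (above_nonempty hA), sInter_above hA]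

/-- The quotients of the successive scales of a chain multiply to the smallest scale. -/
theorem prod_above_div (hP : IsLaminar P) (σ : Set (Fin n) → ℝ) (hσ : ∀ A ∈ P, σ A ≠ 0) :
    ∀ A ∈ P, ∏ B ∈ above P A, (σ B / chainScale σ (sabove P B)) = σ A := by
  suffices h : ∀ (r : ℕ) (A : Set (Fin n)), A ∈ P → (sabove P A).card = r →
      ∏ B ∈ above P A, (σ B / chainScale σ (sabove P B)) = σ A from
    fun A hA => h _ A hA rfl
  intro r
  induction r using Nat.strong_induction_on with
  | _ r ih =>
    rintro A hA rfl
    rw [IsLaminar.above_eq_cons hA, Finset.prod_cons]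
    rcases (sabove P A).eq_empty_or_nonempty with h | h
    · simp [h, chainScale]
    · obtain ⟨B, hB, hAB, h'⟩ := hP.sabove_eq_above_min hA h
      have hc : (sabove P B).card < (sabove P A).card := by
        rw [h', IsLaminar.above_eq_cons hB, Finset.card_cons]
        exact Nat.lt_succ_self _
      rw [h', ih _ hc B hB rfl, chainScale_above σ hB, div_mul_cancel₀ _ (hσ B hB)]

theorem prod_up_div (hP : IsLaminar P) (σ : Set (Fin n) → ℝ) (hσ : ∀ A ∈ P, σ A ≠ 0) (k : Fin n) :
    ∏ B ∈ up P k, (σ B / chainScale σ (sabove P B)) = chainScale σ (up P k) := by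
  rcases (up P k).eq_empty_or_nonempty with h | h
  · simp [h, chainScale]
  · obtain ⟨A, hA, -, -, h'⟩ := hP.up_eq_above_min h
    rw [h', prod_above_div hP σ hσ A hA, chainScale_above σ hA]

theorem chainScale_ne_zero {σ : Set (Fin n) → ℝ} (hP : IsLaminar P) (hσ : ∀ A ∈ P, σ A ≠ 0)
    (k : Fin n) : chainScale σ (up P k) ≠ 0 := by
  rcases (up P k).eq_empty_or_nonempty with h | h
  · simp [h, chainScale]
  · obtain ⟨A, hA, -, -, h'⟩ := hP.up_eq_above_min h
    rw [h', chainScale_above σ hA]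
    exact hσ A hA

/-- Points with nonzero cluster sizes are recovered from their scales and shapes. -/
theorem blowup_disp (hP : IsLaminar P) (F : Frame P) (σ : Set (Fin n) → ℝ)
    (hσ : ∀ A ∈ P, σ A ≠ 0) (u : Fin n → V) (i : Fin n) :
    blowup P (fun A => σ A / chainScale σ (sabove P A))
      (fun k => (chainScale σ (up P k))⁻¹ • F.disp u k) i = u i := by
  have h0 : ∀ i, blowup P (fun A => σ A / chainScale σ (sabove P A))
      (fun k => (chainScale σ (up P k))⁻¹ • F.disp u k) i = ∑ k ∈ anc P i, F.disp u k := by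
    intro i
    refine Finset.sum_congr rfl fun k _ => ?_
    rw [prod_up_div hP σ hσ, smul_smul, mul_inv_cancel₀ (chainScale_ne_zero hP hσ k), one_smul]
  rw [h0]
  induction i using WellFoundedLT.induction with
  | _ i ih =>
    rcases (up P i).eq_empty_or_nonempty with h | h
    · rw [IsLaminar.anc_eq_singleton h, Finset.sum_singleton, Frame.disp, if_pos h]
    · obtain ⟨A, hA, hkA, ⟨j, hj, hjk⟩, h'⟩ := hP.up_eq_above_min h
      have hlt := ((F.isLeast A hA).2 hj).trans_lt hjk
      obtain ⟨h1, h2⟩ := hP.anc_eq_insert hA hkA h' (F.isLeast A hA) hlt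
      rw [h2, Finset.sum_insert h1, ih _ hlt, Frame.disp, if_neg h.ne_empty, h', sInter_above hA,
        sub_add_cancel]

/-- The scales and shapes are recovered from the points. -/
theorem scale_blowup (hP : IsLaminar P) (F : Frame P) {t σ : Set (Fin n) → ℝ} {y : Fin n → V}
    (hσ : ∀ A ∈ P, σ A = ∏ B ∈ above P A, t B) (ht : ∀ A ∈ P, t A ≠ 0) :
    (∀ A ∈ P, σ A / chainScale σ (sabove P A) = t A) ∧
      ∀ k, (chainScale σ (up P k))⁻¹ • F.disp (blowup P t y) k = y k := by
  constructor
  · intro A hA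
    have h1 : chainScale σ (sabove P A) = ∏ B ∈ sabove P A, t B := by
      rcases (sabove P A).eq_empty_or_nonempty with h | h
      · simp [h, chainScale]
      · obtain ⟨B, hB, -, h'⟩ := hP.sabove_eq_above_min hA h
        rw [h', chainScale_above σ hB, hσ B hB]
    have h2 : ∏ B ∈ sabove P A, t B ≠ 0 :=
      Finset.prod_ne_zero_iff.2 fun B hB => ht B (mem_sabove.1 hB).1
    rw [h1, hσ A hA, IsLaminar.above_eq_cons hA, Finset.prod_cons, mul_div_cancel_right₀ _ h2]
  · intro k
    have h2 : ∏ B ∈ up P k, t B ≠ 0 :=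
      Finset.prod_ne_zero_iff.2 fun B hB => ht B (mem_up.1 hB).1
    rcases (up P k).eq_empty_or_nonempty with h | h
    · simp [h, chainScale, Frame.disp, blowup_of_up_eq_empty t y h]
    · obtain ⟨A, hA, hkA, ⟨j, hj, hjk⟩, h'⟩ := hP.up_eq_above_min h
      have h3 := blowup_sub_of_up hP t y hA hkA h' (F.isLeast A hA)
        (((F.isLeast A hA).2 hj).trans_lt hjk)
      rw [Frame.disp, if_neg h.ne_empty, h', sInter_above hA, chainScale_above σ hA, h3, h',
        hσ A hA, smul_smul, inv_mul_cancel₀ (h' ▸ h2), one_smul]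

end Blowup

end Laminar

end FM

namespace FM

open Set Topology Filter Asymptotics

/-! ### The coordinates of the ambient space -/

theorem intervalCoord_eq (a : ℝ≥0∞) : intervalCoord a = 1 - ((1 + a)⁻¹).toReal := rfl

theorem intervalCoord_injective : Function.Injective intervalCoord := by
  intro a b h
  rw [intervalCoord_eq, intervalCoord_eq, sub_right_inj,
    ENNReal.toReal_eq_toReal_iff' (by simp) (by simp), inv_inj] at h
  exact (ENNReal.add_right_inj ENNReal.one_ne_top).1 h

theorem continuous_intervalCoord : Continuous intervalCoord := by
  refine continuous_const.sub (continuous_iff_continuousAt.2 fun a => ?_)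
  have h0 : Continuous fun a : ℝ≥0∞ => (1 + a)⁻¹ := by fun_prop
  have h1 : ContinuousAt (fun a : ℝ≥0∞ => (1 + a)⁻¹) a := h0.continuousAt
  exact ContinuousAt.comp (g := ENNReal.toReal) (ENNReal.continuousAt_toReal (by simp)) h1

theorem intervalCoord_zero : intervalCoord 0 = 0 := by simp [intervalCoord_eq]

theorem intervalCoord_edist_div {A : Type*} [MetricSpace A] (x y z : A) (h : x ≠ z) :
    intervalCoord (edist x y / edist x z) = dist x y / (dist x y + dist x z) := by
  have h0 : 0 < dist x z := dist_pos.2 h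
  rw [intervalCoord_eq, edist_dist, edist_dist, ← ENNReal.ofReal_div_of_pos h0,
    ← ENNReal.ofReal_one, ← ENNReal.ofReal_add zero_le_one (by positivity), ENNReal.toReal_inv,
    ENNReal.toReal_ofReal (by positivity)]
  have : 0 ≤ dist x y := dist_nonneg
  field_simp
  ring

variable {n m : ℕ} {M : Type*}

theorem isEmbedding_coords [TopologicalSpace M] {ε : M ↪ EuclideanSpace ℝ (Fin m)}
    (hε : IsEmbedding ε) : IsEmbedding (coords (n := n) ε) :=
  IsEmbedding.prodMap (IsEmbedding.piMap fun _ => hε)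
    (IsEmbedding.prodMap (IsEmbedding.piMap fun _ => IsEmbedding.subtypeVal)
      (IsEmbedding.piMap fun _ =>
        (continuous_intervalCoord.isClosedEmbedding intervalCoord_injective).isEmbedding))

theorem coords_alpha (ε : M ↪ EuclideanSpace ℝ (Fin m)) (x : Conf n M) :
    coords ε (alpha n ε x) = (fun i => ε (x.1 i),
      fun p => ‖ε (x.1 (p.1 0)) - ε (x.1 (p.1 1))‖⁻¹ • (ε (x.1 (p.1 0)) - ε (x.1 (p.1 1))),
      fun t => dist (ε (x.1 (t.1 0))) (ε (x.1 (t.1 1))) / (dist (ε (x.1 (t.1 0))) (ε (x.1 (t.1 1))) +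
        dist (ε (x.1 (t.1 0))) (ε (x.1 (t.1 2))))) := by
  refine Prod.ext rfl (Prod.ext rfl (funext fun t => ?_))
  exact intervalCoord_edist_div _ _ _
    fun e => x.ne (t.ne (i := 0) (j := 2) (by decide)) (ε.injective e)

/-- A triple of distinct indices as an element of `C_3({1,…,n})`. -/
def triple (i j k : Fin n) (h1 : i ≠ j) (h2 : i ≠ k) (h3 : j ≠ k) : Conf 3 (Fin n) :=
  ⟨![i, j, k], by
    intro a b
    fin_cases a <;> fin_cases b <;> simp [h1, h2, h3, h1.symm, h2.symm, h3.symm]⟩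

/-- A pair of distinct indices as an element of `C_2({1,…,n})`. -/
def pair (i j : Fin n) (h : i ≠ j) : Conf 2 (Fin n) :=
  ⟨![i, j], by
    intro a b
    fin_cases a <;> fin_cases b <;> simp [h, h.symm]⟩

theorem excludes_ne {p : Ambient n m M} {i j k : Fin n} (h : Excludes p i j k) :
    i ≠ j ∧ i ≠ k ∧ j ≠ k := by
  obtain ⟨t, rfl, rfl, rfl, -⟩ := h
  exact ⟨t.ne (by decide), t.ne (by decide), t.ne (by decide)⟩

theorem excludes_iff {p : Ambient n m M} {i j k : Fin n} (h1 : i ≠ j) (h2 : i ≠ k) (h3 : j ≠ k) :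
    Excludes p i j k ↔ p.2.2 (triple i j k h1 h2 h3) = 0 := by
  constructor
  · rintro ⟨t, rfl, rfl, rfl, h⟩
    convert h
    apply Subtype.ext
    funext a
    fin_cases a <;> rfl
  · intro h
    exact ⟨_, rfl, rfl, rfl, h⟩

/-! ### Rates of approach of the points of a degenerate configuration -/

section Asymptotic

variable (ε : M ↪ EuclideanSpace ℝ (Fin m))

/-- The distance of the `i`-th and the `j`-th point of a configuration. -/
noncomputable def gap (i j : Fin n) (x : Conf n M) : ℝ := dist (ε (x.1 i)) (ε (x.1 j))

variable {ε}

theorem gap_comm (i j : Fin n) : gap ε i j = gap (M := M) ε j i :=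
  funext fun _ => dist_comm _ _

theorem gap_self (i : Fin n) : gap ε i i = fun _ : Conf n M => (0 : ℝ) :=
  funext fun _ => dist_self _

theorem gap_pos {i j : Fin n} (h : i ≠ j) (x : Conf n M) : 0 < gap ε i j x :=
  dist_pos.2 fun e => x.ne h (ε.injective e)

theorem gap_nonneg (i j : Fin n) (x : Conf n M) : 0 ≤ gap ε i j x := dist_nonneg

theorem gap_triangle (i j k : Fin n) (x : Conf n M) :
    gap ε i k x ≤ gap ε i j x + gap ε j k x := dist_triangle _ _ _

variable [TopologicalSpace M]

variable (ε) in
/-- The filter of the configurations which approach the point `p` of the ambient space. -/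
noncomputable def approach (p : Ambient n m M) : Filter (Conf n M) := comap (alpha n ε) (𝓝 p)

variable {p : Ambient n m M} (hp : p ∈ closure (range (alpha n ε)))

include hp in
theorem neBot_approach : (approach ε p).NeBot := 
  comap_neBot_iff_frequently.2 (mem_closure_iff_frequently.1 hp)

theorem tendsto_alpha_approach : Tendsto (alpha n ε) (approach ε p) (𝓝 p) := tendsto_comap

theorem tendsto_coords_approach (hε : IsEmbedding ε) :
    Tendsto (fun x => coords ε (alpha n ε x)) (approach ε p) (𝓝 (coords ε p)) :=
  ((isEmbedding_coords hε).continuous.tendsto p).comp tendsto_alpha_approach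

theorem tendsto_ratio {i j k : Fin n} (h1 : i ≠ j) (h2 : i ≠ k) (h3 : j ≠ k) :
    Tendsto (fun x => gap ε i j x / (gap ε i j x + gap ε i k x)) (approach ε p)
      (𝓝 (intervalCoord (p.2.2 (triple i j k h1 h2 h3)))) := by
  have hc : Continuous fun q : Ambient n m M => intervalCoord (q.2.2 (triple i j k h1 h2 h3)) :=
    continuous_intervalCoord.comp (by fun_prop)
  refine ((hc.tendsto p).comp tendsto_alpha_approach).congr fun x => ?_
  exact intervalCoord_edist_div _ _ _ fun e => x.ne h2 (ε.injective e)

theorem tendsto_gap (hε : IsEmbedding ε) (i j : Fin n) :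
    Tendsto (gap ε i j) (approach ε p) (𝓝 (dist (ε (p.1 i)) (ε (p.1 j)))) := by
  have hc : Continuous fun q : Ambient n m M => dist (ε (q.1 i)) (ε (q.1 j)) :=
    (hε.continuous.comp (by fun_prop)).dist (hε.continuous.comp (by fun_prop))
  refine ((hc.tendsto p).comp tendsto_alpha_approach).congr fun x => ?_
  rfl

theorem excludes_imp_isLittleO {i j k : Fin n} (h : Excludes p i j k) :
    gap ε i j =o[approach ε p] gap ε i k := by
  obtain ⟨h1, h2, h3⟩ := excludes_ne h
  have ht := tendsto_ratio (ε := ε) (p := p) h1 h2 h3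
  rw [(excludes_iff h1 h2 h3).1 h, intervalCoord_zero] at ht
  rw [isLittleO_iff_tendsto fun x hx => absurd hx (gap_pos h2 x).ne']
  have h4 : Tendsto (fun c : ℝ => c / (1 - c)) (𝓝 0) (𝓝 0) := by
    have : ContinuousAt (fun c : ℝ => c / (1 - c)) 0 :=
      continuousAt_id.div (by fun_prop) (by norm_num)
    simpa [ContinuousAt] using this
  refine (h4.comp ht).congr fun x => ?_
  have hij := gap_pos (ε := ε) h1 x
  have hik := gap_pos (ε := ε) h2 x
  simp only [Function.comp_apply]
  rw [one_sub_div (by positivity), add_sub_cancel_left]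
  field_simp

theorem not_excludes_imp_isBigO {i j k : Fin n} (h2 : i ≠ k) (hij : i ≠ j)
    (h : ¬ Excludes p i j k) : gap ε i k =O[approach ε p] gap ε i j := by
  by_cases h3 : j = k
  · rw [h3]
  have ht := tendsto_ratio (ε := ε) (p := p) hij h2 h3
  rw [excludes_iff hij h2 h3, ← intervalCoord_injective.eq_iff, intervalCoord_zero] at h
  have h4 := (tendsto_const_nhds (x := (1 : ℝ)).sub ht).div ht h
  refine isBigO_of_div_tendsto_nhds (Eventually.of_forall fun x hx =>
    absurd hx (gap_pos hij x).ne') _ (h4.congr fun x => ?_)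
  have hij := gap_pos (ε := ε) hij x
  have hik := gap_pos (ε := ε) h2 x
  simp only [Pi.div_apply]
  rw [one_sub_div (by positivity), add_sub_cancel_left]
  field_simp

include hp in
theorem not_isLittleO_of_isBigO {i j k : Fin n} (h : i ≠ k)
    (h' : gap ε i k =O[approach ε p] gap ε i j) : ¬ gap ε i j =o[approach ε p] gap ε i k := by
  intro h''
  have := neBot_approach hp
  exact isLittleO_irrefl (f'' := gap ε i k) (l := approach ε p)
    (Frequently.of_forall fun x => (gap_pos h x).ne') (h'.trans_isLittleO h'')

include hp in
/-- The index `j` is infinitely closer to `i` than `k` exactly if `(i,j)` excludes `k`. -/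
theorem eq_or_excludes_iff {i j k : Fin n} (h : i ≠ k) :
    j = i ∨ Excludes p i j k ↔ gap ε i j =o[approach ε p] gap ε i k := by
  constructor
  · rintro (rfl | h')
    · rw [gap_self]
      exact isLittleO_zero _ _
    · exact excludes_imp_isLittleO h'
  · intro h'
    by_contra hne
    push Not at hne
    exact not_isLittleO_of_isBigO hp h (not_excludes_imp_isBigO h hne.1.symm hne.2) h'

include hp in
theorem isBigO_of_not_isLittleO {i j k : Fin n} (h : i ≠ k)
    (h' : ¬ gap ε i j =o[approach ε p] gap ε i k) : gap ε i k =O[approach ε p] gap ε i j := by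
  rw [← eq_or_excludes_iff hp h] at h'
  push Not at h'
  exact not_excludes_imp_isBigO h h'.1.symm h'.2

theorem isBigO_gap_of_isBigO {i j k : Fin n} {f : Conf n M → ℝ}
    (h1 : gap ε i j =O[approach ε p] f) (h2 : gap ε i k =O[approach ε p] f) :
    gap ε j k =O[approach ε p] f := by
  refine IsBigO.trans (IsBigO.of_norm_le (g := fun x => gap ε i j x + gap ε i k x) fun x => ?_)
    (h1.add h2)
  rw [Real.norm_of_nonneg (gap_nonneg _ _ _), gap_comm i j]
  exact gap_triangle j i k x

theorem isLittleO_gap_of_isLittleO {i j k : Fin n} {f : Conf n M → ℝ}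
    (h1 : gap ε i j =o[approach ε p] f) (h2 : gap ε i k =o[approach ε p] f) :
    gap ε j k =o[approach ε p] f := by
  refine IsBigO.trans_isLittleO (IsBigO.of_norm_le
    (g := fun x => gap ε i j x + gap ε i k x) fun x => ?_) (h1.add h2)
  rw [Real.norm_of_nonneg (gap_nonneg _ _ _), gap_comm i j]
  exact gap_triangle j i k x

/-- If `j` is infinitely closer to `i` than `k`, then the distances from `i` and from `j` to `k` are
comparable. -/
theorem isBigO_gap_of_isLittleO {i j k : Fin n} (h : gap ε i j =o[approach ε p] gap ε i k) :
    gap ε i k =O[approach ε p] gap ε j k ∧ gap ε j k =O[approach ε p] gap ε i k := by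
  refine ⟨?_, isBigO_gap_of_isBigO h.isBigO (isBigO_refl _ _)⟩
  have h1 := h.bound (c := 1 / 2) (by norm_num)
  refine IsBigO.of_bound 2 ?_
  filter_upwards [h1] with x hx
  have h2 := gap_triangle (ε := ε) i j k x
  rw [Real.norm_of_nonneg (gap_nonneg _ _ _), Real.norm_of_nonneg (gap_nonneg _ _ _)] at hx ⊢
  linarith

theorem isBigO_gap_one (hε : IsEmbedding ε) (i j : Fin n) :
    gap ε i j =O[approach ε p] fun _ => (1 : ℝ) := (tendsto_gap hε i j).isBigO_one ℝ

theorem isLittleO_gap_one_iff [(approach ε p).NeBot] (hε : IsEmbedding ε) (i j : Fin n) :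
    gap ε i j =o[approach ε p] (fun _ => (1 : ℝ)) ↔ p.1 i = p.1 j := by
  rw [isLittleO_one_iff]
  constructor
  · intro h
    have := tendsto_nhds_unique h (tendsto_gap hε i j)
    exact ε.injective (dist_eq_zero.1 this.symm)
  · intro h
    have := tendsto_gap (p := p) hε i j
    rwa [h, dist_self] at this

theorem isBigO_one_gap (hε : IsEmbedding ε) {i j : Fin n} (h : p.1 i ≠ p.1 j) :
    (fun _ => (1 : ℝ)) =O[approach ε p] gap ε i j := by
  have h0 : dist (ε (p.1 i)) (ε (p.1 j)) ≠ 0 := dist_ne_zero.2 fun e => h (ε.injective e)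
  have hij : i ≠ j := fun e => h (e ▸ rfl)
  exact isBigO_of_div_tendsto_nhds (Eventually.of_forall fun x hx =>
    absurd hx (gap_pos hij x).ne') _ (tendsto_const_nhds.div (tendsto_gap hε i j) h0)

include hp in
theorem mem_parenthesization_iff (hε : IsEmbedding ε) {A : Set (Fin n)} :
    A ∈ parenthesization p ↔
      (∃ i k, i ≠ k ∧ A.Nontrivial ∧ A = {j | gap ε i j =o[approach ε p] gap ε i k}) ∨
      (2 ≤ n ∧ (∀ i j, gap ε i j =o[approach ε p] (fun _ => (1 : ℝ))) ∧ A = univ) := by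
  have := neBot_approach hp
  refine or_congr ?_ (and_congr_right fun _ => and_congr_left fun _ =>
    forall_congr' fun i => forall_congr' fun j => (isLittleO_gap_one_iff hε i j).symm)
  refine exists_congr fun i => exists_congr fun k => ?_
  constructor
  · rintro ⟨⟨j, hj⟩, rfl⟩
    obtain ⟨h1, h2, h3⟩ := excludes_ne hj
    exact ⟨h2, ⟨i, Or.inl rfl, j, Or.inr hj, h1⟩, Set.ext fun j => eq_or_excludes_iff hp h2⟩
  · rintro ⟨h2, hA, rfl⟩
    obtain ⟨j, hj, hji⟩ := hA.exists_ne i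
    refine ⟨⟨j, ((eq_or_excludes_iff hp h2).2 hj).resolve_left hji⟩,
      Set.ext fun j => (eq_or_excludes_iff hp h2).symm⟩

theorem ball_eq_ball {i j k : Fin n} (h : gap ε i j =o[approach ε p] gap ε i k) :
    {l | gap ε i l =o[approach ε p] gap ε i k} = {l | gap ε j l =o[approach ε p] gap ε j k} := by
  obtain ⟨h1, h2⟩ := isBigO_gap_of_isLittleO h
  ext l
  constructor
  · intro hl
    exact (isLittleO_gap_of_isLittleO h hl).trans_isBigO h1
  · intro hl
    refine isLittleO_gap_of_isLittleO (i := j) ?_ (IsLittleO.trans_isBigO hl h2)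
    rw [gap_comm]
    exact h

include hp in
theorem isLaminar_parenthesization (hε : IsEmbedding ε) :
    (∀ A ∈ parenthesization p, A.Nontrivial) ∧ ∀ A ∈ parenthesization p,
      ∀ B ∈ parenthesization p, ∀ i, i ∈ A → i ∈ B → A ⊆ B ∨ B ⊆ A := by
  have := neBot_approach hp
  constructor
  · intro A hA
    rcases (mem_parenthesization_iff hp hε).1 hA with ⟨i, k, -, h, -⟩ | ⟨h, -, rfl⟩
    · exact h
    · exact ⟨⟨0, by omega⟩, mem_univ _, ⟨1, by omega⟩, mem_univ _, by simp [Fin.ext_iff]⟩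
  · intro A hA B hB j hjA hjB
    rcases (mem_parenthesization_iff hp hε).1 hA with ⟨i, k, hik, -, rfl⟩ | ⟨-, -, rfl⟩
    swap
    · exact Or.inr (subset_univ _)
    rcases (mem_parenthesization_iff hp hε).1 hB with ⟨i', k', hik', -, rfl⟩ | ⟨-, -, rfl⟩
    swap
    · exact Or.inl (subset_univ _)
    have hjk : j ≠ k := by
      rintro rfl
      exact not_isLittleO_of_isBigO hp hik (isBigO_refl _ _) hjA
    have hjk' : j ≠ k' := by
      rintro rfl
      exact not_isLittleO_of_isBigO hp hik' (isBigO_refl _ _) hjB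
    rw [ball_eq_ball hjA, ball_eq_ball hjB]
    by_cases h : gap ε j k =o[approach ε p] gap ε j k'
    · exact Or.inl fun l hl => IsLittleO.trans_isBigO hl h.isBigO
    · exact Or.inr fun l hl => IsLittleO.trans_isBigO hl (isBigO_of_not_isLittleO hp hjk' h)

include hp in
theorem isLittleO_gap_iff (hε : IsEmbedding ε) {i j k : Fin n} (hij : i ≠ j) (hik : i ≠ k) :
    gap ε i j =o[approach ε p] gap ε i k ↔ ∃ A ∈ parenthesization p, i ∈ A ∧ j ∈ A ∧ k ∉ A := by
  have := neBot_approach hp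
  have hk : ¬ gap ε i k =o[approach ε p] gap ε i k :=
    not_isLittleO_of_isBigO hp hik (isBigO_refl _ _)
  have hi : gap ε i i =o[approach ε p] gap ε i k := by rw [gap_self]; exact isLittleO_zero _ _
  constructor
  · intro h
    exact ⟨_, (mem_parenthesization_iff hp hε).2 (Or.inl ⟨i, k, hik, ⟨i, hi, j, h, hij⟩, rfl⟩),
      hi, h, hk⟩
  · rintro ⟨A, hA, hiA, hjA, hkA⟩
    rcases (mem_parenthesization_iff hp hε).1 hA with ⟨i', k', hik', -, rfl⟩ | ⟨-, -, rfl⟩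
    · have hik2 : i ≠ k' := by
        rintro rfl
        exact not_isLittleO_of_isBigO hp hik' (isBigO_refl _ _) hiA
      rw [ball_eq_ball hiA] at hjA hkA
      exact IsLittleO.trans_isBigO hjA (isBigO_of_not_isLittleO hp hik2 hkA)
    · exact absurd (mem_univ _) hkA

include hp in
theorem eq_iff_exists_mem_parenthesization (hε : IsEmbedding ε) {i j : Fin n} (hij : i ≠ j) :
    p.1 i = p.1 j ↔ ∃ A ∈ parenthesization p, i ∈ A ∧ j ∈ A := by
  have := neBot_approach hp
  constructor
  · intro h
    by_cases hall : ∀ k, p.1 i = p.1 k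
    · have h2 : 2 ≤ n := by
        have := i.2
        have := j.2
        have : (i : ℕ) ≠ j := fun e => hij (Fin.ext e)
        omega
      exact ⟨univ, Or.inr ⟨h2, fun a b => (hall a).symm.trans (hall b), rfl⟩,
        mem_univ _, mem_univ _⟩
    · push Not at hall
      obtain ⟨k, hk⟩ := hall
      have h1 := ((isLittleO_gap_one_iff hε i j).2 h).trans_isBigO (isBigO_one_gap hε hk)
      obtain ⟨A, hA, h2, h3, -⟩ := (isLittleO_gap_iff hp hε hij (fun e => hk (e ▸ rfl))).1 h1
      exact ⟨A, hA, h2, h3⟩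
  · rintro ⟨A, hA, hi, hj⟩
    rw [← isLittleO_gap_one_iff hε]
    rcases (mem_parenthesization_iff hp hε).1 hA with ⟨i', k', hik', -, rfl⟩ | ⟨-, h, -⟩
    · exact (isLittleO_gap_of_isLittleO hi hj).trans_isBigO (isBigO_gap_one hε _ _)
    · exact h i j

include hp in
/-- If every cluster which contains `a` and `b` also contains `i` and `j`, then `x_i - x_j` is at
most of the order of `x_a - x_b`. -/
theorem isBigO_gap_of_forall (hε : IsEmbedding ε) {i j a b : Fin n} (hab : a ≠ b)
    (h : ∀ A ∈ parenthesization p, a ∈ A → b ∈ A → i ∈ A ∧ j ∈ A) :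
    gap ε i j =O[approach ε p] gap ε a b := by
  have key : ∀ l, (∀ A ∈ parenthesization p, a ∈ A → b ∈ A → l ∈ A) →
      gap ε a l =O[approach ε p] gap ε a b := by
    intro l hl
    by_cases hal : a = l
    · rw [← hal, gap_self]
      exact isBigO_zero _ _
    refine isBigO_of_not_isLittleO hp hal fun hlt => ?_
    obtain ⟨A, hA, h1, h2, h3⟩ := (isLittleO_gap_iff hp hε hab hal).1 hlt
    exact h3 (hl A hA h1 h2)
  exact isBigO_gap_of_isBigO (key i fun A hA h1 h2 => (h A hA h1 h2).1)
    (key j fun A hA h1 h2 => (h A hA h1 h2).2)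

end Asymptotic

/-- A laminar family is the parenthesization of a point as soon as it describes the exclusion
relation, and whether all points coincide. -/
theorem parenthesization_eq {P : Finset (Set (Fin n))} (hP : IsLaminar P) {p : Ambient n m M}
    (h1 : ∀ i j k, i ≠ j → i ≠ k → j ≠ k →
      (Excludes p i j k ↔ ∃ A ∈ P, i ∈ A ∧ j ∈ A ∧ k ∉ A))
    (h2 : 2 ≤ n → ((∀ i j, p.1 i = p.1 j) ↔ univ ∈ P)) : parenthesization p = P := by
  have h1' : ∀ i j k, i ≠ j → (Excludes p i j k ↔ ∃ A ∈ P, i ∈ A ∧ j ∈ A ∧ k ∉ A) := by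
    intro i j k hij
    by_cases hik : i = k
    · subst hik
      exact ⟨fun h => absurd rfl (excludes_ne h).2.1, fun ⟨A, _, h, _, h'⟩ => absurd h h'⟩
    by_cases hjk : j = k
    · subst hjk
      exact ⟨fun h => absurd rfl (excludes_ne h).2.2, fun ⟨A, _, _, h, h'⟩ => absurd h h'⟩
    exact h1 i j k hij hik hjk
  ext A
  rw [Finset.mem_coe]
  constructor
  · rintro (⟨i, k, ⟨j, hj⟩, rfl⟩ | ⟨hn, h, rfl⟩)
    · obtain ⟨B, hB, hiB, hjB, hkB⟩ := (h1' i j k (excludes_ne hj).1).1 hj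
      obtain ⟨C, hC, hmax⟩ := Set.Finite.exists_maximal (s := {B | B ∈ P ∧ i ∈ B ∧ k ∉ B})
        (Set.toFinite _) ⟨B, hB, hiB, hkB⟩
      have : {j | j = i ∨ Excludes p i j k} = C := by
        ext l
        constructor
        · rintro (rfl | hl)
          · exact hC.2.1
          · obtain ⟨D, hD, hiD, hlD, hkD⟩ := (h1' i l k (excludes_ne hl).1).1 hl
            rcases hP.nested C hC.1 D hD i hC.2.1 hiD with h | h
            · exact hmax ⟨hD, hiD, hkD⟩ h hlD
            · exact h hlD
        · intro hl
          by_cases hli : l = i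
          · exact Or.inl hli
          · exact Or.inr ((h1' i l k (Ne.symm hli)).2 ⟨C, hC.1, hC.2.1, hl, hC.2.2⟩)
      rw [this]
      exact hC.1
    · exact (h2 hn).1 h
  · intro hA
    by_cases hu : A = univ
    · subst hu
      obtain ⟨x, -, y, -, hxy⟩ := hP.nontrivial _ hA
      have hn : 2 ≤ n := by
        have := x.2
        have := y.2
        have : (x : ℕ) ≠ y := fun e => hxy (Fin.ext e)
        omega
      exact Or.inr ⟨hn, (h2 hn).2 hA, rfl⟩
    -- the index `k` is chosen in the next larger member, or outside of `A` if there is none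
    obtain ⟨k, hkA, hk⟩ : ∃ k, k ∉ A ∧ ∀ C ∈ P, A ⊂ C → k ∈ C := by
      rcases (sabove P A).eq_empty_or_nonempty with h | h
      · obtain ⟨k, hk⟩ := (ne_univ_iff_exists_notMem A).1 hu
        refine ⟨k, hk, fun C hC hAC => ?_⟩
        have : C ∈ sabove P A := mem_sabove.2 ⟨hC, hAC⟩
        simp [h] at this
      · obtain ⟨B, hB, hAB, h'⟩ := hP.sabove_eq_above_min hA h
        obtain ⟨k, hkB, hkA⟩ := exists_of_ssubset hAB
        refine ⟨k, hkA, fun C hC hAC => ?_⟩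
        have : C ∈ above P B := h' ▸ mem_sabove.2 ⟨hC, hAC⟩
        exact (mem_above.1 this).2 hkB
    obtain ⟨i, hi, j, hj, hij⟩ := hP.nontrivial A hA
    refine Or.inl ⟨i, k, ⟨j, (h1' i j k hij).2 ⟨A, hA, hi, hj, hkA⟩⟩, ?_⟩
    ext l
    constructor
    · intro hl
      by_cases hli : l = i
      · exact Or.inl hli
      · exact Or.inr ((h1' i l k (Ne.symm hli)).2 ⟨A, hA, hi, hl, hkA⟩)
    · rintro (rfl | hl)
      · exact hi
      · obtain ⟨D, hD, hiD, hlD, hkD⟩ := (h1' i l k (excludes_ne hl).1).1 hl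
        rcases hP.nested A hA D hD i hi hiD with h | h
        · by_contra hlA
          exact hkD (hk D hD ⟨h, fun h' => hlA (h' hlD)⟩)
        · exact h hlD

end FM

namespace FM

open Set Topology Filter Asymptotics

/-! ### Corner coordinates near a point of the compactification -/

/-- Euclidean space of dimension `k`. -/
abbrev Euc (k : ℕ) : Type := EuclideanSpace ℝ (Fin k)

/-- A chart `ψ` of `M` around `a` whose inverse and which itself extend to smooth maps `φ` and `χ`
between the whole Euclidean spaces, with the families of linear maps given by Hadamard's lemma. -/
structure LocalParam {m : ℕ} {M : Type*} [TopologicalSpace M] (d : ℕ) (ε : M → Euc m) (a : M) where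
  /-- the chart -/
  ψ : OpenPartialHomeomorph M (Euc d)
  /-- the extension of the inverse of the chart -/
  φ : Euc d → Euc m
  /-- the extension of the chart -/
  χ : Euc m → Euc d
  /-- the difference quotient of `φ` -/
  Dφ : Euc d × Euc d → Euc d →L[ℝ] Euc m
  /-- the difference quotient of `χ` -/
  Dχ : Euc m × Euc m → Euc m →L[ℝ] Euc d
  mem : a ∈ ψ.source
  contDiff_φ : ContDiff ℝ ∞ φ
  contDiff_χ : ContDiff ℝ ∞ χ
  contDiff_Dφ : ContDiff ℝ ∞ Dφ
  contDiff_Dχ : ContDiff ℝ ∞ Dχ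
  φ_ψ : ∀ x ∈ ψ.source, φ (ψ x) = ε x
  χ_ε : ∀ x ∈ ψ.source, χ (ε x) = ψ x
  φ_sub : ∀ u v, φ u - φ v = Dφ (u, v) (u - v)
  χ_sub : ∀ u v, χ u - χ v = Dχ (u, v) (u - v)

theorem nonempty_localParam {d m : ℕ} {M : Type*} [TopologicalSpace M]
    [ChartedSpace (Euc d) M] [IsManifold (𝓡 d) ∞ M]
    {ε : M → Euc m} (hε : Manifold.IsSmoothEmbedding (𝓡 d) (𝓡 m) ∞ ε) (a : M) :
    Nonempty (LocalParam d ε a) := by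
  obtain ⟨ψ, φ, χ, h1, h2, h3, h4⟩ := exists_globalized_chart hε a
  obtain ⟨Dφ, h5, h6⟩ := exists_hadamard h2
  obtain ⟨Dχ, h7, h8⟩ := exists_hadamard h3
  exact ⟨⟨ψ, φ, χ, Dφ, Dχ, h1, h2, h3, h5, h7, fun x hx => (h4 x hx).1,
    fun x hx => (h4 x hx).2, h6, h8⟩⟩

variable {n d m : ℕ} {M : Type*}

/-- The direction from the `j`-th to the `i`-th point, read off from the coordinates. -/
noncomputable def dirVec (i j : Fin n) (q : CoordSpace n m) : Euc m :=
  if h : i ≠ j then q.2.1 (pair i j h) else 0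

/-- The ratio `|x_i - x_j| / |x_i - x_k|`, read off from the coordinates. -/
noncomputable def ratio (i j k : Fin n) (q : CoordSpace n m) : ℝ :=
  if h : i ≠ j ∧ i ≠ k ∧ j ≠ k then
    q.2.2 (triple i j k h.1 h.2.1 h.2.2) / (1 - q.2.2 (triple i j k h.1 h.2.1 h.2.2))
  else if i = j then 0 else 1

theorem dirVec_alpha (ε : M ↪ Euc m) {i j : Fin n} (h : i ≠ j) (x : Conf n M) :
    dirVec i j (coords ε (alpha n ε x)) = (gap ε i j x)⁻¹ • (ε (x.1 i) - ε (x.1 j)) := by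
  rw [coords_alpha, dirVec, dif_pos h, gap, dist_eq_norm]
  rfl

theorem ratio_alpha (ε : M ↪ Euc m) {i j k : Fin n} (h : i ≠ k) (x : Conf n M) :
    ratio i j k (coords ε (alpha n ε x)) = gap ε i j x / gap ε i k x := by
  have hik := gap_pos (ε := ε) h x
  rw [ratio]
  split_ifs with h1 h2
  · have hij := gap_pos (ε := ε) h1.1 x
    rw [coords_alpha]
    change gap ε i j x / (gap ε i j x + gap ε i k x) / (1 - gap ε i j x / (gap ε i j x + gap ε i k x))
      = _
    rw [one_sub_div (by positivity), add_sub_cancel_left]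
    field_simp
  · rw [h2, gap_self]
    simp
  · have h3 : j = k := by
      by_contra h3
      exact h1 ⟨h2, h, h3⟩
    rw [h3, div_self hik.ne']

section

variable [TopologicalSpace M] {ε : M ↪ Euc m}

/-- The difference `u_i - u_j` in the chart, divided by the distance of the points, read off from
the coordinates. -/
noncomputable def localDir (Λ : ∀ a : M, LocalParam d ε a) (p : Ambient n m M) (i j : Fin n)
    (q : CoordSpace n m) : Euc d :=
  (Λ (p.1 j)).Dχ (q.1 i, q.1 j) (dirVec i j q)

variable (d ε) in
/-- The choices on which the corner coordinates around the point `p` of the compactification depend: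
charts of `M`, a frame of the parenthesization of `p`, and, for each cluster, a coordinate `c` of
the Euclidean space and a sign, such that the size of the cluster can be measured by the
corresponding signed coordinate of the difference of the two points chosen by the frame. -/
structure CornerData (n : ℕ) where
  /-- the point -/
  p : Ambient n m M
  hp : p ∈ closure (range (alpha n ε))
  /-- charts of the submanifold -/
  Λ : ∀ a : M, LocalParam d ε a
  /-- the parenthesization of the point -/
  P : Finset (Set (Fin n))
  hP : IsLaminar P
  hpar : parenthesization p = P
  /-- a frame of the parenthesization -/
  F : Frame P
  /-- the coordinate which measures the size of a cluster -/
  c : Fin n → Fin d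
  /-- the sign of that coordinate -/
  sgn : Fin n → ℝ
  sgn_mul_sgn : ∀ k, sgn k * sgn k = 1
  pos : ∀ A ∈ P, 0 < sgn (F.b A) * localDir Λ p (F.b A) (F.a A) (coords ε p) (c (F.b A))

namespace CornerData

variable (C : CornerData d ε n)

/-- The chart of `M` used for the `i`-th point. -/
abbrev loc (i : Fin n) : LocalParam d ε (C.p.1 i) := C.Λ (C.p.1 i)

/-- The indices which are the second elements of a cluster. -/
def IsB (k : Fin n) : Prop := ∃ A ∈ C.P, C.F.b A = k

/-- The size of the cluster `A`, measured in a chart. -/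
noncomputable def size (u : Fin n → Euc d) (A : Set (Fin n)) : ℝ :=
  C.sgn (C.F.b A) * (u (C.F.b A) - u (C.F.a A)) (C.c (C.F.b A))

/-- The size of the cluster `A`, divided by the distance of its two chosen points, read off from the
coordinates. -/
noncomputable def relSize (A : Set (Fin n)) (q : CoordSpace n m) : ℝ :=
  C.sgn (C.F.b A) * localDir C.Λ C.p (C.F.b A) (C.F.a A) q (C.c (C.F.b A))

/-- The quotient of the distances of the chosen points of two clusters, read off from the
coordinates. If the first chosen points differ, the quotient is obtained by way of the distance
between them. -/
noncomputable def distRatio (A B : Set (Fin n)) (q : CoordSpace n m) : ℝ :=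
  if C.F.a A = C.F.a B then ratio (C.F.a A) (C.F.b A) (C.F.b B) q
  else ratio (C.F.a A) (C.F.b A) (C.F.a B) q * ratio (C.F.a B) (C.F.a A) (C.F.b B) q

open scoped Classical in
/-- The size of `A` divided by the size of the next larger cluster, or the size of `A` itself if `A` is
a maximal cluster. The next larger cluster is written as the intersection of all larger ones. -/
noncomputable def scaleRead (A : Set (Fin n)) (q : CoordSpace n m) : ℝ :=
  if sabove C.P A = ∅ then
    C.sgn (C.F.b A) * ((C.loc (C.F.a A)).χ (q.1 (C.F.b A)) - (C.loc (C.F.a A)).χ (q.1 (C.F.a A)))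
      (C.c (C.F.b A))
  else C.relSize A q / C.relSize (⋂₀ (sabove C.P A : Set (Set (Fin n)))) q *
    C.distRatio A (⋂₀ (sabove C.P A : Set (Set (Fin n)))) q

open scoped Classical in
/-- The displacement of the `k`-th point from its predecessor, divided by the size of the smallest
cluster which contains both, or the `k`-th point itself, in its chart, if it has no predecessor. -/
noncomputable def shapeRead (k : Fin n) (q : CoordSpace n m) : Euc d :=
  if up C.P k = ∅ then (C.loc k).χ (q.1 k)
  else (ratio (C.F.a (⋂₀ (up C.P k : Set (Set (Fin n))))) k
      (C.F.b (⋂₀ (up C.P k : Set (Set (Fin n))))) q /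
      C.relSize (⋂₀ (up C.P k : Set (Set (Fin n)))) q) •
    localDir C.Λ C.p k (C.F.a (⋂₀ (up C.P k : Set (Set (Fin n))))) q

/-- The shift of the coordinates which are not scales: it gives them the value `1` at the point
`p`, so that they stay positive near it. -/
noncomputable def base (k : Fin n) (e : Fin d) : ℝ := C.shapeRead k (coords ε C.p) e - 1

open scoped Classical in
/-- The corner coordinates, as a function of the coordinates of the ambient space. The coordinate `c`
of the shape of the second element of a cluster is constantly equal to the sign, and its place is
taken by the scale of the cluster. -/
noncomputable def read (q : CoordSpace n m) : Euc (n * d) :=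
  WithLp.toLp 2 fun l =>
    if C.IsB (finProdFinEquiv.symm l).1 ∧
        (finProdFinEquiv.symm l).2 = C.c (finProdFinEquiv.symm l).1 then
      C.scaleRead (⋂₀ (up C.P (finProdFinEquiv.symm l).1 : Set (Set (Fin n)))) q
    else C.shapeRead (finProdFinEquiv.symm l).1 q (finProdFinEquiv.symm l).2 -
      C.base (finProdFinEquiv.symm l).1 (finProdFinEquiv.symm l).2

/-- The index of the corner coordinate which is the scale of the cluster `A`. -/
def scaleIdx (A : Set (Fin n)) : Fin (n * d) := finProdFinEquiv (C.F.b A, C.c (C.F.b A))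

/-- The scale of a cluster, as a function of the corner coordinates. -/
noncomputable def scale (z : Euc (n * d)) (A : Set (Fin n)) : ℝ := z (C.scaleIdx A)

open scoped Classical in
/-- The shapes of the clusters, as functions of the corner coordinates. -/
noncomputable def shape (z : Euc (n * d)) (k : Fin n) : Euc d :=
  WithLp.toLp 2 fun e =>
    if C.IsB k ∧ e = C.c k then C.sgn k else z (finProdFinEquiv (k, e)) + C.base k e

/-- The points in the charts, as functions of the corner coordinates. -/
noncomputable def pts (z : Euc (n * d)) (i : Fin n) : Euc d := blowup C.P (C.scale z) (C.shape z) i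

/-- The points in the ambient Euclidean space, as functions of the corner coordinates. -/
noncomputable def ambPts (z : Euc (n * d)) (i : Fin n) : Euc m := (C.loc i).φ (C.pts z i)

open scoped Classical in
/-- The differences of the points, divided by their scales. -/
noncomputable def diff (z : Euc (n * d)) (i j : Fin n) : Euc m :=
  if C.p.1 i = C.p.1 j then
    (C.loc i).Dφ (C.pts z i, C.pts z j) (blowupDiff C.P (C.scale z) (C.shape z) i j)
  else C.ambPts z i - C.ambPts z j

open scoped Classical in
/-- The product of the scales of the clusters which contain `i` and `j` but not `k`. -/
noncomputable def sepScale (z : Euc (n * d)) (i j k : Fin n) : ℝ :=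
  ∏ A ∈ common C.P i j with k ∉ A, C.scale z A

/-- The coordinates in the ambient space of the point with given corner coordinates. -/
noncomputable def param (z : Euc (n * d)) : CoordSpace n m :=
  (C.ambPts z, fun q => ‖C.diff z (q.1 0) (q.1 1)‖⁻¹ • C.diff z (q.1 0) (q.1 1),
    fun t => C.sepScale z (t.1 0) (t.1 1) (t.1 2) * ‖C.diff z (t.1 0) (t.1 1)‖ /
      (C.sepScale z (t.1 0) (t.1 1) (t.1 2) * ‖C.diff z (t.1 0) (t.1 1)‖ +
        C.sepScale z (t.1 0) (t.1 2) (t.1 1) * ‖C.diff z (t.1 0) (t.1 2)‖))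

variable {C} {A B : Set (Fin n)} {i j k : Fin n}

theorem mem_P : A ∈ C.P ↔ A ∈ parenthesization C.p := by rw [C.hpar, Finset.mem_coe]

theorem isB_b (hA : A ∈ C.P) : C.IsB (C.F.b A) := ⟨A, hA, rfl⟩

theorem sInter_up_b (hA : A ∈ C.P) : ⋂₀ (up C.P (C.F.b A) : Set (Set (Fin n))) = A := by
  rw [C.F.up_b A hA, sInter_above hA]

theorem a_ne_b (hA : A ∈ C.P) : C.F.b A ≠ C.F.a A := (C.F.lt A hA).ne'

open scoped Classical in
theorem read_apply (q : CoordSpace n m) (k : Fin n) (e : Fin d) :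
    C.read q (finProdFinEquiv (k, e)) = if C.IsB k ∧ e = C.c k then
      C.scaleRead (⋂₀ (up C.P k : Set (Set (Fin n)))) q else C.shapeRead k q e - C.base k e := by
  simp only [read]
  rw [Equiv.symm_apply_apply]

theorem read_scale (hA : A ∈ C.P) (q : CoordSpace n m) :
    C.scale (C.read q) A = C.scaleRead A q := by
  rw [scale, scaleIdx, read_apply, if_pos ⟨isB_b hA, rfl⟩, sInter_up_b hA]

theorem read_shape (q : CoordSpace n m) (k : Fin n) (e : Fin d) (h : ¬ (C.IsB k ∧ e = C.c k)) :
    C.shape (C.read q) k e = C.shapeRead k q e := by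
  simp only [shape]
  rw [if_neg h, read_apply, if_neg h, sub_add_cancel]

/-- Two vectors of corner coordinates with the same scales and shapes are equal. -/
theorem ext_scale_shape {z z' : Euc (n * d)} (h1 : ∀ A ∈ C.P, C.scale z A = C.scale z' A)
    (h2 : ∀ k, C.shape z k = C.shape z' k) : z = z' := by
  ext l
  obtain ⟨⟨k, e⟩, rfl⟩ := finProdFinEquiv.surjective l
  by_cases h : C.IsB k ∧ e = C.c k
  · obtain ⟨⟨A, hA, rfl⟩, rfl⟩ := h
    exact h1 A hA
  · have := congrArg (fun v : Euc d => v e) (h2 k)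
    simpa [shape, h] using this

theorem eq_of_mem (hA : A ∈ C.P) (hi : i ∈ A) (hj : j ∈ A) (hε : IsEmbedding ε) :
    C.p.1 i = C.p.1 j := by
  by_cases h : i = j
  · rw [h]
  · exact (eq_iff_exists_mem_parenthesization C.hp hε h).2 ⟨A, mem_P.1 hA, hi, hj⟩

variable (hε : IsEmbedding ε) {x : Conf n M} (hx : ∀ i, x.1 i ∈ (C.loc i).ψ.source)

variable (C) in
/-- The points of a configuration in the charts. -/
noncomputable def locPts (x : Conf n M) (i : Fin n) : Euc d := (C.loc i).ψ (x.1 i)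

include hx in
theorem χ_ε_eq (h : C.p.1 i = C.p.1 j) : (C.loc j).χ (ε (x.1 i)) = C.locPts x i := by
  have h1 := (C.loc i).χ_ε _ (hx i)
  unfold loc at h1 ⊢
  rw [← h, h1]
  rfl

include hx in
theorem localDir_alpha (hij : i ≠ j) (h : C.p.1 i = C.p.1 j) :
    localDir C.Λ C.p i j (coords ε (alpha n ε x)) =
      (gap ε i j x)⁻¹ • (C.locPts x i - C.locPts x j) := by
  rw [localDir, dirVec_alpha ε hij, map_smul]
  congr 1
  have := (C.loc j).χ_sub (ε (x.1 i)) (ε (x.1 j))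
  rw [χ_ε_eq hx h, χ_ε_eq hx rfl] at this
  exact this.symm

include hε hx in
theorem relSize_alpha (hA : A ∈ C.P) : C.relSize A (coords ε (alpha n ε x)) =
    C.size (C.locPts x) A / gap ε (C.F.a A) (C.F.b A) x := by
  rw [relSize, localDir_alpha hx (a_ne_b hA)
    (eq_of_mem hA (C.F.b_mem A hA) (C.F.isLeast A hA).1 hε), size, gap_comm]
  simp only [PiLp.smul_apply, smul_eq_mul]
  ring

theorem a_notMem (hA : A ∈ C.P) (hB : B ∈ C.P) (hAB : A ⊂ B) (h : C.F.a A ≠ C.F.a B) :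
    C.F.a B ∉ A := fun h' =>
  h (le_antisymm ((C.F.isLeast A hA).2 h') ((C.F.isLeast B hB).2 (hAB.1 (C.F.isLeast A hA).1)))

theorem b_notMem (hA : A ∈ C.P) (hB : B ∈ C.P) (hAB : A ⊂ B) (h : C.F.a A = C.F.a B) :
    C.F.b B ∉ A := fun h' => by
  have h1 : A ∈ up C.P (C.F.b B) :=
    mem_up.2 ⟨hA, h', _, h ▸ (C.F.isLeast A hA).1, C.F.lt B hB⟩
  rw [C.F.up_b B hB] at h1
  exact hAB.2 (mem_above.1 h1).2

theorem distRatio_alpha (hB : B ∈ C.P) :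
    C.distRatio A B (coords ε (alpha n ε x)) =
      gap ε (C.F.a A) (C.F.b A) x / gap ε (C.F.a B) (C.F.b B) x := by
  rw [distRatio]
  split_ifs with h
  · rw [ratio_alpha ε, h]
    rw [h]
    exact (a_ne_b hB).symm
  · rw [ratio_alpha ε h, ratio_alpha ε (a_ne_b hB).symm, gap_comm (C.F.a B) (C.F.a A)]
    exact div_mul_div_cancel₀ (gap_pos h x).ne'

include hε hx in
theorem scaleRead_alpha (hA : A ∈ C.P) : C.scaleRead A (coords ε (alpha n ε x)) =
    C.size (C.locPts x) A / chainScale (C.size (C.locPts x)) (sabove C.P A) := by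
  have hab := (gap_pos (ε := ε) (a_ne_b hA).symm x).ne'
  rw [scaleRead, chainScale]
  split_ifs with h
  · have h1 := χ_ε_eq hx (eq_of_mem hA (C.F.b_mem A hA) (C.F.isLeast A hA).1 hε)
    have h2 := χ_ε_eq hx (rfl : C.p.1 (C.F.a A) = C.p.1 (C.F.a A))
    change C.sgn (C.F.b A) * ((C.loc (C.F.a A)).χ (ε (x.1 (C.F.b A))) -
      (C.loc (C.F.a A)).χ (ε (x.1 (C.F.a A)))) (C.c (C.F.b A)) = _
    rw [div_one, size, h1, h2]
  · obtain ⟨B, hB, hAB, h'⟩ := C.hP.sabove_eq_above_min hA (Finset.nonempty_iff_ne_empty.2 h)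
    rw [h', sInter_above hB, relSize_alpha hε hx hA, relSize_alpha hε hx hB,
      distRatio_alpha hB]
    have := (gap_pos (ε := ε) (a_ne_b hB).symm x).ne'
    by_cases h0 : C.size (C.locPts x) B = 0
    · simp [h0]
    · field_simp

include hε hx in
theorem shapeRead_alpha (k : Fin n) : C.shapeRead k (coords ε (alpha n ε x)) =
    (chainScale (C.size (C.locPts x)) (up C.P k))⁻¹ • C.F.disp (C.locPts x) k := by
  rw [shapeRead, chainScale, Frame.disp]
  split_ifs with h
  · rw [inv_one, one_smul, ← χ_ε_eq hx rfl]
    rfl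
  · obtain ⟨A, hA, hkA, ⟨j, hj, hjk⟩, h'⟩ :=
      C.hP.up_eq_above_min (Finset.nonempty_iff_ne_empty.2 h)
    have hak : C.F.a A ≠ k := (((C.F.isLeast A hA).2 hj).trans_lt hjk).ne
    rw [h', sInter_above hA, ratio_alpha ε (a_ne_b hA).symm, relSize_alpha hε hx hA,
      localDir_alpha hx hak.symm (eq_of_mem hA hkA (C.F.isLeast A hA).1 hε), smul_smul, gap_comm k]
    congr 1
    have h1 := (gap_pos (ε := ε) (a_ne_b hA).symm x).ne'
    have h2 := (gap_pos (ε := ε) hak x).ne'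
    by_cases h0 : C.size (C.locPts x) A = 0
    · simp [h0]
    · field_simp

/-- The coordinate `c` of the displacement of a second element is the signed size of its
cluster. -/
theorem size_eq_disp (u : Fin n → Euc d) (hA : A ∈ C.P) :
    C.size u A = C.sgn (C.F.b A) * C.F.disp u (C.F.b A) (C.c (C.F.b A)) := by
  rw [size, Frame.disp, if_neg, sInter_up_b hA]
  rw [C.F.up_b A hA]
  exact above_nonempty hA

include hε hx in
theorem shape_read_alpha (hσ : ∀ A ∈ C.P, C.size (C.locPts x) A ≠ 0) (k : Fin n) :
    C.shape (C.read (coords ε (alpha n ε x))) k =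
      (chainScale (C.size (C.locPts x)) (up C.P k))⁻¹ • C.F.disp (C.locPts x) k := by
  ext e
  by_cases h : C.IsB k ∧ e = C.c k
  · obtain ⟨⟨A, hA, rfl⟩, rfl⟩ := h
    have h1 := size_eq_disp (C.locPts x) hA
    have h2 : C.F.disp (C.locPts x) (C.F.b A) (C.c (C.F.b A)) =
        C.sgn (C.F.b A) * C.size (C.locPts x) A := by
      rw [h1, ← mul_assoc, C.sgn_mul_sgn, one_mul]
    have h3 : C.shape (C.read (coords ε (alpha n ε x))) (C.F.b A) (C.c (C.F.b A)) =
        C.sgn (C.F.b A) := by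
      simp [shape, isB_b hA]
    rw [h3, PiLp.smul_apply, h2, C.F.up_b A hA, chainScale_above _ hA, smul_eq_mul]
    field_simp [hσ A hA]
  · rw [read_shape _ _ _ h, shapeRead_alpha hε hx]

include hε hx in
/-- The corner coordinates of a configuration determine its points. -/
theorem pts_read_alpha (hσ : ∀ A ∈ C.P, C.size (C.locPts x) A ≠ 0) :
    C.pts (C.read (coords ε (alpha n ε x))) = C.locPts x := by
  funext i
  rw [← blowup_disp C.hP C.F _ hσ (C.locPts x) i, pts, blowup, blowup]
  refine Finset.sum_congr rfl fun k _ => ?_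
  rw [shape_read_alpha hε hx hσ]
  congr 1
  refine Finset.prod_congr rfl fun A hA => ?_
  have hA' := (mem_up.1 hA).1
  rw [read_scale hA', scaleRead_alpha hε hx hA']

/-- The size of a cluster is the product of the scales of the clusters which contain it. -/
theorem size_pts (z : Euc (n * d)) (hA : A ∈ C.P) :
    C.size (C.pts z) A = ∏ B ∈ above C.P A, C.scale z B := by
  have h1 := blowup_sub_of_up C.hP (C.scale z) (C.shape z) hA (C.F.b_mem A hA) (C.F.up_b A hA)
    (C.F.isLeast A hA) (C.F.lt A hA)
  rw [size, pts, pts, h1, PiLp.smul_apply, C.F.up_b A hA, smul_eq_mul]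
  have h3 : C.shape z (C.F.b A) (C.c (C.F.b A)) = C.sgn (C.F.b A) := by
    simp [shape, isB_b hA]
  rw [h3, mul_left_comm, C.sgn_mul_sgn, mul_one]

include hε hx in
/-- The corner coordinates are recovered from the points they parametrize. -/
theorem read_alpha_of_pts {z : Euc (n * d)} (hz : ∀ A ∈ C.P, C.scale z A ≠ 0)
    (h : C.locPts x = C.pts z) : C.read (coords ε (alpha n ε x)) = z := by
  have h1 := scale_blowup C.hP C.F (σ := C.size (C.pts z)) (y := C.shape z)
    (fun A hA => size_pts z hA) hz
  have hσ : ∀ A ∈ C.P, C.size (C.locPts x) A ≠ 0 := by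
    intro A hA
    rw [h, size_pts z hA]
    exact Finset.prod_ne_zero_iff.2 fun B hB => hz B (mem_above.1 hB).1
  refine ext_scale_shape (C := C) (fun A hA => ?_) fun k => ?_
  · rw [read_scale hA, scaleRead_alpha hε hx hA, h]
    exact h1.1 A hA
  · rw [shape_read_alpha hε hx hσ, h]
    exact h1.2 k

include hε in
/-- The difference of two points is the product of their scale and of `diff`. -/
theorem ambPts_sub_ambPts (z : Euc (n * d)) (i j : Fin n) :
    C.ambPts z i - C.ambPts z j = (∏ A ∈ common C.P i j, C.scale z A) • C.diff z i j := by
  by_cases h : C.p.1 i = C.p.1 j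
  · rw [diff, if_pos h, ambPts, ambPts]
    have h1 := (C.loc i).φ_sub (C.pts z i) (C.pts z j)
    have h2 : (C.loc j).φ = (C.loc i).φ := by unfold loc; rw [h]
    rw [h2, h1, ← map_smul, ← blowup_sub_blowup C.hP]
    rfl
  · have h1 : common C.P i j = ∅ := by
      by_contra hne
      obtain ⟨A, hA⟩ := Finset.nonempty_iff_ne_empty.2 hne
      obtain ⟨hA, hi, hj⟩ := mem_common.1 hA
      exact h (eq_of_mem hA hi hj hε)
    rw [diff, if_neg h, h1, Finset.prod_empty, one_smul]

open scoped Classical in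
theorem prod_common (z : Euc (n * d)) (i j k : Fin n) :
    ∏ A ∈ common C.P i j, C.scale z A =
      (∏ A ∈ common C.P i j with k ∈ A, C.scale z A) * C.sepScale z i j k :=
  (Finset.prod_filter_mul_prod_filter_not _ _ _).symm

include hε in
/-- The parametrization gives the coordinates of the configuration of the parametrized points when
all scales are positive. -/
theorem param_eq_coords {z : Euc (n * d)} (hz : ∀ A ∈ C.P, 0 < C.scale z A)
    (h : ∀ i, ε (x.1 i) = C.ambPts z i) : C.param z = coords ε (alpha n ε x) := by
  classical
  have hpos : ∀ Q : Finset (Set (Fin n)), Q ⊆ C.P → 0 < ∏ A ∈ Q, C.scale z A :=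
    fun Q hQ => Finset.prod_pos fun A hA => hz A (hQ hA)
  have hS : ∀ i j, 0 < ∏ A ∈ common C.P i j, C.scale z A :=
    fun i j => hpos _ fun A hA => (mem_common.1 hA).1
  have hd : ∀ i j, ε (x.1 i) - ε (x.1 j) =
      (∏ A ∈ common C.P i j, C.scale z A) • C.diff z i j := fun i j => by
    rw [h, h, ambPts_sub_ambPts hε]
  rw [coords_alpha]
  refine Prod.ext (funext fun i => (h i).symm) (Prod.ext (funext fun q => ?_) (funext fun t => ?_))
  · change ‖C.diff z (q.1 0) (q.1 1)‖⁻¹ • C.diff z (q.1 0) (q.1 1) =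
      ‖ε (x.1 (q.1 0)) - ε (x.1 (q.1 1))‖⁻¹ • (ε (x.1 (q.1 0)) - ε (x.1 (q.1 1)))
    have h0 := hS (q.1 0) (q.1 1)
    rw [hd, norm_smul, Real.norm_of_nonneg h0.le, smul_smul, mul_inv, mul_comm (_ * _),
      ← mul_assoc, mul_inv_cancel₀ h0.ne', one_mul]
  · have key : ∀ i j, dist (ε (x.1 i)) (ε (x.1 j)) =
        (∏ A ∈ common C.P i j, C.scale z A) * ‖C.diff z i j‖ := fun i j => by
      rw [dist_eq_norm, hd, norm_smul, Real.norm_of_nonneg (hS i j).le]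
    change _ = dist (ε (x.1 (t.1 0))) (ε (x.1 (t.1 1))) / (dist (ε (x.1 (t.1 0))) (ε (x.1 (t.1 1))) +
        dist (ε (x.1 (t.1 0))) (ε (x.1 (t.1 2))))
    rw [key, key, prod_common z _ _ (t.1 2), prod_common z (t.1 0) (t.1 2) (t.1 1)]
    have h1 : {A ∈ common C.P (t.1 0) (t.1 1) | t.1 2 ∈ A} =
        {A ∈ common C.P (t.1 0) (t.1 2) | t.1 1 ∈ A} := by
      ext A
      simp only [Finset.mem_filter, mem_common]
      tauto
    have h0 : 0 < ∏ A ∈ common C.P (t.1 0) (t.1 2) with t.1 1 ∈ A, C.scale z A :=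
      hpos _ fun A hA => (mem_common.1 (Finset.mem_filter.1 hA).1).1
    rw [h1, mul_assoc, mul_assoc, ← mul_add, mul_div_mul_left _ _ h0.ne']
    rfl

end CornerData

end

end FM

namespace FM

open Set Topology Filter Asymptotics

/-! ### Smoothness of the corner coordinates -/

variable {n d m : ℕ} {M : Type*} [TopologicalSpace M] {ε : M ↪ Euc m}

section Ratio

variable {p : Ambient n m M} (hp : p ∈ closure (range (alpha n ε)))

include hp in
theorem intervalCoord_add {i j k : Fin n} (h1 : i ≠ j) (h2 : i ≠ k) (h3 : j ≠ k) :
    intervalCoord (p.2.2 (triple i j k h1 h2 h3)) +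
      intervalCoord (p.2.2 (triple i k j h2 h1 h3.symm)) = 1 := by
  have := neBot_approach hp
  refine tendsto_nhds_unique ((tendsto_ratio (ε := ε) h1 h2 h3).add (tendsto_ratio h2 h1 h3.symm))
    (tendsto_const_nhds.congr fun x => ?_)
  have := gap_pos (ε := ε) h1 x
  have := gap_pos (ε := ε) h2 x
  rw [add_comm (gap ε i k x), ← add_div, div_self (by positivity)]

include hp in
theorem contDiffAt_ratio {i j k : Fin n} (h : ¬ Excludes p i k j) :
    ContDiffAt ℝ ∞ (ratio i j k) (coords ε p) := by
  by_cases h0 : i ≠ j ∧ i ≠ k ∧ j ≠ k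
  · obtain ⟨h1, h2, h3⟩ := h0
    have h4 : ratio (m := m) i j k = fun q => q.2.2 (triple i j k h1 h2 h3) /
        (1 - q.2.2 (triple i j k h1 h2 h3)) := by
      funext q
      rw [ratio, dif_pos ⟨h1, h2, h3⟩]
    have h5 : 1 - (coords ε p).2.2 (triple i j k h1 h2 h3) ≠ 0 := by
      change 1 - intervalCoord (p.2.2 (triple i j k h1 h2 h3)) ≠ 0
      rw [sub_eq_iff_eq_add'.2 (intervalCoord_add hp h1 h2 h3).symm, ← intervalCoord_zero]
      exact fun e => h ((excludes_iff h2 h1 h3.symm).2 (intervalCoord_injective e))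
    have h6 : ContDiff ℝ ∞ fun q : CoordSpace n m => q.2.2 (triple i j k h1 h2 h3) := by fun_prop
    rw [h4]
    exact h6.contDiffAt.div (contDiffAt_const.sub h6.contDiffAt) h5
  · have h4 : ratio (m := m) i j k = fun _ => if i = j then 0 else 1 := by
      funext q
      rw [ratio, dif_neg h0]
    rw [h4]
    exact contDiffAt_const

omit [TopologicalSpace M] in
theorem ratio_eq_zero {i j k : Fin n} (h : i = j ∨ Excludes p i j k) :
    ratio i j k (coords ε p) = 0 := by
  rcases h with h | h
  · rw [ratio, dif_neg (fun h' => h'.1 h), if_pos h]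
  · obtain ⟨h1, h2, h3⟩ := excludes_ne h
    rw [ratio, dif_pos ⟨h1, h2, h3⟩]
    have : (coords ε p).2.2 (triple i j k h1 h2 h3) = 0 := by
      change intervalCoord (p.2.2 (triple i j k h1 h2 h3)) = 0
      rw [(excludes_iff h1 h2 h3).1 h, intervalCoord_zero]
    rw [this, zero_div]

theorem contDiff_localDir (Λ : ∀ a : M, LocalParam d ε a) (p : Ambient n m M) (i j : Fin n) :
    ContDiff ℝ ∞ (localDir Λ p i j) := by
  have h1 : ContDiff ℝ ∞ fun q : CoordSpace n m => dirVec i j q := by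
    unfold dirVec
    split_ifs
    · fun_prop
    · exact contDiff_const
  have h2 := (Λ (p.1 j)).contDiff_Dχ
  unfold localDir
  exact (h2.comp (by fun_prop : ContDiff ℝ ∞ fun q : CoordSpace n m => (q.1 i, q.1 j))).clm_apply h1

include hp in
/-- The limit directions of points which collide are nonzero in the charts. -/
theorem localDir_ne_zero (hε : IsEmbedding ε) (Λ : ∀ a : M, LocalParam d ε a) {i j : Fin n}
    (hij : i ≠ j) (h : p.1 i = p.1 j) : localDir Λ p i j (coords ε p) ≠ 0 := by
  have := neBot_approach hp
  have hc := tendsto_coords_approach (p := p) hε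
  let L := Λ (p.1 j)
  let G : CoordSpace n m → Euc m := fun q => L.Dφ (L.χ (q.1 i), L.χ (q.1 j)) (localDir Λ p i j q)
  have hG : Continuous G := by
    have h1 := L.contDiff_χ.continuous
    exact (L.contDiff_Dφ.continuous.comp (by fun_prop)).clm_apply
      (contDiff_localDir Λ p i j).continuous
  have hev : ∀ l : Fin n, p.1 l = p.1 j → ∀ᶠ x in approach ε p, x.1 l ∈ L.ψ.source := by
    intro l hl
    have h1 : Tendsto (fun x : Conf n M => x.1 l) (approach ε p) (𝓝 (p.1 l)) :=
      ((by fun_prop : Continuous fun q : Ambient n m M => q.1 l).tendsto p).comp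
        tendsto_alpha_approach
    exact h1 (L.ψ.open_source.mem_nhds (by rw [hl]; exact L.mem))
  have hd : Continuous fun q : CoordSpace n m => dirVec i j q := by
    have : (fun q : CoordSpace n m => dirVec i j q) = fun q => q.2.1 (pair i j hij) := by
      funext q
      rw [dirVec, dif_pos hij]
    rw [this]
    fun_prop
  have hlim : G (coords ε p) = dirVec i j (coords ε p) := by
    refine tendsto_nhds_unique ((hG.tendsto _).comp hc) (((hd.tendsto _).comp hc).congr' ?_)
    filter_upwards [hev i h, hev j rfl] with x hi hj
    have h1 := L.φ_sub (L.ψ (x.1 i)) (L.ψ (x.1 j))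
    have h2 := L.χ_sub (ε (x.1 i)) (ε (x.1 j))
    rw [L.χ_ε _ hi, L.χ_ε _ hj] at h2
    rw [L.φ_ψ _ hi, L.φ_ψ _ hj] at h1
    change _ = L.Dφ (L.χ (ε (x.1 i)), L.χ (ε (x.1 j)))
      (L.Dχ (ε (x.1 i), ε (x.1 j)) (dirVec i j (coords ε (alpha n ε x))))
    rw [Function.comp_apply, L.χ_ε _ hi, L.χ_ε _ hj, dirVec_alpha ε hij, map_smul, ← h2, map_smul,
      ← h1]
  intro h0
  have h1 : dirVec i j (coords ε p) = 0 := by rw [← hlim]; simp [G, h0]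
  have h2 : ‖dirVec i j (coords ε p)‖ = 1 := by
    rw [dirVec, dif_pos hij]
    exact mem_sphere_zero_iff_norm.1 (p.2.1 (pair i j hij)).2
  rw [h1, norm_zero] at h2
  exact zero_ne_one h2

end Ratio

theorem exists_cornerData [ChartedSpace (Euc d) M] [IsManifold (𝓡 d) ∞ M] [NeZero n] (hd : 0 < d)
    (hε : Manifold.IsSmoothEmbedding (𝓡 d) (𝓡 m) ∞ ε) {p : Ambient n m M}
    (hp : p ∈ closure (range (alpha n ε))) : ∃ C : CornerData d ε n, C.p = p := by
  have hemb : IsEmbedding ε := hε.isEmbedding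
  have hlam := isLaminar_parenthesization hp hemb
  let P : Finset (Set (Fin n)) := (Set.toFinite (parenthesization p)).toFinset
  have hmem : ∀ A, A ∈ P ↔ A ∈ parenthesization p := fun A => by simp [P]
  have hP : IsLaminar P := ⟨fun A hA => hlam.1 A ((hmem A).1 hA), fun A hA B hB =>
    hlam.2 A ((hmem A).1 hA) B ((hmem B).1 hB)⟩
  obtain ⟨F⟩ := hP.nonempty_frame
  let Λ : ∀ a : M, LocalParam d ε a := fun a => (nonempty_localParam hε a).some
  have hne : ∀ A ∈ P, localDir Λ p (F.b A) (F.a A) (coords ε p) ≠ 0 := by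
    intro A hA
    have hab : F.b A ≠ F.a A := (F.lt A hA).ne'
    exact localDir_ne_zero hp hemb Λ hab ((eq_iff_exists_mem_parenthesization hp hemb hab).2
      ⟨A, (hmem A).1 hA, F.b_mem A hA, (F.isLeast A hA).1⟩)
  have hex : ∀ k, ∃ (e : Fin d) (s : ℝ), s * s = 1 ∧
      ∀ A ∈ P, F.b A = k → 0 < s * localDir Λ p (F.b A) (F.a A) (coords ε p) e := by
    intro k
    by_cases hk : ∃ A ∈ P, F.b A = k
    · obtain ⟨A, hA, rfl⟩ := hk
      obtain ⟨e, he⟩ : ∃ e, localDir Λ p (F.b A) (F.a A) (coords ε p) e ≠ 0 := by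
        by_contra! h
        exact hne A hA (by ext e; exact h e)
      have huniq : ∀ B ∈ P, F.b B = F.b A → B = A := fun B hB h => F.b_injOn hB hA h
      rcases lt_or_gt_of_ne he with h | h
      · refine ⟨e, -1, by norm_num, fun B hB hBA => ?_⟩
        rw [huniq B hB hBA]
        linarith
      · refine ⟨e, 1, by norm_num, fun B hB hBA => ?_⟩
        rw [huniq B hB hBA]
        linarith
    · exact ⟨⟨0, hd⟩, 1, by norm_num, fun A hA h => absurd ⟨A, hA, h⟩ hk⟩
  choose c s h1 h2 using hex
  exact ⟨⟨p, hp, Λ, P, hP, by ext A; rw [Finset.mem_coe, hmem], F, c, s, h1,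
    fun A hA => h2 _ A hA rfl⟩, rfl⟩

namespace CornerData

variable {C : CornerData d ε n} {A B : Set (Fin n)} (hε : IsEmbedding ε)

include hε in
theorem excludes_iff_P {i j k : Fin n} (hij : i ≠ j) (hik : i ≠ k) :
    Excludes C.p i j k ↔ ∃ A ∈ C.P, i ∈ A ∧ j ∈ A ∧ k ∉ A := by
  have h1 := eq_or_excludes_iff (ε := ε) C.hp (j := j) hik
  rw [isLittleO_gap_iff C.hp hε hij hik, or_iff_right hij.symm] at h1
  simp only [h1, mem_P]

theorem subset_of_a_b_mem (hA : A ∈ C.P) (hB : B ∈ C.P) (h1 : C.F.a A ∈ B) (h2 : C.F.b A ∈ B) :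
    A ⊆ B := by
  have : B ∈ common C.P (C.F.a A) (C.F.b A) := mem_common.2 ⟨hB, h1, h2⟩
  rw [C.F.common_a_b hA] at this
  exact (mem_above.1 this).2

theorem contDiff_relSize (A : Set (Fin n)) : ContDiff ℝ ∞ (C.relSize A) := by
  have := contDiff_localDir C.Λ C.p (C.F.b A) (C.F.a A)
  unfold relSize
  fun_prop

include hε in
theorem contDiffAt_ratio_of_forall {i j k : Fin n}
    (h : ∀ D ∈ C.P, i ∈ D → k ∈ D → j ∈ D) : ContDiffAt ℝ ∞ (ratio i j k) (coords ε C.p) := by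
  refine contDiffAt_ratio C.hp fun h' => ?_
  obtain ⟨h1, h2, -⟩ := excludes_ne h'
  obtain ⟨D, hD, hi, hk, hj⟩ := (excludes_iff_P hε h1 h2).1 h'
  exact hj (h D hD hi hk)

include hε in
theorem contDiffAt_distRatio (hA : A ∈ C.P) (hB : B ∈ C.P) (hAB : A ⊂ B) :
    ContDiffAt ℝ ∞ (C.distRatio A B) (coords ε C.p) := by
  by_cases h : C.F.a A = C.F.a B
  · have : C.distRatio A B = ratio (C.F.a A) (C.F.b A) (C.F.b B) := by
      funext q
      rw [distRatio, if_pos h]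
    rw [this]
    exact contDiffAt_ratio_of_forall hε fun D hD h1 h2 =>
      subset_of_a_b_mem hB hD (h ▸ h1) h2 (hAB.1 (C.F.b_mem A hA))
  · have : C.distRatio A B = fun q =>
        ratio (C.F.a A) (C.F.b A) (C.F.a B) q * ratio (C.F.a B) (C.F.a A) (C.F.b B) q := by
      funext q
      rw [distRatio, if_neg h]
    rw [this]
    refine (contDiffAt_ratio_of_forall hε fun D hD h1 h2 => ?_).mul
      (contDiffAt_ratio_of_forall hε fun D hD h1 h2 =>
        subset_of_a_b_mem hB hD h1 h2 (hAB.1 (C.F.isLeast A hA).1))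
    rcases C.hP.nested A hA D hD _ (C.F.isLeast A hA).1 h1 with h3 | h3
    · exact h3 (C.F.b_mem A hA)
    · exact absurd (h3 h2) (a_notMem hA hB hAB h)

include hε in
theorem distRatio_eq_zero (hA : A ∈ C.P) (hB : B ∈ C.P) (hAB : A ⊂ B) :
    C.distRatio A B (coords ε C.p) = 0 := by
  have key : ∀ k, k ∉ A → ratio (C.F.a A) (C.F.b A) k (coords ε C.p) = 0 := fun k hk =>
    ratio_eq_zero (Or.inr ((excludes_iff_P hε (a_ne_b hA).symm
      (by rintro rfl; exact hk (C.F.isLeast A hA).1)).2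
        ⟨A, hA, (C.F.isLeast A hA).1, C.F.b_mem A hA, hk⟩))
  rw [distRatio]
  split_ifs with h
  · exact key _ (b_notMem hA hB hAB h)
  · rw [key _ (a_notMem hA hB hAB h), zero_mul]

include hε in
theorem contDiffAt_scaleRead (hA : A ∈ C.P) :
    ContDiffAt ℝ ∞ (C.scaleRead A) (coords ε C.p) := by
  by_cases h : sabove C.P A = ∅
  · have h1 : C.scaleRead A = fun q => C.sgn (C.F.b A) *
        ((C.loc (C.F.a A)).χ (q.1 (C.F.b A)) - (C.loc (C.F.a A)).χ (q.1 (C.F.a A)))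
          (C.c (C.F.b A)) := by
      funext q
      rw [scaleRead, if_pos h]
    have h2 := (C.loc (C.F.a A)).contDiff_χ
    rw [h1]
    refine ContDiff.contDiffAt ?_
    fun_prop
  · obtain ⟨B, hB, hAB, h'⟩ := C.hP.sabove_eq_above_min hA (Finset.nonempty_iff_ne_empty.2 h)
    have h1 : C.scaleRead A = fun q => C.relSize A q / C.relSize B q * C.distRatio A B q := by
      funext q
      rw [scaleRead, if_neg h, h', sInter_above hB]
    rw [h1]
    exact ((contDiff_relSize A).contDiffAt.div (contDiff_relSize B).contDiffAt
      (C.pos B hB).ne').mul (contDiffAt_distRatio hε hA hB hAB)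

include hε in
theorem scaleRead_eq_zero (hA : A ∈ C.P) : C.scaleRead A (coords ε C.p) = 0 := by
  rw [scaleRead]
  split_ifs with h
  · have : (coords ε C.p).1 (C.F.b A) = (coords ε C.p).1 (C.F.a A) :=
      congrArg ε (eq_of_mem hA (C.F.b_mem A hA) (C.F.isLeast A hA).1 hε)
    rw [this, sub_self]
    simp
  · obtain ⟨B, hB, hAB, h'⟩ := C.hP.sabove_eq_above_min hA (Finset.nonempty_iff_ne_empty.2 h)
    rw [h', sInter_above hB, distRatio_eq_zero hε hA hB hAB, mul_zero]

include hε in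
theorem contDiffAt_shapeRead (k : Fin n) : ContDiffAt ℝ ∞ (C.shapeRead k) (coords ε C.p) := by
  by_cases h : up C.P k = ∅
  · have h1 : C.shapeRead k = fun q => (C.loc k).χ (q.1 k) := by
      funext q
      rw [shapeRead, if_pos h]
    have h2 := (C.loc k).contDiff_χ
    rw [h1]
    refine ContDiff.contDiffAt ?_
    fun_prop
  · obtain ⟨A, hA, hkA, -, h'⟩ := C.hP.up_eq_above_min (Finset.nonempty_iff_ne_empty.2 h)
    have h1 : C.shapeRead k = fun q => (ratio (C.F.a A) k (C.F.b A) q / C.relSize A q) •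
        localDir C.Λ C.p k (C.F.a A) q := by
      funext q
      rw [shapeRead, if_neg h, h', sInter_above hA]
    rw [h1]
    exact ((contDiffAt_ratio_of_forall hε fun D hD h1 h2 => subset_of_a_b_mem hA hD h1 h2 hkA).div
      (contDiff_relSize A).contDiffAt (C.pos A hA).ne').smul
        (contDiff_localDir C.Λ C.p k (C.F.a A)).contDiffAt

include hε in
theorem contDiffAt_read : ContDiffAt ℝ ∞ C.read (coords ε C.p) := by
  rw [contDiffAt_euclidean]
  intro l
  obtain ⟨⟨k, e⟩, rfl⟩ := finProdFinEquiv.surjective l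
  simp only [read_apply]
  split_ifs with h
  · obtain ⟨⟨A, hA, rfl⟩, -⟩ := h
    simp only [sInter_up_b hA]
    exact contDiffAt_scaleRead hε hA
  · exact (contDiffAt_euclidean.1 (contDiffAt_shapeRead hε k) e).sub contDiffAt_const

include hε in
/-- The corner coordinates of the given point: the scales vanish, the others are `1`. -/
theorem read_coords_p : (∀ A ∈ C.P, C.scale (C.read (coords ε C.p)) A = 0) ∧
    ∀ l, (∀ A ∈ C.P, C.scaleIdx A ≠ l) → C.read (coords ε C.p) l = 1 := by
  refine ⟨fun A hA => by rw [read_scale hA, scaleRead_eq_zero hε hA], fun l hl => ?_⟩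
  obtain ⟨⟨k, e⟩, rfl⟩ := finProdFinEquiv.surjective l
  rw [read_apply, if_neg]
  · simp [base]
  · rintro ⟨⟨A, hA, rfl⟩, rfl⟩
    exact hl A hA rfl

theorem scaleIdx_injOn (hA : A ∈ C.P) (hB : B ∈ C.P) (h : C.scaleIdx A = C.scaleIdx B) : A = B :=
  C.F.b_injOn hA hB (congrArg Prod.fst (finProdFinEquiv.injective h))

end CornerData

end FM

namespace FM

open Set Topology Filter Asymptotics

/-! ### The parametrization by corner coordinates -/

theorem IsLaminar.common_eq_above_min {n : ℕ} {P : Finset (Set (Fin n))} (hP : IsLaminar P)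
    {i j : Fin n} (h : (common P i j).Nonempty) :
    ∃ A ∈ P, i ∈ A ∧ j ∈ A ∧ common P i j = above P A := by
  obtain ⟨A, hA, hmin⟩ := (common P i j).exists_minimal h
  obtain ⟨hA, hi, hj⟩ := mem_common.1 hA
  refine ⟨A, hA, hi, hj, Finset.ext fun B => ?_⟩
  rw [mem_above]
  constructor
  · intro hB
    obtain ⟨hB', hi', -⟩ := mem_common.1 hB
    rcases hP.nested A hA B hB' i hi hi' with h1 | h1
    · exact ⟨hB', h1⟩
    · exact ⟨hB', hmin hB h1⟩
  · rintro ⟨hB, hAB⟩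
    exact mem_common.2 ⟨hB, hAB hi, hAB hj⟩

theorem IsLaminar.univ_mem {n : ℕ} {P : Finset (Set (Fin n))} (hP : IsLaminar P) (hn : 2 ≤ n)
    (h : ∀ i j, i ≠ j → ∃ A ∈ P, i ∈ A ∧ j ∈ A) : univ ∈ P := by
  let i : Fin n := ⟨0, by omega⟩
  obtain ⟨B, hB, hiB, -⟩ := h i ⟨1, by omega⟩ (by simp [i])
  obtain ⟨A, hA, hmax⟩ := Set.Finite.exists_maximal (s := {B | B ∈ P ∧ i ∈ B}) (Set.toFinite _)
    ⟨B, hB, hiB⟩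
  have : A = univ := by
    refine eq_univ_of_forall fun j => ?_
    by_cases hij : i = j
    · exact hij ▸ hA.2
    · obtain ⟨B, hB, hi, hj⟩ := h i j hij
      rcases hP.nested A hA.1 B hB i hA.2 hi with h1 | h1
      · exact hmax ⟨hB, hi⟩ h1 hj
      · exact h1 hj
  exact this ▸ hA.1

theorem IsLaminar.mono {n : ℕ} {P Q : Finset (Set (Fin n))} (hP : IsLaminar P) (h : Q ⊆ P) :
    IsLaminar Q :=
  ⟨fun A hA => hP.nontrivial A (h hA), fun A hA B hB => hP.nested A (h hA) B (h hB)⟩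

theorem exists_intervalCoord_eq {c : ℝ} (h0 : 0 ≤ c) (h1 : c ≤ 1) : ∃ a, intervalCoord a = c := by
  refine ⟨(ENNReal.ofReal (1 - c))⁻¹ - 1, ?_⟩
  have h2 : (1 : ℝ≥0∞) ≤ (ENNReal.ofReal (1 - c))⁻¹ := by
    rw [ENNReal.one_le_inv, ← ENNReal.ofReal_one]
    exact ENNReal.ofReal_le_ofReal (by linarith)
  rw [intervalCoord_eq, add_tsub_cancel_of_le h2, inv_inv, ENNReal.toReal_ofReal (by linarith)]
  ring

variable {n d m : ℕ} {M : Type*} [TopologicalSpace M] {ε : M ↪ Euc m}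

namespace CornerData

variable {C : CornerData d ε n} {A B : Set (Fin n)} (hε : IsEmbedding ε)

variable (C) in
/-- The denominator in the formula for the ratios of distances. -/
noncomputable def den (z : Euc (n * d)) (t : Conf 3 (Fin n)) : ℝ :=
  C.sepScale z (t.1 0) (t.1 1) (t.1 2) * ‖C.diff z (t.1 0) (t.1 1)‖ +
    C.sepScale z (t.1 0) (t.1 2) (t.1 1) * ‖C.diff z (t.1 0) (t.1 2)‖

variable (C) in
/-- The open set on which the parametrization is smooth. -/
def dom : Set (Euc (n * d)) :=
  {z | (∀ i, C.pts z i ∈ (C.loc i).ψ.target) ∧ (∀ q : Conf 2 (Fin n), C.diff z (q.1 0) (q.1 1) ≠ 0) ∧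
    (∀ t, C.den z t ≠ 0) ∧ ∀ l, (∀ A ∈ C.P, C.scaleIdx A ≠ l) → 0 < z l}

theorem contDiff_scale (A : Set (Fin n)) : ContDiff ℝ ∞ fun z => C.scale z A := by
  unfold scale
  fun_prop

theorem contDiff_shape (k : Fin n) : ContDiff ℝ ∞ fun z => C.shape z k := by
  rw [contDiff_euclidean]
  intro e
  by_cases h : C.IsB k ∧ e = C.c k
  · simp only [shape, h, and_self, if_true]
    exact contDiff_const
  · simp only [shape, h, if_false]
    fun_prop

theorem contDiff_pts (i : Fin n) : ContDiff ℝ ∞ fun z => C.pts z i := by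
  unfold pts blowup
  exact ContDiff.sum fun k _ =>
    (contDiff_prod fun A _ => contDiff_scale A).smul (contDiff_shape k)

theorem contDiff_ambPts (i : Fin n) : ContDiff ℝ ∞ fun z => C.ambPts z i :=
  (C.loc i).contDiff_φ.comp (contDiff_pts i)

theorem contDiff_diff (i j : Fin n) : ContDiff ℝ ∞ fun z => C.diff z i j := by
  unfold diff
  split_ifs with h
  · refine ((C.loc i).contDiff_Dφ.comp ((contDiff_pts i).prodMk (contDiff_pts j))).clm_apply ?_
    unfold blowupDiff
    exact (ContDiff.sum fun k _ =>
      (contDiff_prod fun A _ => contDiff_scale A).smul (contDiff_shape k)).sub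
      (ContDiff.sum fun k _ =>
        (contDiff_prod fun A _ => contDiff_scale A).smul (contDiff_shape k))
  · exact (contDiff_ambPts i).sub (contDiff_ambPts j)

theorem contDiff_sepScale (i j k : Fin n) : ContDiff ℝ ∞ fun z => C.sepScale z i j k := by
  unfold sepScale
  exact contDiff_prod fun A _ => contDiff_scale A

theorem isOpen_dom : IsOpen C.dom := by
  have h1 : ∀ i, Continuous fun z => C.pts z i := fun i => (contDiff_pts i).continuous
  have h2 : ∀ i j, Continuous fun z => C.diff z i j := fun i j => (contDiff_diff i j).continuous
  have h3 : ∀ i j k, Continuous fun z => C.sepScale z i j k :=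
    fun i j k => (contDiff_sepScale i j k).continuous
  have h4 : ∀ t, Continuous fun z => C.den z t := fun t =>
    ((h3 _ _ _).mul (h2 _ _).norm).add ((h3 _ _ _).mul (h2 _ _).norm)
  unfold dom
  simp only [ofPred_and, ofPred_forall]
  refine (isOpen_iInter_of_finite fun i => (C.loc i).ψ.open_target.preimage (h1 i)).inter
    ((isOpen_iInter_of_finite fun q => isOpen_ne.preimage (h2 _ _)).inter
      ((isOpen_iInter_of_finite fun t => isOpen_ne.preimage (h4 t)).inter
        (isOpen_iInter_of_finite fun l => isOpen_iInter_of_finite fun _ => ?_)))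
  exact isOpen_lt continuous_const (by fun_prop)

theorem contDiffOn_param : ContDiffOn ℝ ∞ C.param C.dom := by
  intro z hz
  refine ContDiffAt.contDiffWithinAt ?_
  obtain ⟨-, h2, h3, -⟩ := hz
  have hn : ∀ q : Conf 2 (Fin n), ContDiffAt ℝ ∞ (fun z => ‖C.diff z (q.1 0) (q.1 1)‖) z :=
    fun q => (contDiff_diff _ _).contDiffAt.norm ℝ (h2 q)
  have hn' : ∀ i j, i ≠ j → ContDiffAt ℝ ∞ (fun z => ‖C.diff z i j‖) z :=
    fun i j h => hn (pair i j h)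
  refine ContDiffAt.prodMk (contDiffAt_pi.2 fun i => (contDiff_ambPts i).contDiffAt)
    (ContDiffAt.prodMk (contDiffAt_pi.2 fun q => ?_) (contDiffAt_pi.2 fun t => ?_))
  · exact ((hn q).inv (norm_ne_zero_iff.2 (h2 q))).smul (contDiff_diff _ _).contDiffAt
  · have h5 := (contDiff_sepScale (C := C) (t.1 0) (t.1 1) (t.1 2)).contDiffAt (x := z)
    have h6 := (contDiff_sepScale (C := C) (t.1 0) (t.1 2) (t.1 1)).contDiffAt (x := z)
    have h7 := hn' (t.1 0) (t.1 1) (t.ne (by decide))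
    have h8 := hn' (t.1 0) (t.1 2) (t.ne (by decide))
    exact (h5.mul h7).div ((h5.mul h7).add (h6.mul h8)) (h3 t)

section

variable {x : Conf n M} (hx : ∀ i, x.1 i ∈ (C.loc i).ψ.source)
  (hpos : ∀ A ∈ C.P, 0 < C.relSize A (coords ε (alpha n ε x)))

include hε hx hpos

theorem size_pos (hA : A ∈ C.P) : 0 < C.size (C.locPts x) A := by
  have h1 := hpos A hA
  rw [relSize_alpha hε hx hA] at h1
  exact (div_pos_iff_of_pos_right (gap_pos (a_ne_b hA).symm x)).1 h1

theorem scale_read_pos (hA : A ∈ C.P) : 0 < C.scale (C.read (coords ε (alpha n ε x))) A := by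
  rw [read_scale hA, scaleRead_alpha hε hx hA]
  refine div_pos (size_pos hε hx hpos hA) ?_
  rcases (sabove C.P A).eq_empty_or_nonempty with h | h
  · simp [h, chainScale]
  · obtain ⟨B, hB, -, h'⟩ := C.hP.sabove_eq_above_min hA h
    rw [h', chainScale_above _ hB]
    exact size_pos hε hx hpos hB

theorem pts_read_alpha_of_pos : C.pts (C.read (coords ε (alpha n ε x))) = C.locPts x :=
  pts_read_alpha hε hx fun _ hA => (size_pos hε hx hpos hA).ne'

theorem ambPts_read_alpha (i : Fin n) :
    C.ambPts (C.read (coords ε (alpha n ε x))) i = ε (x.1 i) := by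
  rw [ambPts, pts_read_alpha_of_pos hε hx hpos]
  exact (C.loc i).φ_ψ _ (hx i)

theorem param_read_alpha : C.param (C.read (coords ε (alpha n ε x))) = coords ε (alpha n ε x) :=
  param_eq_coords hε (fun _ hA => scale_read_pos hε hx hpos hA)
    fun i => (ambPts_read_alpha hε hx hpos i).symm

end

include hε in
/-- Corner coordinates with positive scales are those of a configuration. -/
theorem exists_conf {z : Euc (n * d)} (hz : z ∈ C.dom) (hs : ∀ A ∈ C.P, 0 < C.scale z A) :
    ∃ x : Conf n M, C.param z = coords ε (alpha n ε x) ∧ C.read (C.param z) = z := by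
  let x : Fin n → M := fun i => (C.loc i).ψ.symm (C.pts z i)
  have hx : ∀ i, x i ∈ (C.loc i).ψ.source := fun i => (C.loc i).ψ.map_target (hz.1 i)
  have hψ : ∀ i, (C.loc i).ψ (x i) = C.pts z i := fun i => (C.loc i).ψ.right_inv (hz.1 i)
  have hεx : ∀ i, ε (x i) = C.ambPts z i := fun i => by
    rw [ambPts, ← hψ, (C.loc i).φ_ψ _ (hx i)]
  have hinj : Function.Injective x := by
    intro i j hij
    by_contra hne
    have h1 := ambPts_sub_ambPts hε (C := C) z i j
    rw [← hεx, ← hεx, hij, sub_self] at h1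
    rcases smul_eq_zero.1 h1.symm with h2 | h2
    · exact (Finset.prod_pos fun A hA => hs A (mem_common.1 hA).1).ne' h2
    · exact hz.2.1 (pair i j hne) h2
  have h1 := param_eq_coords hε (C := C) (x := ⟨x, hinj⟩) hs hεx
  refine ⟨⟨x, hinj⟩, h1, ?_⟩
  rw [h1]
  exact read_alpha_of_pts hε hx (fun A hA => (hs A hA).ne') (funext hψ)

theorem eventually_mem_source :
    ∀ᶠ x in approach ε C.p, ∀ i, x.1 i ∈ (C.loc i).ψ.source := by
  rw [eventually_all]
  intro i
  have h1 : Tendsto (fun x : Conf n M => x.1 i) (approach ε C.p) (𝓝 (C.p.1 i)) :=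
    ((by fun_prop : Continuous fun q : Ambient n m M => q.1 i).tendsto C.p).comp
      tendsto_alpha_approach
  exact h1 ((C.loc i).ψ.open_source.mem_nhds (C.loc i).mem)

include hε in
theorem eventually_relSize_pos :
    ∀ᶠ x in approach ε C.p, ∀ A ∈ C.P, 0 < C.relSize A (coords ε (alpha n ε x)) := by
  rw [Finset.eventually_all]
  intro A hA
  have h1 := ((contDiff_relSize (C := C) A).continuous.tendsto _).comp
    (tendsto_coords_approach (p := C.p) hε)
  exact h1.eventually_const_lt (C.pos A hA)

include hε in
theorem tendsto_read :
    Tendsto (fun x => C.read (coords ε (alpha n ε x))) (approach ε C.p)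
      (𝓝 (C.read (coords ε C.p))) :=
  (contDiffAt_read hε).continuousAt.tendsto.comp (tendsto_coords_approach hε)

include hε in
theorem pts_read_p (i : Fin n) : C.pts (C.read (coords ε C.p)) i = (C.loc i).ψ (C.p.1 i) := by
  have := neBot_approach C.hp
  have h1 : Tendsto (fun x : Conf n M => (C.loc i).χ (ε (x.1 i))) (approach ε C.p)
      (𝓝 ((C.loc i).χ (ε (C.p.1 i)))) := by
    have h2 := (C.loc i).contDiff_χ.continuous
    have h3 := hε.continuous
    exact ((by fun_prop : Continuous fun q : Ambient n m M =>
      (C.loc i).χ (ε (q.1 i))).tendsto C.p).comp tendsto_alpha_approach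
  rw [(C.loc i).χ_ε _ (C.loc i).mem] at h1
  refine tendsto_nhds_unique (((contDiff_pts i).continuous.tendsto _).comp (tendsto_read hε))
    (h1.congr' ?_)
  filter_upwards [eventually_mem_source (C := C), eventually_relSize_pos hε] with x hx hpos
  rw [Function.comp_apply, pts_read_alpha_of_pos hε hx hpos, (C.loc i).χ_ε _ (hx i)]
  rfl

include hε in
/-- The points with the corner coordinates of the given point are separated at the rate given by the
scales: this is where all the asymptotic information in the parenthesization is used. -/
theorem diff_read_p_ne_zero {i j : Fin n} (hij : i ≠ j) :
    C.diff (C.read (coords ε C.p)) i j ≠ 0 := by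
  have := neBot_approach C.hp
  intro h0
  have hlim : Tendsto (fun x => C.diff (C.read (coords ε (alpha n ε x))) i j) (approach ε C.p)
      (𝓝 0) := h0 ▸ ((contDiff_diff i j).continuous.tendsto _).comp (tendsto_read hε)
  have hev := (eventually_mem_source (C := C)).and (eventually_relSize_pos hε)
  rcases (common C.P i j).eq_empty_or_nonempty with h | h
  · have h1 : (fun x => C.diff (C.read (coords ε (alpha n ε x))) i j) =ᶠ[approach ε C.p]
        fun x => ε (x.1 i) - ε (x.1 j) := by
      filter_upwards [hev] with x hx
      have h2 := ambPts_sub_ambPts hε (C := C) (C.read (coords ε (alpha n ε x))) i j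
      rw [h, Finset.prod_empty, one_smul, ambPts_read_alpha hε hx.1 hx.2,
        ambPts_read_alpha hε hx.1 hx.2] at h2
      exact h2.symm
    have h3 : Tendsto (gap ε i j) (approach ε C.p) (𝓝 0) := by
      have := (hlim.congr' h1).norm
      rw [norm_zero] at this
      exact this.congr fun x => (dist_eq_norm _ _).symm
    have h4 := tendsto_nhds_unique h3 (tendsto_gap hε i j)
    obtain ⟨A, hA, hi, hj⟩ := (eq_iff_exists_mem_parenthesization C.hp hε hij).1
      (ε.injective (dist_eq_zero.1 h4.symm))
    have : A ∈ common C.P i j := mem_common.2 ⟨mem_P.2 hA, hi, hj⟩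
    simp [h] at this
  · obtain ⟨J, hJ, hi, hj, hcom⟩ := C.hP.common_eq_above_min h
    have h1 : gap ε (C.F.a J) (C.F.b J) =O[approach ε C.p] gap ε i j := by
      refine isBigO_gap_of_forall C.hp hε hij fun A hA h1 h2 => ?_
      have h3 : A ∈ common C.P i j := mem_common.2 ⟨mem_P.2 hA, h1, h2⟩
      rw [hcom] at h3
      have h4 := (mem_above.1 h3).2
      exact ⟨h4 (C.F.isLeast J hJ).1, h4 (C.F.b_mem J hJ)⟩
    have h2 : gap ε i j =ᶠ[approach ε C.p] fun x =>
        (C.relSize J (coords ε (alpha n ε x)) *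
          ‖C.diff (C.read (coords ε (alpha n ε x))) i j‖) * gap ε (C.F.a J) (C.F.b J) x := by
      filter_upwards [hev] with x hx
      have h3 := ambPts_sub_ambPts hε (C := C) (C.read (coords ε (alpha n ε x))) i j
      have h4 := gap_pos (ε := ε) (a_ne_b hJ).symm x
      have h5 := size_pos hε hx.1 hx.2 hJ
      rw [ambPts_read_alpha hε hx.1 hx.2, ambPts_read_alpha hε hx.1 hx.2, hcom, ← size_pts _ hJ,
        pts_read_alpha_of_pos hε hx.1 hx.2] at h3
      rw [gap, dist_eq_norm, h3, norm_smul, relSize_alpha hε hx.1 hJ, Real.norm_of_nonneg h5.le]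
      field_simp
    have h3 : Tendsto (fun x => C.relSize J (coords ε (alpha n ε x)) *
        ‖C.diff (C.read (coords ε (alpha n ε x))) i j‖) (approach ε C.p) (𝓝 0) := by
      have h4 := (((contDiff_relSize (C := C) J).continuous.tendsto _).comp
        (tendsto_coords_approach (p := C.p) hε)).mul hlim.norm
      simpa using h4
    have h5 : gap ε i j =o[approach ε C.p] gap ε (C.F.a J) (C.F.b J) := by
      have h6 := ((isLittleO_one_iff ℝ).2 h3).mul_isBigO
        (isBigO_refl (gap ε (C.F.a J) (C.F.b J)) (approach ε C.p))
      simp only [one_mul] at h6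
      exact h2.trans_isLittleO h6
    exact not_isLittleO_of_isBigO C.hp hij (isBigO_refl _ _) (h5.trans_isBigO h1)

theorem sepScale_eq_zero_iff {z : Euc (n * d)} {i j k : Fin n} : C.sepScale z i j k = 0 ↔
    ∃ A ∈ C.P, C.scale z A = 0 ∧ i ∈ A ∧ j ∈ A ∧ k ∉ A := by
  rw [sepScale, Finset.prod_eq_zero_iff]
  simp only [Finset.mem_filter, mem_common]
  tauto

include hε in
theorem read_p_mem_dom : C.read (coords ε C.p) ∈ C.dom := by
  classical
  have hs : ∀ i j k, 0 ≤ C.sepScale (C.read (coords ε C.p)) i j k := fun i j k =>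
    Finset.prod_nonneg fun A hA =>
      ((read_coords_p hε).1 A (mem_common.1 (Finset.mem_filter.1 hA).1).1).ge
  refine ⟨fun i => ?_, fun q => diff_read_p_ne_zero hε (q.ne (by decide)), fun t ht => ?_,
    fun l hl => ?_⟩
  · rw [pts_read_p hε]
    exact (C.loc i).ψ.map_source (C.loc i).mem
  · have h1 := norm_pos_iff.2 (diff_read_p_ne_zero hε (C := C) (t.ne (i := 0) (j := 1) (by decide)))
    have h2 := norm_pos_iff.2 (diff_read_p_ne_zero hε (C := C) (t.ne (i := 0) (j := 2) (by decide)))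
    obtain ⟨h3, h4⟩ := (add_eq_zero_iff_of_nonneg (mul_nonneg (hs _ _ _) h1.le)
      (mul_nonneg (hs _ _ _) h2.le)).1 ht
    obtain ⟨A, hA, -, h5, h6, h7⟩ :=
      sepScale_eq_zero_iff.1 ((mul_eq_zero.1 h3).resolve_right h1.ne')
    obtain ⟨B, hB, -, h8, h9, h10⟩ :=
      sepScale_eq_zero_iff.1 ((mul_eq_zero.1 h4).resolve_right h2.ne')
    rcases C.hP.nested A hA B hB _ h5 h8 with h | h
    · exact h10 (h h6)
    · exact h7 (h h9)
  · rw [(read_coords_p hε).2 l hl]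
    exact one_pos

include hε in
theorem param_read_p : C.param (C.read (coords ε C.p)) = coords ε C.p := by
  have := neBot_approach C.hp
  have h1 := (contDiffOn_param (C := C)).continuousOn.continuousAt
    (isOpen_dom.mem_nhds (read_p_mem_dom hε))
  refine tendsto_nhds_unique (h1.tendsto.comp (tendsto_read hε))
    ((tendsto_coords_approach hε).congr' ?_)
  filter_upwards [eventually_mem_source (C := C), eventually_relSize_pos hε] with x hx hpos
  exact (param_read_alpha hε hx hpos).symm

include hε in
theorem exists_nhds : ∃ U : Set (CoordSpace n m), IsOpen U ∧ coords ε C.p ∈ U ∧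
    ∀ q ∈ U, ContDiffAt ℝ 1 C.read q ∧ ∀ A ∈ C.P, 0 < C.relSize A q := by
  have h1 : ∀ᶠ q in 𝓝 (coords ε C.p), ContDiffAt ℝ 1 C.read q :=
    ((contDiffAt_read hε).of_le (by simp)).eventually (by simp)
  have h2 : ∀ᶠ q in 𝓝 (coords ε C.p), ∀ A ∈ C.P, 0 < C.relSize A q := by
    rw [Finset.eventually_all]
    intro A hA
    exact ((contDiff_relSize (C := C) A).continuous.tendsto _).eventually_const_lt (C.pos A hA)
  obtain ⟨U, hU, hUo, hp⟩ := eventually_nhds_iff.1 (h1.and h2)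
  exact ⟨U, hUo, hp, hU⟩

end CornerData

end FM

namespace FM

open Set Topology Filter

/-! ### Corner charts -/

variable {n d m : ℕ} {M : Type*} [TopologicalSpace M] {ε : M ↪ Euc m}

variable (d) in
/-- A chart of the compactification around `p` with values in a quadrant, in which the coordinates
of the ambient space are a smooth immersion `f`. The coordinates which can vanish are indexed
through `D` by the parenthesization of `p`, and the parenthesization of a point of the chart
consists of the sets whose coordinate vanishes. -/
structure CornerChart (p : CompactConf n ε) where
  /-- the chart -/
  χ : OpenPartialHomeomorph (CompactConf n ε) (EuclideanQuadrant (n * d))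
  /-- the index of the coordinate corresponding to a member of the parenthesization -/
  D : parenthesization p.1 → Fin (n * d)
  /-- an open set of the Euclidean space which cuts out the target of the chart -/
  O : Set (Euc (n * d))
  /-- the extension of the inverse of the chart -/
  f : Euc (n * d) → CoordSpace n m
  mem_source : p ∈ χ.source
  injective_D : Function.Injective D
  isOpen_O : IsOpen O
  contDiffOn_f : ContDiffOn ℝ ∞ f O
  mem_target : ∀ h, h ∈ χ.target ↔ h.1 ∈ O
  coords_symm : ∀ h ∈ χ.target, coords ε (χ.symm h).1 = f h.1
  injective_fderiv : ∀ h ∈ χ.target, Function.Injective (fderiv ℝ f h.1)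
  pos : ∀ z ∈ O, ∀ l ∉ range D, 0 < z l
  parenthesization_symm : ∀ h ∈ χ.target, ∀ A, A ∈ parenthesization (χ.symm h).1 ↔
    ∃ hA : A ∈ parenthesization p.1, h.1 (D ⟨A, hA⟩) = 0

/-- Two maps which are inverse to each other on the quadrant have injective derivatives. -/
theorem injective_fderiv_of_leftInverse {k : ℕ} {E : Type*} [NormedAddCommGroup E]
    [NormedSpace ℝ E] {f : Euc k → E} {g : E → Euc k} {z : Euc k}
    (hz : z ∈ range (Corners k)) (hf : DifferentiableAt ℝ f z) (hg : DifferentiableAt ℝ g (f z))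
    (h : ∀ᶠ y in 𝓝[range (Corners k)] z, g (f y) = y) : Function.Injective (fderiv ℝ f z) := by
  have h1 : HasFDerivWithinAt (g ∘ f) ((fderiv ℝ g (f z)).comp (fderiv ℝ f z))
      (range (Corners k)) z := (hg.hasFDerivAt.comp z hf.hasFDerivAt).hasFDerivWithinAt
  have h2 : HasFDerivWithinAt (g ∘ f) (ContinuousLinearMap.id ℝ (Euc k)) (range (Corners k)) z :=
    (hasFDerivWithinAt_id z _).congr_of_eventuallyEq h (h.self_of_nhdsWithin hz)
  have h3 := ((Corners k).uniqueDiffOn z hz).eq h1 h2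
  exact Function.LeftInverse.injective (g := fderiv ℝ g (f z)) fun v =>
    congrArg (fun L : Euc k →L[ℝ] Euc k => L v) h3

theorem mem_range_corners {k : ℕ} {z : Euc k} : z ∈ range (Corners k) ↔ ∀ l, 0 ≤ z l := by
  constructor
  · rintro ⟨h, rfl⟩
    exact h.2
  · exact fun h => ⟨⟨z, h⟩, rfl⟩

/-- A chart made of a continuous map `f` and a left inverse `g` of it, when `g` takes its values in
the subspace `H`. -/
theorem exists_chart_of_inverse {X E H A : Type*} [TopologicalSpace X] [TopologicalSpace E]
    [TopologicalSpace H] [TopologicalSpace A] [Nonempty X] [Nonempty H] {e : X → E}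
    (he : IsEmbedding e) {I : H → A} (hI : IsEmbedding I) {V : Set X} (hV : IsOpen V) {O : Set A}
    (hO : IsOpen O) {g : X → A} {f : A → E} (hg : ContinuousOn g V) (hf : ContinuousOn f O)
    (h1 : ∀ q ∈ V, g q ∈ O ∧ f (g q) = e q ∧ g q ∈ range I)
    (h2 : ∀ h, I h ∈ O → ∃ q, q ∈ V ∧ e q = f (I h) ∧ g q = I h) :
    ∃ χ : OpenPartialHomeomorph X H, χ.source = V ∧ χ.target = I ⁻¹' O ∧
      (∀ q ∈ V, I (χ q) = g q) ∧ ∀ h, I h ∈ O → e (χ.symm h) = f (I h) := by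
  choose! inv hinv using h2
  have hex : ∀ q, ∃ h, q ∈ V → I h = g q := fun q => by
    by_cases hq : q ∈ V
    · obtain ⟨h, hh⟩ := (h1 q hq).2.2
      exact ⟨h, fun _ => hh⟩
    · exact ⟨Classical.arbitrary H, fun h => absurd h hq⟩
  choose toF htoF using hex
  have htO : ∀ q ∈ V, I (toF q) ∈ O := fun q hq => htoF q hq ▸ (h1 q hq).1
  have hcont : ContinuousOn toF V := hI.continuousOn_iff.2 (hg.congr htoF)
  have hcont' : ContinuousOn inv (I ⁻¹' O) := by
    rw [he.continuousOn_iff]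
    exact (hf.comp hI.continuous.continuousOn fun h hh => hh).congr fun h hh => (hinv h hh).2.1
  exact ⟨{  toFun := toF
            invFun := inv
            source := V
            target := I ⁻¹' O
            map_source' := htO
            map_target' := fun h hh => (hinv h hh).1
            left_inv' := fun q hq => he.injective (by
              rw [(hinv _ (htO q hq)).2.1, htoF q hq, (h1 q hq).2.1])
            right_inv' := fun h hh => hI.injective (by
              rw [htoF _ (hinv h hh).1, (hinv h hh).2.2])
            open_source := hV
            open_target := hO.preimage hI.continuous
            continuousOn_toFun := hcont
            continuousOn_invFun := hcont' }, rfl, rfl, htoF, fun h hh => (hinv h hh).2.1⟩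

namespace CornerData

variable {C : CornerData d ε n} (hε : IsEmbedding ε)

section

variable {U : Set (CoordSpace n m)}
  (hr : ∀ q ∈ U, ContDiffAt ℝ 1 C.read q ∧ ∀ A ∈ C.P, 0 < C.relSize A q)

include hε hr in
/-- The points of the closure with coordinates in a suitable open set are determined by their
corner coordinates, which are nonnegative. -/
theorem param_read {q : Ambient n m M} (hq : q ∈ closure (range (alpha n ε)))
    (h1 : ∀ i, q.1 i ∈ (C.loc i).ψ.source) (h2 : coords ε q ∈ U)
    (h3 : C.read (coords ε q) ∈ C.dom) :
    C.param (C.read (coords ε q)) = coords ε q ∧ ∀ l, 0 ≤ C.read (coords ε q) l := by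
  have := neBot_approach hq
  have hc := tendsto_coords_approach (p := q) hε
  have ht : Tendsto (fun x => C.read (coords ε (alpha n ε x))) (approach ε q)
      (𝓝 (C.read (coords ε q))) := (hr _ h2).1.continuousAt.tendsto.comp hc
  have hev1 : ∀ᶠ x in approach ε q, ∀ i, x.1 i ∈ (C.loc i).ψ.source := by
    rw [eventually_all]
    intro i
    have h1' : Tendsto (fun x : Conf n M => x.1 i) (approach ε q) (𝓝 (q.1 i)) :=
      ((by fun_prop : Continuous fun q : Ambient n m M => q.1 i).tendsto q).comp
        tendsto_alpha_approach
    exact h1' ((C.loc i).ψ.open_source.mem_nhds (h1 i))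
  have hev2 : ∀ᶠ x in approach ε q, ∀ A ∈ C.P, 0 < C.relSize A (coords ε (alpha n ε x)) := by
    rw [Finset.eventually_all]
    intro A hA
    exact (((contDiff_relSize (C := C) A).continuous.tendsto _).comp hc).eventually_const_lt
      ((hr _ h2).2 A hA)
  constructor
  · have h4 := (contDiffOn_param (C := C)).continuousOn.continuousAt (isOpen_dom.mem_nhds h3)
    refine tendsto_nhds_unique (h4.tendsto.comp ht) (hc.congr' ?_)
    filter_upwards [hev1, hev2] with x hx hpos
    exact (param_read_alpha hε hx hpos).symm
  · intro l
    by_cases hl : ∃ A ∈ C.P, C.scaleIdx A = l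
    · obtain ⟨A, hA, rfl⟩ := hl
      have h4 : Tendsto (fun x => C.scale (C.read (coords ε (alpha n ε x))) A) (approach ε q)
        (𝓝 (C.scale (C.read (coords ε q)) A)) :=
        ((contDiff_scale A).continuous.tendsto _).comp ht
      refine ge_of_tendsto h4 ?_
      filter_upwards [hev1, hev2] with x hx hpos
      exact (scale_read_pos hε hx hpos hA).le
    · push Not at hl
      exact (h3.2.2.2 l hl).le

include hε hr in
/-- Nonnegative corner coordinates are those of a point of the closure. -/
theorem exists_point {z : Euc (n * d)} (hz : z ∈ C.dom) (hzU : C.param z ∈ U)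
    (hz0 : ∀ l, 0 ≤ z l) : ∃ q ∈ closure (range (alpha n ε)), coords ε q = C.param z ∧
      (∀ i, q.1 i ∈ (C.loc i).ψ.source) ∧ C.read (C.param z) = z := by
  classical
  have hs : ∀ i j k, 0 ≤ C.sepScale z i j k := fun i j k => Finset.prod_nonneg fun A _ => hz0 _
  let c : Conf 3 (Fin n) → ℝ := (C.param z).2.2
  have hc : ∀ t, ∃ a, intervalCoord a = c t := fun t => by
    have h1 := mul_nonneg (hs (t.1 0) (t.1 1) (t.1 2)) (norm_nonneg (C.diff z (t.1 0) (t.1 1)))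
    have h2 := mul_nonneg (hs (t.1 0) (t.1 2) (t.1 1)) (norm_nonneg (C.diff z (t.1 0) (t.1 2)))
    exact exists_intervalCoord_eq (div_nonneg h1 (add_nonneg h1 h2))
      (div_le_one_of_le₀ (le_add_of_nonneg_right h2) (add_nonneg h1 h2))
  choose a ha using hc
  have hnorm : ∀ e, ‖(C.param z).2.1 e‖ = 1 := fun e => by
    change ‖‖C.diff z (e.1 0) (e.1 1)‖⁻¹ • C.diff z (e.1 0) (e.1 1)‖ = 1
    rw [norm_smul, norm_inv, norm_norm, inv_mul_cancel₀ (norm_ne_zero_iff.2 (hz.2.1 e))]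
  let q : Ambient n m M := (fun i => (C.loc i).ψ.symm (C.pts z i),
    fun e => ⟨(C.param z).2.1 e, mem_sphere_zero_iff_norm.2 (hnorm e)⟩, a)
  have hq1 : ∀ i, q.1 i ∈ (C.loc i).ψ.source := fun i => (C.loc i).ψ.map_target (hz.1 i)
  have hq : coords ε q = C.param z := by
    refine Prod.ext (funext fun i => ?_) (Prod.ext rfl (funext ha))
    change ε (q.1 i) = C.ambPts z i
    rw [← (C.loc i).φ_ψ _ (hq1 i), ambPts, (C.loc i).ψ.right_inv (hz.1 i)]
  -- the point is approached by moving into the interior of the quadrant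
  let w : ℝ → Euc (n * d) := fun t => z + t • WithLp.toLp 2 fun _ => 1
  have hw0 : w 0 = z := by simp [w]
  have hw : Tendsto w (𝓝[>] 0) (𝓝 z) := by
    have : Continuous w := by fun_prop
    exact hw0 ▸ (this.tendsto 0).mono_left nhdsWithin_le_nhds
  have hev : ∀ᶠ t in 𝓝[>] (0 : ℝ), ∃ x : Conf n M,
      C.param (w t) = coords ε (alpha n ε x) ∧ C.read (C.param (w t)) = w t := by
    filter_upwards [hw (isOpen_dom.mem_nhds hz), self_mem_nhdsWithin] with t ht ht0
    refine exists_conf hε ht fun A _ => ?_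
    have : C.scale (w t) A = z (C.scaleIdx A) + t := by simp [scale, w]
    rw [this]
    exact add_pos_of_nonneg_of_pos (hz0 _) ht0
  have hpt : Tendsto (fun t => C.param (w t)) (𝓝[>] 0) (𝓝 (C.param z)) :=
    ((contDiffOn_param (C := C)).continuousOn.continuousAt
      (isOpen_dom.mem_nhds hz)).tendsto.comp hw
  refine ⟨q, ?_, hq, hq1, ?_⟩
  · rw [(isEmbedding_coords hε).isInducing.closure_eq_preimage_closure_image, mem_preimage, hq]
    refine mem_closure_of_tendsto hpt (hev.mono ?_)
    rintro t ⟨x, hx, -⟩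
    exact hx ▸ mem_image_of_mem _ (mem_range_self x)
  · refine tendsto_nhds_unique (((hr _ hzU).1.continuousAt).tendsto.comp hpt) (hw.congr' ?_)
    filter_upwards [hev] with t ht
    exact ht.choose_spec.2.symm

end

open scoped Classical in
include hε in
/-- The members of the parenthesization of a point near the given one are the sets of which the
scale vanishes. -/
theorem parenthesization_of_coords {z : Euc (n * d)} (hz : z ∈ C.dom) {q : Ambient n m M}
    (hq : coords ε q = C.param z) :
    parenthesization q = ({A ∈ C.P | C.scale z A = 0} : Finset (Set (Fin n))) := by
  have hlam : IsLaminar ({A ∈ C.P | C.scale z A = 0} : Finset (Set (Fin n))) :=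
    C.hP.mono (Finset.filter_subset _ _)
  have hdiff : ∀ i j, i ≠ j → C.diff z i j ≠ 0 := fun i j h => hz.2.1 (pair i j h)
  have hdist : ∀ i j, i ≠ j → (q.1 i = q.1 j ↔ ∃ A ∈ C.P, C.scale z A = 0 ∧ i ∈ A ∧ j ∈ A) := by
    intro i j hij
    have h1 : ∀ l, ε (q.1 l) = C.ambPts z l := fun l => congrFun (congrArg Prod.fst hq) l
    rw [← ε.injective.eq_iff, ← sub_eq_zero, h1, h1, ambPts_sub_ambPts hε,
      smul_eq_zero_iff_left (hdiff i j hij), Finset.prod_eq_zero_iff]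
    simp only [mem_common]
    tauto
  refine parenthesization_eq hlam (fun i j k h1 h2 h3 => ?_) fun hn => ⟨fun h => ?_, fun h i j => ?_⟩
  · have h4 : intervalCoord (q.2.2 (triple i j k h1 h2 h3)) = C.sepScale z i j k * ‖C.diff z i j‖ /
        C.den z (triple i j k h1 h2 h3) :=
      congrFun (congrArg (fun e : CoordSpace n m => e.2.2) hq) (triple i j k h1 h2 h3)
    rw [excludes_iff h1 h2 h3, ← intervalCoord_injective.eq_iff, intervalCoord_zero, h4,
      div_eq_zero_iff, or_iff_left (hz.2.2.1 _), mul_eq_zero,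
      or_iff_left (norm_ne_zero_iff.2 (hdiff i j h1)), sepScale_eq_zero_iff]
    simp only [Finset.mem_filter, and_assoc]
  · refine hlam.univ_mem hn fun i j hij => ?_
    obtain ⟨A, hA, h0, hi, hj⟩ := (hdist i j hij).1 (h i j)
    exact ⟨A, Finset.mem_filter.2 ⟨hA, h0⟩, hi, hj⟩
  · by_cases hij : i = j
    · rw [hij]
    · obtain ⟨hA, h0⟩ := Finset.mem_filter.1 h
      exact (hdist i j hij).2 ⟨univ, hA, h0, mem_univ i, mem_univ j⟩

include hε in
theorem nonempty_cornerChart (p : CompactConf n ε) (hp : C.p = p.1) :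
    Nonempty (CornerChart d p) := by
  classical
  have : Nonempty (CompactConf n ε) := ⟨p⟩
  obtain ⟨U, hU, hpU, hr⟩ := exists_nhds (C := C) hε
  let O : Set (Euc (n * d)) := C.dom ∩ C.param ⁻¹' U
  have hO : IsOpen O := (contDiffOn_param (C := C)).continuousOn.isOpen_inter_preimage isOpen_dom hU
  have hemb : IsEmbedding fun q : CompactConf n ε => coords ε q.1 :=
    (isEmbedding_coords hε).comp IsEmbedding.subtypeVal
  let V : Set (CompactConf n ε) := {q | (∀ i, q.1.1 i ∈ (C.loc i).ψ.source) ∧ coords ε q.1 ∈ U ∧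
    C.read (coords ε q.1) ∈ O}
  have hread : ContinuousOn C.read U := fun q hq => (hr q hq).1.continuousAt.continuousWithinAt
  have hV : IsOpen V := by
    have h1 : IsOpen (U ∩ C.read ⁻¹' O) := hread.isOpen_inter_preimage hU hO
    have h2 : IsOpen {q : CompactConf n ε | ∀ i, q.1.1 i ∈ (C.loc i).ψ.source} := by
      simp only [ofPred_forall]
      refine isOpen_iInter_of_finite fun i => (C.loc i).ψ.open_source.preimage ?_
      fun_prop
    exact h2.inter (h1.preimage hemb.continuous)
  have hpoint : ∀ h : EuclideanQuadrant (n * d), h.1 ∈ O → ∃ q : CompactConf n ε, q ∈ V ∧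
      coords ε q.1 = C.param h.1 ∧ C.read (coords ε q.1) = h.1 := by
    intro h hh
    obtain ⟨q, hq, h1, h2, h3⟩ := exists_point hε hr hh.1 hh.2 h.2
    refine ⟨⟨q, hq⟩, ⟨h2, ?_, ?_⟩, h1, h1 ▸ h3⟩
    · change coords ε q ∈ U
      rw [h1]
      exact hh.2
    · change C.read (coords ε q) ∈ O
      rw [h1, h3]
      exact hh
  have : Nonempty (EuclideanQuadrant (n * d)) := ⟨⟨0, fun _ => le_rfl⟩⟩
  have hval : IsEmbedding fun h : EuclideanQuadrant (n * d) => h.1 := IsEmbedding.subtypeVal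
  obtain ⟨χ, hχs, hχt, -, hχ⟩ := exists_chart_of_inverse hemb hval hV hO
    (hread.comp hemb.continuous.continuousOn fun q hq => hq.2.1)
    ((contDiffOn_param (C := C)).continuousOn.mono inter_subset_left)
    (fun q hq => by
      obtain ⟨h1, h2⟩ := param_read hε hr q.2 hq.1 hq.2.1 hq.2.2.1
      exact ⟨hq.2.2, h1, ⟨_, h2⟩, rfl⟩) hpoint
  have hmemt : ∀ h, h ∈ χ.target ↔ h.1 ∈ O := fun h => by rw [hχt, mem_preimage]
  have hmem : ∀ A, A ∈ parenthesization p.1 ↔ A ∈ C.P := fun A => by rw [mem_P, hp]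
  refine ⟨⟨χ, fun A => C.scaleIdx A.1, O, C.param, ?_, ?_, hO,
    contDiffOn_param.mono inter_subset_left, hmemt, fun h hh => hχ h ((hmemt h).1 hh), ?_, ?_,
    ?_⟩⟩
  · rw [hχs]
    refine ⟨fun i => ?_, ?_, ?_⟩
    · have := (C.loc i).mem
      rwa [← hp]
    · rwa [← hp]
    · rw [← hp]
      refine ⟨read_p_mem_dom hε, ?_⟩
      rw [mem_preimage, param_read_p hε]
      exact hpU
  · exact fun A B h => Subtype.ext (scaleIdx_injOn ((hmem _).1 A.2) ((hmem _).1 B.2) h)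
  · intro h hh
    have hh' : h.1 ∈ O := (hmemt h).1 hh
    refine injective_fderiv_of_leftInverse (g := C.read) (mem_range_corners.2 h.2)
      (((contDiffOn_param (C := C)).contDiffAt (isOpen_dom.mem_nhds hh'.1)).differentiableAt
        (by simp)) ((hr _ hh'.2).1.differentiableAt (by simp)) ?_
    filter_upwards [mem_nhdsWithin_of_mem_nhds (hO.mem_nhds hh'), self_mem_nhdsWithin] with y hy hy'
    obtain ⟨q, -, h1, h2⟩ := hpoint ⟨y, mem_range_corners.1 hy'⟩ hy
    rw [h1] at h2
    exact h2
  · intro z hz l hl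
    exact hz.1.2.2.2 l fun A hA h => hl ⟨⟨A, (hmem A).2 hA⟩, h⟩
  · intro h hh A
    have hh' : h.1 ∈ O := (hmemt h).1 hh
    have h1 := parenthesization_of_coords hε (z := h.1) (q := (χ.symm h).1) hh'.1 (hχ h hh')
    rw [h1, Finset.mem_coe, Finset.mem_filter, ← hmem]
    exact exists_prop.symm

end CornerData

theorem nonempty_cornerChart [ChartedSpace (Euc d) M] [IsManifold (𝓡 d) ∞ M] (hd : 0 < d)
    (hε : Manifold.IsSmoothEmbedding (𝓡 d) (𝓡 m) ∞ ε) (p : CompactConf n ε) :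
    Nonempty (CornerChart d p) := by
  rcases Nat.eq_zero_or_pos n with rfl | hn
  · have h1 : IsEmpty (Fin (0 * d)) := by
      rw [zero_mul]
      infer_instance
    have h2 : ∀ k, IsEmpty (Conf (k + 1) (Fin 0)) := fun k => ⟨fun t => (t.1 0).elim0⟩
    have : IsEmpty (Conf 2 (Fin 0)) := h2 1
    have : IsEmpty (Conf 3 (Fin 0)) := h2 2
    have h3 : Subsingleton (CompactConf 0 ε) := by infer_instance
    have h4 : Subsingleton (EuclideanQuadrant (0 * d)) :=
      ⟨fun a b => Subtype.ext (by ext l; exact (h1.false l).elim)⟩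
    have h5 : ∀ q : Ambient 0 m M, parenthesization q = ∅ := by
      refine fun q => eq_empty_of_forall_notMem fun A hA => ?_
      rcases hA with ⟨i, -⟩ | ⟨h, -⟩
      · exact i.elim0
      · omega
    have : Unique (CompactConf 0 ε) := ⟨⟨p⟩, fun q => Subsingleton.elim _ _⟩
    have : Unique (EuclideanQuadrant (0 * d)) :=
      ⟨⟨⟨0, fun l => le_rfl⟩⟩, fun q => Subsingleton.elim _ _⟩
    refine ⟨⟨(Homeomorph.homeomorphOfUnique _ _).toOpenPartialHomeomorph,
      fun A => absurd A.2 (by simp [h5]), univ, fun _ => coords ε p.1, mem_univ _,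
      fun A => absurd A.2 (by simp [h5]), isOpen_univ, contDiffOn_const, fun h => by simp,
      fun h _ => ?_, fun h _ => ?_, fun z _ l => (h1.false l).elim, fun h _ A => by simp [h5]⟩⟩
    · exact congrArg (fun q : CompactConf 0 ε => coords ε q.1) (Subsingleton.elim _ _)
    · have : Subsingleton (Euc (0 * d)) := ⟨fun a b => by ext l; exact (h1.false l).elim⟩
      exact Function.injective_of_subsingleton _
  · have : NeZero n := ⟨hn.ne'⟩
    obtain ⟨C, hC⟩ := exists_cornerData hd hε p.2
    exact CornerData.nonempty_cornerChart hε.isEmbedding p hC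

end FM

namespace FM

open Set

/-! ### Rooted trees as ordered sets -/

namespace TreeWithRoot

variable (T : TreeWithRoot)

/-- The path from a vertex to the root. -/
noncomputable def rootPath (u : T.V) : T.G.Walk u T.root :=
  (T.isTree.existsUnique_path u T.root).choose

theorem isPath_rootPath (u : T.V) : (T.rootPath u).IsPath :=
  (T.isTree.existsUnique_path u T.root).choose_spec.1

variable {T}

theorem eq_rootPath {u : T.V} {p : T.G.Walk u T.root} (hp : p.IsPath) : p = T.rootPath u :=
  (T.isTree.existsUnique_path u T.root).choose_spec.2 p hp

theorem over_iff_mem_support {u v : T.V} : T.Over u v ↔ v ∈ (T.rootPath u).support := by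
  constructor
  · rintro ⟨p, hp, hv⟩
    exact eq_rootPath hp ▸ hv
  · exact fun h => ⟨_, T.isPath_rootPath u, h⟩

/-- The distance of a vertex from the root. -/
noncomputable def depth (u : T.V) : ℕ := (T.rootPath u).length

/-- The neighbour of a vertex on the path to the root. For the root this is the root itself. -/
noncomputable def parent (u : T.V) : T.V := (T.rootPath u).snd

theorem rootPath_eq_cons {u : T.V} (hu : u ≠ T.root) :
    ∃ h : T.G.Adj u (parent u), T.rootPath u = .cons h (T.rootPath (parent u)) := by
  have h : ∀ (p : T.G.Walk u T.root), p.IsPath → ∀ w, p.snd = w →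
      ∃ h : T.G.Adj u w, p = .cons h (T.rootPath w) := by
    intro p hp w hw
    cases p with
    | nil => exact absurd rfl hu
    | cons h q =>
      rw [SimpleGraph.Walk.snd_cons] at hw
      subst hw
      exact ⟨h, by rw [eq_rootPath ((SimpleGraph.Walk.cons_isPath_iff h q).1 hp).1]⟩
  exact h _ (T.isPath_rootPath u) _ rfl

theorem adj_parent {u : T.V} (hu : u ≠ T.root) : T.G.Adj u (parent u) :=
  (rootPath_eq_cons hu).choose

theorem depth_parent {u : T.V} (hu : u ≠ T.root) : depth u = depth (parent u) + 1 := by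
  obtain ⟨h, h'⟩ := rootPath_eq_cons hu
  rw [depth, h', SimpleGraph.Walk.length_cons, depth]

theorem rootPath_root : T.rootPath T.root = .nil := (eq_rootPath SimpleGraph.Walk.IsPath.nil).symm

theorem over_refl (u : T.V) : T.Over u u :=
  over_iff_mem_support.2 (SimpleGraph.Walk.start_mem_support _)

theorem over_root (u : T.V) : T.Over u T.root :=
  over_iff_mem_support.2 (SimpleGraph.Walk.end_mem_support _)

theorem over_iff {u v : T.V} : T.Over u v ↔ u = v ∨ u ≠ T.root ∧ T.Over (parent u) v := by
  by_cases hu : u = T.root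
  · subst hu
    rw [over_iff_mem_support, rootPath_root]
    simp [eq_comm]
  · obtain ⟨h, h'⟩ := rootPath_eq_cons hu
    rw [over_iff_mem_support, over_iff_mem_support, h', SimpleGraph.Walk.support_cons,
      List.mem_cons, eq_comm]
    tauto

theorem over_parent {u : T.V} (hu : u ≠ T.root) : T.Over u (parent u) :=
  over_iff.2 (Or.inr ⟨hu, over_refl _⟩)

theorem Over.parent_of_ne {u v : T.V} (h : T.Over u v) (hne : u ≠ v) :
    u ≠ T.root ∧ T.Over (parent u) v :=
  (over_iff.1 h).resolve_left hne

/-- Induction from the root to the leaves. -/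
theorem induction_parent {p : T.V → Prop} (h : ∀ u, (u ≠ T.root → p (parent u)) → p u) (u : T.V) :
    p u := by
  suffices H : ∀ k u, depth u = k → p u from H _ u rfl
  intro k
  induction k with
  | zero => exact fun u hu => h u fun hne => by rw [depth_parent hne] at hu; omega
  | succ k ih => exact fun u hu => h u fun hne => ih _ (by rw [depth_parent hne] at hu; omega)

theorem Over.trans {u v w : T.V} (h : T.Over u v) (h' : T.Over v w) : T.Over u w := by
  induction u using induction_parent with
  | h u ih =>
    by_cases huv : u = v
    · exact huv ▸ h'
    · obtain ⟨h1, h2⟩ := h.parent_of_ne huv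
      exact over_iff.2 (Or.inr ⟨h1, ih h1 h2⟩)

theorem Over.depth_le {u v : T.V} (h : T.Over u v) : depth v ≤ depth u := by
  induction u using induction_parent with
  | h u ih =>
    by_cases huv : u = v
    · exact huv ▸ le_rfl
    · obtain ⟨h1, h2⟩ := h.parent_of_ne huv
      rw [depth_parent h1]
      exact (ih h1 h2).trans (Nat.le_succ _)

theorem Over.eq_of_depth_le {u v : T.V} (h : T.Over u v) (h' : depth u ≤ depth v) : u = v := by
  by_contra hne
  obtain ⟨h1, h2⟩ := h.parent_of_ne hne
  have := h2.depth_le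
  rw [depth_parent h1] at h'
  omega

theorem Over.antisymm {u v : T.V} (h : T.Over u v) (h' : T.Over v u) : u = v :=
  h.eq_of_depth_le h'.depth_le

theorem not_over_parent {u : T.V} (hu : u ≠ T.root) : ¬ T.Over (parent u) u := fun h => by
  have := h.depth_le
  rw [depth_parent hu] at this
  omega

theorem parent_ne {u : T.V} (hu : u ≠ T.root) : parent u ≠ u := fun h =>
  not_over_parent hu (h.symm ▸ over_refl u)

theorem eq_root_of_over {v : T.V} (h : T.Over T.root v) : v = T.root :=
  (h.antisymm (over_root v)).symm

theorem Over.total {u v w : T.V} (h : T.Over u v) (h' : T.Over u w) : T.Over v w ∨ T.Over w v := by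
  induction u using induction_parent with
  | h u ih =>
    by_cases huv : u = v
    · exact Or.inl (huv ▸ h')
    by_cases huw : u = w
    · exact Or.inr (huw ▸ h)
    exact ih (h.parent_of_ne huv).1 (h.parent_of_ne huv).2 (h'.parent_of_ne huw).2

theorem adj_iff {u v : T.V} :
    T.G.Adj u v ↔ (u ≠ T.root ∧ parent u = v) ∨ (v ≠ T.root ∧ parent v = u) := by
  constructor
  · intro h
    by_cases hv : v ∈ (T.rootPath u).support
    · left
      have hu : u ≠ T.root := by
        rintro rfl
        rw [rootPath_root] at hv
        simp only [SimpleGraph.Walk.support_nil, List.mem_singleton] at hv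
        exact h.ne hv.symm
      exact ⟨hu, (T.isTree.isAcyclic.eq_snd_of_adj_start (T.isPath_rootPath u) h hv).symm⟩
    by_cases hu : u ∈ (T.rootPath v).support
    · right
      have hv : v ≠ T.root := by
        rintro rfl
        rw [rootPath_root] at hu
        simp only [SimpleGraph.Walk.support_nil, List.mem_singleton] at hu
        exact h.ne hu
      exact ⟨hv, (T.isTree.isAcyclic.eq_snd_of_adj_start (T.isPath_rootPath v) h.symm hu).symm⟩
    · exfalso
      have h1 := eq_rootPath ((T.isPath_rootPath u).cons (h := h.symm) hv)
      apply hu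
      rw [← h1]
      simp
  · rintro (⟨hu, rfl⟩ | ⟨hv, rfl⟩)
    · exact adj_parent hu
    · exact (adj_parent hv).symm

/-- Siblings which are comparable are equal. -/
theorem eq_of_over_of_parent_eq {u v : T.V} (hv : v ≠ T.root) (h : parent u = parent v)
    (h' : T.Over u v) : u = v := by
  by_contra hne
  exact not_over_parent hv (h ▸ (h'.parent_of_ne hne).2)

theorem neighborSet_eq {u : T.V} (hu : u ≠ T.root) :
    T.G.neighborSet u = insert (parent u) {w | w ≠ T.root ∧ parent w = u} := by
  ext w
  rw [SimpleGraph.mem_neighborSet, adj_iff, mem_insert_iff, eq_comm (a := w)]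
  simp [hu]

theorem parent_notMem {u : T.V} (hu : u ≠ T.root) :
    parent u ∉ {w | w ≠ T.root ∧ parent w = u} := by
  rintro ⟨h, h'⟩
  have := depth_parent h
  have := depth_parent hu
  rw [h'] at *
  omega

theorem mem_leaves_iff {u : T.V} (hu : u ≠ T.root) :
    u ∈ T.leaves ↔ ∀ w, w ≠ T.root → parent w ≠ u := by
  have := T.finite
  have h1 : (T.G.neighborSet u).ncard = {w | w ≠ T.root ∧ parent w = u}.ncard + 1 := by
    rw [neighborSet_eq hu, ncard_insert_of_notMem (parent_notMem hu) (toFinite _)]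
  rw [leaves, mem_ofPred_eq, h1, and_iff_right hu, Nat.add_eq_right, ncard_eq_zero (toFinite _),
    eq_empty_iff_forall_notMem]
  simp

theorem eq_of_over_leaf {u v : T.V} (hv : v ∈ T.leaves) (h : T.Over u v) : u = v := by
  induction u using induction_parent with
  | h u ih =>
    by_contra hne
    obtain ⟨h1, h2⟩ := h.parent_of_ne hne
    exact (mem_leaves_iff hv.1).1 hv u h1 (ih h1 h2)

theorem exists_children {u : T.V} (hu : u ∈ T.internal) : ∃ v w, v ≠ w ∧
    v ≠ T.root ∧ w ≠ T.root ∧ parent v = u ∧ parent w = u := by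
  have := T.finite
  obtain ⟨hr, hl⟩ := hu
  have h1 : (T.G.neighborSet u).ncard = {w | w ≠ T.root ∧ parent w = u}.ncard + 1 := by
    rw [neighborSet_eq hr, ncard_insert_of_notMem (parent_notMem hr) (toFinite _)]
  have h2 := T.no_bivalent u hr
  have h3 : (T.G.neighborSet u).ncard ≠ 1 := fun h => hl ⟨hr, h⟩
  obtain ⟨v, hv, w, hw, hvw⟩ := (one_lt_ncard (toFinite _)).1
    (show 1 < {w | w ≠ T.root ∧ parent w = u}.ncard by omega)
  exact ⟨v, w, hvw, hv.1, hw.1, hv.2, hw.2⟩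

theorem exists_leaf_over {v : T.V} (hv : v ≠ T.root) : ∃ u ∈ T.leaves, T.Over u v := by
  have := T.finite
  obtain ⟨u, hu, hmax⟩ := Set.exists_max_image {u | T.Over u v} depth (toFinite _) ⟨v, over_refl v⟩
  have hur : u ≠ T.root := by
    rintro rfl
    exact hv (eq_root_of_over hu)
  refine ⟨u, (mem_leaves_iff hur).2 fun w hw h => ?_, hu⟩
  have h1 := hmax w ((over_parent hw).trans (h ▸ hu))
  rw [depth_parent hw, h] at h1
  omega

/-- A vertex strictly below `v` lies over a child of `v`. -/
theorem Over.exists_child {u v : T.V} (h : T.Over u v) (hne : u ≠ v) :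
    ∃ w, w ≠ T.root ∧ parent w = v ∧ T.Over u w := by
  induction u using induction_parent with
  | h u ih =>
    obtain ⟨h1, h2⟩ := h.parent_of_ne hne
    by_cases h3 : parent u = v
    · exact ⟨u, h1, h3, over_refl u⟩
    · obtain ⟨w, hw, hw', h4⟩ := ih h1 h2 h3
      exact ⟨w, hw, hw', (over_parent h1).trans h4⟩

/-- A bijection which preserves the order of the vertices is an isomorphism. -/
theorem isIso_of_over {T T' : TreeWithRoot} (φ : T.V ≃ T'.V)
    (h : ∀ u v, T'.Over (φ u) (φ v) ↔ T.Over u v) : T.IsIso T' := by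
  have hroot : φ T.root = T'.root := by
    obtain ⟨v, hv⟩ := φ.surjective T'.root
    refine eq_root_of_over ?_
    rw [← hv, h]
    exact over_root v
  have hne : ∀ u, u ≠ T.root → φ u ≠ T'.root := fun u hu e => hu (φ.injective (e.trans hroot.symm))
  have hpar : ∀ u, u ≠ T.root → parent (φ u) = φ (parent u) := by
    intro u hu
    apply Over.antisymm
    · exact (((h _ _).2 (over_parent hu)).parent_of_ne
        fun e => parent_ne hu (φ.injective e).symm).2
    · obtain ⟨v, hv⟩ := φ.surjective (parent (φ u))
      rw [← hv, h]
      have h1 : T.Over u v := by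
        rw [← h, hv]
        exact over_parent (hne u hu)
      refine (h1.parent_of_ne ?_).2
      rintro rfl
      exact parent_ne (hne u hu) hv.symm
  have hne' : ∀ u, φ u ≠ T'.root ↔ u ≠ T.root := fun u =>
    ⟨fun hu e => hu (e ▸ hroot), hne u⟩
  have hpar' : ∀ u v, (u ≠ T.root ∧ parent (φ u) = φ v) ↔ (u ≠ T.root ∧ parent u = v) := by
    intro u v
    refine and_congr_right fun hu => ?_
    rw [hpar u hu, φ.injective.eq_iff]
  exact ⟨⟨φ, by
    intro u v
    rw [adj_iff, adj_iff, hne', hne', hpar', hpar']⟩, hroot⟩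

/-- A tree whose graph is given by a parent function is ordered accordingly. -/
theorem parent_eq_of_rank {par : T.V → T.V} {rank : T.V → ℕ}
    (h1 : ∀ v, v ≠ T.root → rank (par v) < rank v)
    (h2 : ∀ v, v ≠ T.root → T.G.Adj v (par v)) {v : T.V} (hv : v ≠ T.root) : parent v = par v := by
  suffices H : ∀ k v, rank v = k → v ≠ T.root → parent v = par v from H _ v rfl hv
  intro k
  induction k using Nat.strong_induction_on with
  | _ k ih =>
    intro v hk hv
    rcases adj_iff.1 (h2 v hv) with h | h
    · exact h.2
    · have h3 := ih _ (hk ▸ h1 v hv) (par v) rfl h.1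
      have h4 := h1 _ h.1
      rw [← h3, h.2] at h4
      exact absurd (h4.trans (h1 v hv)) (lt_irrefl _)

end TreeWithRoot

/-! ### The laminar family of a tree -/

namespace FTree

open TreeWithRoot

variable {n : ℕ} {T T' : FTree n}

theorem mem_labelsOver {v : T.V} {i : Fin n} : i ∈ T.labelsOver v ↔ T.Over (T.label i).1 v :=
  Iff.rfl

theorem labelsOver_mono {u v : T.V} (h : T.Over u v) : T.labelsOver u ⊆ T.labelsOver v :=
  fun _ hi => Over.trans hi h

theorem labelsOver_nonempty {v : T.V} (hv : v ≠ T.root) : (T.labelsOver v).Nonempty := by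
  obtain ⟨u, hu, h⟩ := exists_leaf_over hv
  refine ⟨T.label.symm ⟨u, hu⟩, ?_⟩
  rw [mem_labelsOver, Equiv.apply_symm_apply]
  exact h

theorem labelsOver_label (i : Fin n) : T.labelsOver (T.label i).1 = {i} := by
  ext j
  rw [mem_labelsOver, mem_singleton_iff]
  constructor
  · intro h
    exact T.label.injective (Subtype.ext (eq_of_over_leaf (T.label i).2 h))
  · rintro rfl
    exact over_refl _

/-- The order of the vertices is the inclusion of the sets of labels. The root is excluded on the left
because its only child, if it is univalent, has the same set of labels. -/
theorem over_iff_labelsOver_subset {u v : T.V} (hu : u ≠ T.root) :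
    T.Over u v ↔ T.labelsOver u ⊆ T.labelsOver v := by
  refine ⟨labelsOver_mono, fun h => ?_⟩
  obtain ⟨i, hi⟩ := labelsOver_nonempty hu
  rcases Over.total hi (h hi) with h1 | h1
  · exact h1
  by_contra hnot
  have hne : v ≠ u := by
    rintro rfl
    exact hnot (over_refl _)
  -- `v` lies over a child `w` of `u`, and a leaf over another child does not lie over `v`
  obtain ⟨w, hw, hwu, h2⟩ := h1.exists_child hne
  have hint : u ∈ T.internal := ⟨hu, fun hl => (mem_leaves_iff hu).1 hl w hw hwu⟩
  obtain ⟨w', hw', hww', hwu'⟩ : ∃ w', w' ≠ T.root ∧ w' ≠ w ∧ parent w' = u := by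
    obtain ⟨a, b, hab, ha, hb, ha', hb'⟩ := exists_children hint
    by_cases h3 : a = w
    · exact ⟨b, hb, fun e => hab (h3.trans e.symm), hb'⟩
    · exact ⟨a, ha, h3, ha'⟩
  obtain ⟨j, hj⟩ := labelsOver_nonempty hw'
  have h4 : T.Over (T.label j).1 w :=
    Over.trans (h (labelsOver_mono (hwu' ▸ over_parent hw') hj)) h2
  rcases Over.total hj h4 with h5 | h5
  · exact hww' (eq_of_over_of_parent_eq hw (hwu'.trans hwu.symm) h5)
  · exact hww' (eq_of_over_of_parent_eq hw' (hwu.trans hwu'.symm) h5).symm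

theorem eq_of_labelsOver_eq {u v : T.V} (hu : u ≠ T.root) (hv : v ≠ T.root)
    (h : T.labelsOver u = T.labelsOver v) : u = v :=
  ((over_iff_labelsOver_subset hu).2 h.le).antisymm ((over_iff_labelsOver_subset hv).2 h.ge)

theorem ncard_parenthesization (T : FTree n) : T.parenthesization.ncard = T.numInternal :=
  InjOn.ncard_image fun _ hu _ hv h => eq_of_labelsOver_eq hu.1 hv.1 h

theorem nontrivial_of_mem {A : Set (Fin n)} (hA : A ∈ T.parenthesization) : A.Nontrivial := by
  obtain ⟨v, hv, rfl⟩ := hA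
  obtain ⟨a, b, hab, ha, hb, ha', hb'⟩ := exists_children hv
  obtain ⟨i, hi⟩ := labelsOver_nonempty ha
  obtain ⟨j, hj⟩ := labelsOver_nonempty hb
  refine ⟨i, labelsOver_mono (ha' ▸ over_parent ha) hi, j,
    labelsOver_mono (hb' ▸ over_parent hb) hj, ?_⟩
  rintro rfl
  rcases Over.total hi hj with h | h
  · exact hab (eq_of_over_of_parent_eq hb (ha'.trans hb'.symm) h)
  · exact hab (eq_of_over_of_parent_eq ha (hb'.trans ha'.symm) h).symm

/-- The parenthesization of a tree as a finite set. -/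
noncomputable def family (T : FTree n) : Finset (Set (Fin n)) :=
  (toFinite T.parenthesization).toFinset

theorem coe_family (T : FTree n) : (T.family : Set (Set (Fin n))) = T.parenthesization := by
  simp [family]

theorem mem_family {A : Set (Fin n)} : A ∈ T.family ↔ A ∈ T.parenthesization := by simp [family]

theorem isLaminar_family (T : FTree n) : IsLaminar T.family := by
  refine ⟨fun A hA => nontrivial_of_mem (mem_family.1 hA), fun A hA B hB i hi hi' => ?_⟩
  obtain ⟨u, -, rfl⟩ := mem_family.1 hA
  obtain ⟨v, -, rfl⟩ := mem_family.1 hB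
  exact (Over.total hi hi').imp labelsOver_mono labelsOver_mono

/-- If the family of `T'` is contained in the one of `T`, then the vertices of `T'` are vertices
of `T`. -/
theorem exists_section (h : T'.parenthesization ⊆ T.parenthesization) : ∃ s : T'.V → T.V,
    s T'.root = T.root ∧ ∀ v, v ≠ T'.root → s v ≠ T.root ∧ T.labelsOver (s v) = T'.labelsOver v := by
  classical
  have key : ∀ v, v ≠ T'.root → ∃ u, u ≠ T.root ∧ T.labelsOver u = T'.labelsOver v := by
    intro v hv
    by_cases hl : v ∈ T'.leaves
    · obtain ⟨i, hi⟩ := T'.label.surjective ⟨v, hl⟩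
      refine ⟨(T.label i).1, (T.label i).2.1, ?_⟩
      rw [labelsOver_label, ← labelsOver_label (T := T') i, hi]
    · obtain ⟨u, hu, hu'⟩ := h ⟨v, ⟨hv, hl⟩, rfl⟩
      exact ⟨u, hu.1, hu'⟩
  have : Nonempty T.V := ⟨T.root⟩
  choose! s hs using key
  refine ⟨fun v => if v = T'.root then T.root else s v, if_pos rfl, fun v hv => ?_⟩
  simpa only [if_neg hv] using hs v hv

theorem section_over_iff {s : T'.V → T.V} (h0 : s T'.root = T.root)
    (hs : ∀ v, v ≠ T'.root → s v ≠ T.root ∧ T.labelsOver (s v) = T'.labelsOver v) (a b : T'.V) :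
    T.Over (s a) (s b) ↔ T'.Over a b := by
  by_cases hb : b = T'.root
  · subst hb
    rw [h0]
    exact iff_of_true (over_root _) (over_root _)
  by_cases ha : a = T'.root
  · subst ha
    rw [h0]
    exact iff_of_false (fun h => (hs b hb).1 (eq_root_of_over h)) fun h => hb (eq_root_of_over h)
  rw [over_iff_labelsOver_subset (hs a ha).1, (hs a ha).2, (hs b hb).2,
    over_iff_labelsOver_subset ha]

/-- Trees with the same family are isomorphic. -/
theorem isIso_of_parenthesization_eq (h : T.parenthesization = T'.parenthesization) :
    T.IsIso T'.toTreeWithRoot := by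
  obtain ⟨s, h0, hs⟩ := exists_section h.ge
  obtain ⟨s', h0', hs'⟩ := exists_section h.le
  have key : ∀ {T T' : FTree n} {s : T'.V → T.V} {s' : T.V → T'.V} (_ : s T'.root = T.root)
      (_ : ∀ v, v ≠ T'.root → s v ≠ T.root ∧ T.labelsOver (s v) = T'.labelsOver v)
      (_ : s' T.root = T'.root)
      (_ : ∀ v, v ≠ T.root → s' v ≠ T'.root ∧ T'.labelsOver (s' v) = T.labelsOver v) (v : T'.V),
      s' (s v) = v := by
    intro T T' s s' h0 hs h0' hs' v
    by_cases hv : v = T'.root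
    · rw [hv, h0, h0']
    · have h1 := hs v hv
      have h2 := hs' _ h1.1
      exact eq_of_labelsOver_eq h2.1 hv (h2.2.trans h1.2)
  exact isIso_of_over ⟨s', s, key h0' hs' h0 hs, key h0 hs h0' hs'⟩
    fun u v => section_over_iff h0' hs' u v

end FTree

end FM

namespace FM

open Set

/-! ### The tree of a laminar family -/

theorem isTree_of_parent {V : Type*} [Finite V] {G : SimpleGraph V} {r : V} {par : V → V}
    {rank : V → ℕ} (h1 : ∀ v, v ≠ r → rank (par v) < rank v)
    (h2 : ∀ u v, G.Adj u v ↔ (u ≠ r ∧ par u = v) ∨ (v ≠ r ∧ par v = u)) : G.IsTree := by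
  rw [SimpleGraph.isTree_iff_connected_and_card]
  have hreach : ∀ k v, rank v = k → G.Reachable v r := by
    intro k
    induction k using Nat.strong_induction_on with
    | _ k ih =>
      intro v hv
      by_cases hvr : v = r
      · exact hvr ▸ SimpleGraph.Reachable.refl _
      · exact ((h2 v (par v)).2 (Or.inl ⟨hvr, rfl⟩)).reachable.trans
          (ih _ (hv ▸ h1 v hvr) (par v) rfl)
  constructor
  · have : Nonempty V := ⟨r⟩
    exact ⟨fun u v => (hreach _ u rfl).trans (hreach _ v rfl).symm⟩
  · classical
    let e : {v // v ≠ r} → G.edgeSet := fun v => ⟨s(v.1, par v.1), (h2 _ _).2 (Or.inl ⟨v.2, rfl⟩)⟩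
    have he : Function.Bijective e := by
      constructor
      · intro v w hvw
        have h3 : s(v.1, par v.1) = s(w.1, par w.1) := congrArg Subtype.val hvw
        rcases Sym2.eq_iff.1 h3 with h | h
        · exact Subtype.ext h.1
        · have h4 := h1 _ v.2
          have h5 := h1 _ w.2
          rw [h.2] at h4
          rw [← h.1] at h5
          omega
      · rintro ⟨x, hx⟩
        induction x using Sym2.ind with
        | _ a b =>
          rcases (h2 a b).1 hx with ⟨ha, rfl⟩ | ⟨hb, rfl⟩
          · exact ⟨⟨a, ha⟩, rfl⟩
          · exact ⟨⟨b, hb⟩, Subtype.ext Sym2.eq_swap⟩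
    rw [← Nat.card_congr (Equiv.ofBijective e he), ← Finite.card_option]
    exact Nat.card_congr (Equiv.optionSubtypeNe r)

section Canonical

variable {n : ℕ} {P : Finset (Set (Fin n))}

variable (P) in
/-- The vertices other than the root of the tree of a laminar family: the members of the family and
the singletons. -/
abbrev Node : Type := {A : Set (Fin n) // A ∈ P ∨ ∃ i, A = {i}}

theorem IsLaminar.node_nonempty (hP : IsLaminar P) (A : Node P) : A.1.Nonempty := by
  rcases A.2 with h | ⟨i, h⟩
  · exact (hP.nontrivial _ h).nonempty
  · exact h ▸ singleton_nonempty i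

theorem IsLaminar.mem_of_ssubset (hP : IsLaminar P) {A B : Node P} (h : A.1 ⊂ B.1) : B.1 ∈ P := by
  rcases B.2 with h' | ⟨i, h'⟩
  · exact h'
  · rw [h', ssubset_singleton_iff] at h
    exact absurd h (hP.node_nonempty A).ne_empty

theorem IsLaminar.exists_parent (hP : IsLaminar P) : ∃ par : Option (Node P) → Option (Node P),
    (∀ A B : Node P, par (some A) = some B → A.1 ⊂ B.1) ∧
    (∀ A B C : Node P, par (some A) = some B → A.1 ⊂ C.1 → B.1 ⊆ C.1) ∧
    ∀ A C : Node P, par (some A) = none → ¬ A.1 ⊂ C.1 := by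
  have key : ∀ A : Node P, ∃ o : Option (Node P), (∀ B : Node P, o = some B → A.1 ⊂ B.1) ∧
      (∀ B C : Node P, o = some B → A.1 ⊂ C.1 → B.1 ⊆ C.1) ∧
      ∀ C : Node P, o = none → ¬ A.1 ⊂ C.1 := by
    intro A
    by_cases h : ∃ C : Node P, A.1 ⊂ C.1
    · obtain ⟨B, hB, hmin⟩ := Set.Finite.exists_minimal (s := {C : Set (Fin n) | C ∈ P ∧ A.1 ⊂ C})
        (toFinite _) (h.elim fun C hC => ⟨C.1, hP.mem_of_ssubset hC, hC⟩)
      obtain ⟨i, hi⟩ := hP.node_nonempty A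
      refine ⟨some ⟨B, Or.inl hB.1⟩, ?_, ?_, by simp⟩
      · rintro _ ⟨⟩
        exact hB.2
      · rintro _ C ⟨⟩ hC
        rcases hP.nested B hB.1 C (hP.mem_of_ssubset hC) i (hB.2.1 hi) (hC.1 hi) with h | h
        · exact h
        · exact hmin ⟨hP.mem_of_ssubset hC, hC⟩ h
    · exact ⟨none, by simp, by simp, fun C _ hC => h ⟨C, hC⟩⟩
  choose f h1 h2 h3 using key
  exact ⟨fun o => o.elim none f, h1, h2, h3⟩

open TreeWithRoot in
/-- Every laminar family is the family of a tree. -/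
theorem IsLaminar.exists_tree (hP : IsLaminar P) : ∃ T : FTree n, T.parenthesization = P := by
  classical
  obtain ⟨par, hlt, hle, hnone⟩ := hP.exists_parent
  let rank : Option (Node P) → ℕ := fun o => o.elim 0 fun A => n + 1 - A.1.ncard
  have hcard : ∀ A : Set (Fin n), A.ncard ≤ n := fun A => by
    have h := ncard_le_ncard (subset_univ A) (toFinite _)
    rwa [ncard_univ, Nat.card_fin] at h
  have hrank : ∀ v, v ≠ none → rank (par v) < rank v := by
    intro v hv
    obtain ⟨A, rfl⟩ := Option.ne_none_iff_exists'.1 hv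
    have h1 := hcard A.1
    rcases h : par (some A) with _ | B
    · change 0 < n + 1 - A.1.ncard
      omega
    · have h2 := ncard_lt_ncard (hlt A B h) (toFinite _)
      have h3 := hcard B.1
      change n + 1 - B.1.ncard < n + 1 - A.1.ncard
      omega
  have hne : ∀ v, v ≠ none → par v ≠ v := fun v hv h => by
    have := hrank v hv
    rw [h] at this
    exact lt_irrefl _ this
  let G : SimpleGraph (Option (Node P)) :=
    { Adj := fun u v => (u ≠ none ∧ par u = v) ∨ (v ≠ none ∧ par v = u)
      symm := ⟨fun u v h => h.symm⟩
      loopless := ⟨fun u h => h.elim (fun h => hne u h.1 h.2) fun h => hne u h.1 h.2⟩ }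
  have hT : G.IsTree := isTree_of_parent hrank fun u v => Iff.rfl
  let i₀ : Fin n → Node P := fun i => ⟨{i}, Or.inr ⟨i, rfl⟩⟩
  have hnbr : ∀ v, v ≠ none → G.neighborSet v = insert (par v) {w | w ≠ none ∧ par w = v} := by
    intro v hv
    ext w
    change (v ≠ none ∧ par v = w) ∨ (w ≠ none ∧ par w = v) ↔ _
    rw [mem_insert_iff, eq_comm (a := w)]
    simp [hv]
  have hncard : ∀ v, v ≠ none →
      (G.neighborSet v).ncard = {w | w ≠ none ∧ par w = v}.ncard + 1 := by
    intro v hv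
    rw [hnbr v hv, ncard_insert_of_notMem _ (toFinite _)]
    rintro ⟨h1, h2⟩
    have h3 := hrank _ h1
    rw [h2] at h3
    exact absurd (h3.trans (hrank v hv)) (lt_irrefl _)
  -- singletons have no children
  have hleaf : ∀ i, (G.neighborSet (some (i₀ i))).ncard = 1 := by
    intro i
    rw [hncard _ (by simp), Nat.add_eq_right, ncard_eq_zero (toFinite _)]
    refine eq_empty_of_forall_notMem fun w hw => ?_
    obtain ⟨A, rfl⟩ := Option.ne_none_iff_exists'.1 hw.1
    have h1 := hlt A _ hw.2
    rw [ssubset_singleton_iff] at h1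
    exact (hP.node_nonempty A).ne_empty h1
  -- every element of a member of the family lies in one of its children
  have hchild : ∀ A : Node P, A.1 ∈ P → ∀ i ∈ A.1, ∃ B : Node P, i ∈ B.1 ∧ B.1 ⊂ A.1 ∧
      par (some B) = some A := by
    intro A hA i hi
    have hiA : (i₀ i).1 ⊂ A.1 := by
      refine ⟨singleton_subset_iff.2 hi, fun h => ?_⟩
      exact (hP.nontrivial _ hA).not_subset_singleton h
    obtain ⟨B, hB, hmax⟩ := Set.Finite.exists_maximalFor (fun B : Node P => B.1)
      {B : Node P | i ∈ B.1 ∧ B.1 ⊂ A.1} (toFinite _) ⟨i₀ i, rfl, hiA⟩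
    refine ⟨B, hB.1, hB.2, ?_⟩
    rcases h : par (some B) with _ | C
    · exact absurd hB.2 (hnone B A h)
    · have h1 := hlt B C h
      have h2 := hle B C A h hB.2
      by_contra hCA
      have h3 : C.1 ⊂ A.1 := h2.ssubset_of_ne fun e => hCA (congrArg some (Subtype.ext e))
      exact h1.2 (hmax ⟨h1.1 hB.1, h3⟩ h1.1)
  have hnode : ∀ A : Node P, A.1 ∈ P → 3 ≤ (G.neighborSet (some A)).ncard := by
    intro A hA
    rw [hncard _ (by simp)]
    obtain ⟨i, hi⟩ := hP.node_nonempty A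
    obtain ⟨B, hiB, hBA, hB⟩ := hchild A hA i hi
    obtain ⟨j, hj, hjB⟩ := exists_of_ssubset hBA
    obtain ⟨C, hjC, -, hC⟩ := hchild A hA j hj
    have h1 : 1 < {w | w ≠ none ∧ par w = some A}.ncard := by
      refine (one_lt_ncard (toFinite _)).2 ⟨some B, ⟨by simp, hB⟩, some C, ⟨by simp, hC⟩, ?_⟩
      intro h
      rw [Option.some_inj] at h
      exact hjB (h ▸ hjC)
    omega
  let T₀ : TreeWithRoot :=
    { V := Option (Node P)
      finite := inferInstance
      G := G
      isTree := hT
      root := none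
      no_bivalent := fun v hv => by
        obtain ⟨A, rfl⟩ := Option.ne_none_iff_exists'.1 hv
        rcases A.2 with hA | ⟨i, hA⟩
        · have := hnode A hA
          omega
        · have h1 : A = i₀ i := Subtype.ext hA
          rw [h1, hleaf i]
          norm_num }
  let lab : Fin n → T₀.leaves := fun i => ⟨some (i₀ i), by simp [T₀], hleaf i⟩
  have hlab : Function.Bijective lab := by
    constructor
    · intro i j h
      have h1 : i₀ i = i₀ j := Option.some_inj.1 (congrArg Subtype.val h)
      exact singleton_injective (congrArg Subtype.val h1)
    · rintro ⟨v, hv, hv1⟩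
      obtain ⟨A, rfl⟩ := Option.ne_none_iff_exists'.1 hv
      rcases A.2 with hA | ⟨i, hA⟩
      · have h1 := hnode A hA
        have h2 : (G.neighborSet (some A)).ncard = 1 := hv1
        omega
      · exact ⟨i, Subtype.ext (congrArg some (Subtype.ext hA.symm))⟩
  let T : FTree n := { T₀ with label := Equiv.ofBijective lab hlab }
  have hpar : ∀ v : T₀.V, v ≠ T₀.root → parent v = par v := fun v hv =>
    parent_eq_of_rank (T := T₀) (par := par) (rank := rank) hrank
      (fun v hv => Or.inl ⟨hv, rfl⟩) hv
  have hover : ∀ A B : Node P, T₀.Over (some A) (some B) ↔ A.1 ⊆ B.1 := by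
    suffices H : ∀ (u : T₀.V) (A B : Node P), u = some A → (T₀.Over u (some B) ↔ A.1 ⊆ B.1) from
      fun A B => H _ A B rfl
    intro u
    induction u using induction_parent with
    | h u ih =>
      rintro A B rfl
      have hA : (some A : T₀.V) ≠ T₀.root := by simp [T₀]
      have hB : (some B : T₀.V) ≠ T₀.root := by simp [T₀]
      have ih' := ih hA
      rw [over_iff]
      by_cases hAB : A = B
      · subst hAB
        simp
      have hAB' : ¬ (some A : T₀.V) = some B := fun h => hAB (Option.some_inj.1 h)
      rw [or_iff_right hAB', and_iff_right hA]
      rw [hpar _ hA] at ih' ⊢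
      rcases h : par (some A) with _ | C
      · refine iff_of_false (fun h' => hB (eq_root_of_over h')) fun h' => hnone A B h ?_
        exact h'.ssubset_of_ne fun e => hAB (Subtype.ext e)
      · have h1 := ih' C B h
        rw [h] at h1
        rw [h1]
        exact ⟨fun h' => (hlt A C h).1.trans h', fun h' =>
          hle A C B h (h'.ssubset_of_ne fun e => hAB (Subtype.ext e))⟩
  have hL : ∀ A : Node P, T.labelsOver (some A : T₀.V) = A.1 := by
    intro A
    ext i
    exact (hover (i₀ i) A).trans singleton_subset_iff
  refine ⟨T, ?_⟩
  ext A
  constructor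
  · rintro ⟨v, hv, rfl⟩
    obtain ⟨A, rfl⟩ := Option.ne_none_iff_exists'.1 (show v ≠ none from hv.1)
    rw [hL]
    rcases A.2 with hA | ⟨i, hA⟩
    · exact hA
    · refine absurd ⟨hv.1, ?_⟩ hv.2
      have h1 : A = i₀ i := Subtype.ext hA
      rw [h1]
      exact hleaf i
  · intro hA
    refine ⟨(some ⟨A, Or.inl hA⟩ : T₀.V), ⟨by simp [T, T₀], fun h => ?_⟩, hL _⟩
    have h1 := hnode ⟨A, Or.inl hA⟩ hA
    have h2 : (G.neighborSet (some ⟨A, Or.inl hA⟩)).ncard = 1 := h.2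
    omega

end Canonical

end FM

namespace FM

open Set

/-! ### Contractions of trees -/

namespace TreeWithRoot

section Contraction

variable {T T' : TreeWithRoot} {E : Set (Sym2 T.V)} {c : T.V → T'.V}

namespace IsContraction

variable (h : T.IsContraction T' E c)

include h

theorem eq_of_mem {u v : T.V} (huv : s(u, v) ∈ E) : c u = c v := by
  refine (h.identify u v).2 (SimpleGraph.Adj.reachable ?_)
  have hadj : T.G.Adj u v := h.subset_edges huv
  exact (SimpleGraph.fromEdgeSet_adj _).2 ⟨huv, hadj.ne⟩

/-- The top of the fibre of a vertex: the other elements lie over it, and the path which joins them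
stays in the fibre. -/
theorem exists_top (v' : T'.V) : ∃ t, c t = v' ∧ (t ≠ T.root → c (parent t) ≠ v') ∧
    ∀ u, c u = v' → T.Over u t ∧ ∀ w, T.Over u w → T.Over w t → c w = v' := by
  have := T.finite
  obtain ⟨t, ht, hmin⟩ := Set.exists_min_image {u | c u = v'} depth (toFinite _)
    (h.surjective v')
  have htop : t ≠ T.root → c (parent t) ≠ v' := by
    intro htr e
    have := hmin (parent t) e
    rw [depth_parent htr] at this
    omega
  refine ⟨t, ht, htop, fun u hu => ?_⟩
  have h1 := (h.identify t u).1 (ht.trans hu.symm)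
  rw [SimpleGraph.reachable_iff_reflTransGen] at h1
  clear hu
  induction h1 with
  | refl => exact ⟨over_refl _, fun w h1 h2 => h2.antisymm h1 ▸ ht⟩
  | @tail x y hx hxy ih =>
    have hE : s(x, y) ∈ E := ((SimpleGraph.fromEdgeSet_adj _).1 hxy).1
    have hxv : c x = v' := (ih.2 x (over_refl x) ih.1)
    have hyv : c y = v' := (h.eq_of_mem hE).symm.trans hxv
    have hadj : T.G.Adj x y := h.subset_edges hE
    rcases adj_iff.1 hadj with ⟨hxr, rfl⟩ | ⟨hyr, rfl⟩
    · have hxt : x ≠ t := by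
        rintro rfl
        exact htop hxr hyv
      exact ⟨(ih.1.parent_of_ne hxt).2, fun w h1 h2 => ih.2 w ((over_parent hxr).trans h1) h2⟩
    · refine ⟨(over_parent hyr).trans ih.1, fun w h1 h2 => ?_⟩
      by_cases hyw : y = w
      · exact hyw ▸ hyv
      · exact ih.2 w (h1.parent_of_ne hyw).2 h2

/-- The fibres are convex. -/
theorem eq_of_over {u v w : T.V} (huw : T.Over u w) (hwv : T.Over w v) (huv : c u = c v) :
    c w = c u := by
  obtain ⟨t, -, -, ht⟩ := h.exists_top (c u)
  exact (ht u rfl).2 w huw (hwv.trans (ht v huv.symm).1)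

theorem eq_or_adj {u : T.V} (hu : u ≠ T.root) : c u = c (parent u) ∨
    T'.G.Adj (c u) (c (parent u)) := by
  by_cases hE : s(u, parent u) ∈ E
  · exact Or.inl (h.eq_of_mem hE)
  · exact Or.inr ((h.adj _ _).2 ⟨u, parent u, adj_parent hu, hE, rfl, rfl⟩)

/-- If the image of the path from `u` to the root starts over `b` then it passes from `b` to the
parent of `b`. -/
theorem exists_over_eq_parent {u : T.V} {b : T'.V} (hb : b ≠ T'.root) (hu : T'.Over (c u) b) :
    ∃ w, w ≠ T.root ∧ T.Over u w ∧ c w = b ∧ c (parent w) = parent b := by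
  induction u using induction_parent with
  | h u ih =>
    have hur : u ≠ T.root := by
      rintro rfl
      rw [h.root] at hu
      exact hb (eq_root_of_over hu)
    by_cases h1 : T'.Over (c (parent u)) b
    · obtain ⟨w, hw, h2, h3⟩ := ih hur h1
      exact ⟨w, hw, (over_parent hur).trans h2, h3⟩
    · have h2 : c u ≠ c (parent u) := fun e => h1 (e ▸ hu)
      rcases adj_iff.1 ((h.eq_or_adj hur).resolve_left h2) with ⟨h3, h4⟩ | ⟨h3, h4⟩
      · have h5 : c u = b := by
          by_contra hne
          exact h1 (h4 ▸ (hu.parent_of_ne hne).2)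
        exact ⟨u, hur, over_refl u, h5, by rw [← h4, h5]⟩
      · exact absurd ((over_parent h3).trans (h4.symm ▸ hu)) h1

/-- A contraction does not reverse the direction of an edge: otherwise the image of the path to the
root would have to return to a fibre which it has left. -/
theorem over_parent {u : T.V} (hu : u ≠ T.root) : T'.Over (c u) (c (parent u)) := by
  rcases h.eq_or_adj hu with h1 | h1
  · exact h1 ▸ over_refl _
  rcases adj_iff.1 h1 with ⟨h2, h3⟩ | ⟨h2, h3⟩
  · exact h3 ▸ TreeWithRoot.over_parent h2
  · obtain ⟨w, hw, h4, h5, h6⟩ := h.exists_over_eq_parent (u := parent u) h2 (over_refl _)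
    have h7 := h.eq_of_over (TreeWithRoot.over_parent hu) (h4.trans (TreeWithRoot.over_parent hw))
      (h3.symm.trans h6.symm)
    exact absurd h7.symm h1.ne

theorem monotone {u v : T.V} (huv : T.Over u v) : T'.Over (c u) (c v) := by
  induction u using induction_parent with
  | h u ih =>
    by_cases hne : u = v
    · exact hne ▸ over_refl _
    · obtain ⟨h1, h2⟩ := huv.parent_of_ne hne
      exact (h.over_parent h1).trans (ih h1 h2)

theorem eq_of_mem_leaves {u v : T.V} (hu : u ∈ T.leaves) (huv : c u = c v) : u = v := by
  have h1 := (h.identify u v).1 huv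
  rw [SimpleGraph.reachable_iff_reflTransGen] at h1
  rcases h1.cases_head with h2 | ⟨x, h2, -⟩
  · exact h2
  · exact absurd hu (h.nonleaf _ ((SimpleGraph.fromEdgeSet_adj _).1 h2).1 u (Sym2.mem_mk_left _ _))

theorem map_leaves {u : T.V} (hu : u ∈ T.leaves) : c u ∈ T'.leaves := by
  have hur : c u ≠ T'.root := fun e => hu.1 (h.eq_of_mem_leaves hu (e.trans h.root.symm))
  refine (mem_leaves_iff hur).2 fun b hb hbu => ?_
  obtain ⟨v, hv, hvu, hE⟩ : ∃ v, T.G.Adj u v ∧ c v = b ∧ s(u, v) ∉ E := by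
    obtain ⟨x, v, h1, h2, h3, h4⟩ := (h.adj (c u) b).1 (adj_iff.2 (Or.inr ⟨hb, hbu⟩))
    obtain rfl := h.eq_of_mem_leaves hu h3.symm
    exact ⟨v, h1, h4, h2⟩
  rcases adj_iff.1 hv with ⟨-, h1⟩ | ⟨h1, h2⟩
  · have h2 := h.over_parent hu.1
    rw [h1, hvu, ← hbu] at h2
    exact not_over_parent hb h2
  · exact (mem_leaves_iff hu.1).1 hu v h1 h2

end IsContraction

end Contraction

end TreeWithRoot

namespace FTree

open TreeWithRoot

variable {n : ℕ} {T T' : FTree n}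

/-- The labels of a contraction correspond to those of the tree by a permutation, for which the
family of the contraction is a part of the family of the tree. -/
theorem exists_perm_of_isContraction {E : Set (Sym2 T.V)} {c : T.V → T'.V}
    (h : T.IsContraction T'.toTreeWithRoot E c) :
    ∃ σ : Equiv.Perm (Fin n), (σ • T').parenthesization ⊆ T.parenthesization := by
  let f : Fin n → Fin n := fun i => T'.label.symm ⟨c (T.label i).1, h.map_leaves (T.label i).2⟩
  have hf : ∀ i, (T'.label (f i)).1 = c (T.label i).1 := fun i => by
    simp only [f, Equiv.apply_symm_apply]
  have hinj : Function.Injective f := by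
    intro i j hij
    have h1 : c (T.label i).1 = c (T.label j).1 := by rw [← hf, ← hf, hij]
    exact T.label.injective (Subtype.ext (h.eq_of_mem_leaves (T.label i).2 h1))
  let τ : Equiv.Perm (Fin n) := Equiv.ofBijective f (Finite.injective_iff_bijective.1 hinj)
  refine ⟨τ⁻¹, ?_⟩
  rintro _ ⟨v', hv', rfl⟩
  obtain ⟨t, htv, httop, ht⟩ := h.exists_top v'
  have htr : t ≠ T.root := by
    rintro rfl
    exact hv'.1 (htv.symm.trans h.root)
  refine ⟨t, ⟨htr, fun hl => hv'.2 (htv ▸ h.map_leaves hl)⟩, ?_⟩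
  ext i
  have h1 : ((τ⁻¹ • T').label i).1 = c (T.label i).1 := hf i
  rw [mem_labelsOver, mem_labelsOver, h1]
  constructor
  · intro h2
    exact htv ▸ h.monotone h2
  · intro h2
    obtain ⟨w, -, h3, h4, -⟩ := h.exists_over_eq_parent hv'.1 h2
    exact h3.trans (ht w h4).1

/-- A tree whose family is a part of the family of `T` is a contraction of `T`. -/
theorem exists_isContraction (h : T'.parenthesization ⊆ T.parenthesization) :
    ∃ E c, T.IsContraction T'.toTreeWithRoot E c := by
  have := T'.finite
  obtain ⟨s, h0, hs⟩ := exists_section h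
  have hs' := section_over_iff h0 hs
  have hleaf : ∀ i, s (T'.label i).1 = (T.label i).1 := fun i => by
    have h1 := hs _ (T'.label i).2.1
    exact eq_of_labelsOver_eq h1.1 (T.label i).2.1
      (by rw [h1.2, labelsOver_label, labelsOver_label])
  -- the contraction is the lower adjoint of the section
  have hex : ∀ u, ∃ a, ∀ b, T.Over u (s b) ↔ T'.Over a b := by
    intro u
    obtain ⟨a, ha, hmax⟩ := Set.exists_max_image {a | T.Over u (s a)} depth (toFinite _)
      ⟨T'.root, by rw [mem_ofPred_eq, h0]; exact over_root u⟩
    refine ⟨a, fun b => ⟨fun hb => ?_, fun hb => Over.trans ha ((hs' _ _).2 hb)⟩⟩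
    rcases Over.total ha hb with h1 | h1
    · exact (hs' _ _).1 h1
    · have h2 := (hs' _ _).1 h1
      exact (h2.eq_of_depth_le (hmax b hb)) ▸ over_refl _
  choose c hc using hex
  have hle : ∀ u, T.Over u (s (c u)) := fun u => (hc u _).2 (over_refl _)
  have hcs : ∀ a, c (s a) = a := fun a =>
    ((hc _ _).1 (over_refl _)).antisymm ((hs' _ _).1 (hle (s a)))
  have hmono : ∀ u v, T.Over u v → T'.Over (c u) (c v) := fun u v huv =>
    (hc u _).1 (huv.trans (hle v))
  have hroot : c T.root = T'.root := by rw [← h0, hcs]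
  have hnr : ∀ a, a ≠ T'.root → s a ≠ T.root := fun a ha => (hs a ha).1
  -- a vertex at the top of a fibre is in the image of the section
  have htop : ∀ u, u ≠ s (c u) → c (parent u) = c u := fun u hu =>
    ((hc _ _).1 ((hle u).parent_of_ne hu).2).antisymm (hmono _ _ (over_parent ((hle u).parent_of_ne hu).1))
  have hpar : ∀ a, a ≠ T'.root → c (parent (s a)) = parent a := by
    intro a ha
    apply Over.antisymm
    · refine (hc _ _).1 (((hs' _ _).2 (over_parent ha)).parent_of_ne fun e => ?_).2
      have := congrArg c e
      rw [hcs, hcs] at this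
      exact parent_ne ha this.symm
    · have h1 := hmono _ _ (over_parent (hnr a ha))
      rw [hcs] at h1
      refine (h1.parent_of_ne fun e => ?_).2
      exact not_over_parent (hnr a ha) ((hc _ _).2 (e ▸ over_refl _))
  let E : Set (Sym2 T.V) := {e | ∃ u, u ≠ T.root ∧ c u = c (parent u) ∧ e = s(u, parent u)}
  have hE : ∀ u v, s(u, v) ∈ E → c u = c v := by
    rintro u v ⟨w, -, h1, h2⟩
    rcases Sym2.eq_iff.1 h2 with ⟨rfl, rfl⟩ | ⟨rfl, rfl⟩
    · exact h1
    · exact h1.symm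
  have hreach : ∀ u, (SimpleGraph.fromEdgeSet E).Reachable u (s (c u)) := by
    intro u
    induction u using induction_parent with
    | h u ih =>
      by_cases hu : u = s (c u)
      · rw [← hu]
      · have hur := ((hle u).parent_of_ne hu).1
        have h1 := htop u hu
        have h2 : (SimpleGraph.fromEdgeSet E).Adj u (parent u) :=
          (SimpleGraph.fromEdgeSet_adj _).2 ⟨⟨u, hur, h1.symm, rfl⟩, (parent_ne hur).symm⟩
        exact h2.reachable.trans (h1 ▸ ih hur)
  refine ⟨E, c, ?_, ?_, fun a => ⟨s a, hcs a⟩, fun u v => ⟨fun huv => ?_, fun huv => ?_⟩,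
    fun a b => ⟨fun hab => ?_, ?_⟩, hroot⟩
  · rintro _ ⟨u, hu, -, rfl⟩
    exact adj_parent hu
  · rintro _ ⟨u, hu, huc, rfl⟩ v hv hvl
    rcases Sym2.mem_iff.1 hv with rfl | rfl
    · obtain ⟨i, hi⟩ := T.label.surjective ⟨v, hvl⟩
      have h1 : s (T'.label i).1 = v := by rw [hleaf, hi]
      have h2 : T.Over (parent v) (s (T'.label i).1) := by
        rw [hc, ← huc, ← h1, hcs]
        exact over_refl _
      rw [h1] at h2
      exact not_over_parent hu h2
    · exact (mem_leaves_iff hvl.1).1 hvl u hu rfl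
  · exact (hreach u).trans (huv ▸ (hreach v).symm)
  · rw [SimpleGraph.reachable_iff_reflTransGen] at huv
    induction huv with
    | refl => rfl
    | tail _ hxy ih => exact ih.trans (hE _ _ ((SimpleGraph.fromEdgeSet_adj _).1 hxy).1)
  · have key : ∀ a, a ≠ T'.root → s(s a, parent (s a)) ∉ E := by
      intro a ha hmem
      have := hE _ _ hmem
      rw [hcs, hpar a ha] at this
      exact parent_ne ha this.symm
    rcases adj_iff.1 hab with ⟨ha, rfl⟩ | ⟨hb, rfl⟩
    · exact ⟨s a, parent (s a), adj_parent (hnr a ha), key a ha, hcs a, hpar a ha⟩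
    · exact ⟨parent (s b), s b, (adj_parent (hnr b hb)).symm, Sym2.eq_swap ▸ key b hb,
        hpar b hb, hcs b⟩
  · have key : ∀ u, u ≠ T.root → s(u, parent u) ∉ E → T'.G.Adj (c u) (c (parent u)) := by
      intro u hu hmem
      have h1 : u = s (c u) := by
        by_contra hne
        exact hmem ⟨u, hu, (htop u hne).symm, rfl⟩
      have h2 : c u ≠ T'.root := by
        intro e
        rw [e, h0] at h1
        exact hu h1
      have h3 := hpar _ h2
      rw [← h1] at h3
      rw [h3]
      exact adj_parent h2
    rintro ⟨u, v, huv, hmem, rfl, rfl⟩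
    rcases adj_iff.1 huv with ⟨hu, rfl⟩ | ⟨hv, rfl⟩
    · exact key u hu hmem
    · exact (key v hv (Sym2.eq_swap ▸ hmem)).symm

end FTree

/-! ### Relabelling and unlabelled trees -/

namespace FTree

open TreeWithRoot

variable {n : ℕ} {T T' : FTree n}

theorem mem_smul_parenthesization {σ : Equiv.Perm (Fin n)} {A : Set (Fin n)} :
    A ∈ (σ • T).parenthesization ↔ σ ⁻¹' A ∈ T.parenthesization := by
  have h1 : ∀ v : T.V, (σ • T).labelsOver v = ⇑σ⁻¹ ⁻¹' T.labelsOver v := fun v => rfl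
  constructor
  · rintro ⟨v, hv, rfl⟩
    refine ⟨v, hv, ?_⟩
    rw [h1, ← preimage_comp]
    ext i
    simp
  · rintro ⟨v, hv, hA⟩
    refine ⟨v, hv, ?_⟩
    rw [h1]
    erw [hA]
    ext i
    simp

theorem unlabelled_smul (σ : Equiv.Perm (Fin n)) (T : FTree n) :
    (σ • T).unlabelled = T.unlabelled := rfl

theorem exists_labelling (T : UFTree n) : ∃ T' : FTree n, T'.toTreeWithRoot = T.1 := by
  have := T.1.finite
  have h : Nat.card T.1.leaves = n := by rw [Nat.card_coe_set_eq, T.2]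
  exact ⟨{ T.1 with label := (Finite.equivFinOfCardEq h).symm }, rfl⟩

theorem unlabelled_surjective : Function.Surjective (unlabelled (n := n)) := by
  intro a
  obtain ⟨T, rfl⟩ := Quotient.exists_rep a
  obtain ⟨T', hT'⟩ := exists_labelling T
  exact ⟨T', congrArg (Quotient.mk _) (Subtype.ext hT')⟩

theorem exists_perm_of_isIso (h : T.IsIso T'.toTreeWithRoot) :
    ∃ σ : Equiv.Perm (Fin n), (σ • T').parenthesization ⊆ T.parenthesization := by
  obtain ⟨φ, hφ⟩ := h
  refine exists_perm_of_isContraction (E := ∅) (c := φ) ⟨empty_subset _, by simp, φ.surjective,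
    fun u v => ?_, fun a b => ⟨fun hab => ?_, ?_⟩, hφ⟩
  · rw [φ.injective.eq_iff, SimpleGraph.fromEdgeSet_empty, SimpleGraph.reachable_bot]
  · obtain ⟨u, rfl⟩ := φ.surjective a
    obtain ⟨v, rfl⟩ := φ.surjective b
    exact ⟨u, v, φ.map_adj_iff.1 hab, notMem_empty _, rfl, rfl⟩
  · rintro ⟨u, v, huv, -, rfl, rfl⟩
    exact φ.map_adj_iff.2 huv

theorem isIso_of_unlabelled_eq (h : T.unlabelled = T'.unlabelled) : T.IsIso T'.toTreeWithRoot :=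
  Quotient.exact h

/-- The morphisms between unlabelled trees are the inclusions of their families, up to a
permutation of the labels. -/
theorem hom_iff : UnlabelledFTree.Hom T.unlabelled T'.unlabelled ↔
    ∃ σ : Equiv.Perm (Fin n), (σ • T').parenthesization ⊆ T.parenthesization := by
  have hsub : ∀ {A B : FTree n} (ρ : Equiv.Perm (Fin n)), A.parenthesization ⊆ B.parenthesization →
      (ρ • A).parenthesization ⊆ (ρ • B).parenthesization := fun ρ h D hD =>
    mem_smul_parenthesization.2 (h (mem_smul_parenthesization.1 hD))
  constructor
  · rintro ⟨S, S', hS, hS', E, c, h⟩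
    obtain ⟨U, hU⟩ := exists_labelling S
    obtain ⟨U', hU'⟩ := exists_labelling S'
    obtain ⟨S, hS1⟩ := S
    obtain ⟨S', hS1'⟩ := S'
    subst hU hU'
    obtain ⟨ρ, hρ⟩ := exists_perm_of_isIso (T := T) (T' := U) (isIso_of_unlabelled_eq hS.symm)
    obtain ⟨σ, hσ⟩ := exists_perm_of_isContraction (T := U) (T' := U') h
    obtain ⟨τ, hτ⟩ := exists_perm_of_isIso (T := U') (T' := T') (isIso_of_unlabelled_eq hS')
    refine ⟨ρ * σ * τ, ?_⟩
    rw [mul_smul, mul_smul]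
    exact (hsub ρ ((hsub σ hτ).trans hσ)).trans hρ
  · rintro ⟨σ, hσ⟩
    obtain ⟨E, c, h⟩ := exists_isContraction hσ
    exact ⟨_, _, rfl, unlabelled_smul σ T', E, c, h⟩

theorem unlabelled_eq_iff : T.unlabelled = T'.unlabelled ↔
    ∃ σ : Equiv.Perm (Fin n), (σ • T').parenthesization = T.parenthesization := by
  constructor
  · intro h
    have hcard : ∀ {A B : FTree n}, A.unlabelled = B.unlabelled →
        B.parenthesization.ncard ≤ A.parenthesization.ncard := by
      intro A B hAB
      obtain ⟨σ, hσ⟩ := exists_perm_of_isIso (isIso_of_unlabelled_eq hAB)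
      have h1 := ncard_le_ncard hσ (toFinite _)
      rwa [ncard_parenthesization, show (σ • B).numInternal = B.numInternal from rfl,
        ← ncard_parenthesization] at h1
    obtain ⟨σ, hσ⟩ := exists_perm_of_isIso (isIso_of_unlabelled_eq h)
    refine ⟨σ, eq_of_subset_of_ncard_le hσ ?_ (toFinite _)⟩
    exact hcard (A := σ • T') (B := T) (unlabelled_smul σ T' ▸ h.symm)
  · rintro ⟨σ, hσ⟩
    rw [← unlabelled_smul σ T']
    exact Quotient.sound (isIso_of_parenthesization_eq (T' := σ • T') hσ.symm)

end FTree

end FM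

namespace FM

open Set Topology Filter

/-! ### The compactification and its strata as manifolds -/

variable {n d m : ℕ} {M : Type*} [TopologicalSpace M] {ε : M ↪ Euc m}

namespace CornerChart

variable {p : CompactConf n ε} (K : CornerChart d p)

theorem isAdaptedChart :
    IsAdaptedChart (Corners (n * d)) (fun q : CompactConf n ε => coords ε q.1) K.χ :=
  ⟨K.O, K.f, K.isOpen_O, K.contDiffOn_f, fun h hh =>
    ⟨(K.mem_target h).1 hh, K.injective_fderiv h hh, K.coords_symm h hh⟩⟩

/-- In a corner chart, the parenthesization of a point consists of the sets of which the coordinate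
vanishes. -/
theorem mem_parenthesization_iff {q : CompactConf n ε} (hq : q ∈ K.χ.source) (A : Set (Fin n)) :
    A ∈ parenthesization q.1 ↔ ∃ hA : A ∈ parenthesization p.1, (K.χ q).1 (K.D ⟨A, hA⟩) = 0 := by
  have := K.parenthesization_symm _ (K.χ.map_source hq) A
  rwa [K.χ.left_inv hq] at this

/-- The codimension of the corner of a point is the number of sets in its parenthesization. -/
theorem ncard_zero : {l : Fin (n * d) | (K.χ p).1 l = 0}.ncard = (parenthesization p.1).ncard := by
  have h1 : {l : Fin (n * d) | (K.χ p).1 l = 0} = range K.D := by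
    ext l
    constructor
    · intro hl
      by_contra h
      have h2 := K.pos _ ((K.mem_target _).1 (K.χ.map_source K.mem_source)) l h
      rw [mem_ofPred_eq] at hl
      exact h2.ne' hl
    · rintro ⟨A, rfl⟩
      exact ((K.mem_parenthesization_iff K.mem_source A.1).1 A.2).2
  rw [h1, ← Nat.card_coe_set_eq, Nat.card_range_of_injective K.injective_D, Nat.card_coe_set_eq]

/-- Near a point, the parenthesizations are contained in the one of the point. -/
theorem eventually_parenthesization_subset (K : CornerChart d p) :
    ∀ᶠ q in 𝓝 p, parenthesization q.1 ⊆ parenthesization p.1 := by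
  filter_upwards [K.χ.open_source.mem_nhds K.mem_source] with q hq A hA
  exact ((K.mem_parenthesization_iff hq A).1 hA).1

/-- Every part of the parenthesization of a point is the parenthesization of nearby points. -/
theorem mem_closure {P : Set (Set (Fin n))} (hP : P ⊆ parenthesization p.1)
    (K : CornerChart d p) : p ∈ closure {q : CompactConf n ε | parenthesization q.1 = P} := by
  classical
  let w : ℝ → EuclideanQuadrant (n * d) := fun t =>
    ⟨(K.χ p).1 + (max t 0) • WithLp.toLp 2 fun l => if ∃ A, l = K.D A ∧ A.1 ∉ P then 1 else 0,
      fun l => add_nonneg ((K.χ p).2 l) (mul_nonneg (le_max_right _ _) (by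
        change 0 ≤ if _ then (1 : ℝ) else 0
        split_ifs <;> norm_num))⟩
  have hw : Tendsto w (𝓝[>] 0) (𝓝 (K.χ p)) := by
    have h1 : Continuous w := by
      refine Continuous.subtype_mk ?_ _
      fun_prop
    have h2 : w 0 = K.χ p := by
      apply Subtype.ext
      simp [w]
    exact h2 ▸ (h1.tendsto 0).mono_left nhdsWithin_le_nhds
  have hsymm : Tendsto (fun t => K.χ.symm (w t)) (𝓝[>] 0) (𝓝 p) := by
    have h1 := (K.χ.continuousAt_symm (K.χ.map_source K.mem_source)).tendsto.comp hw
    rwa [K.χ.left_inv K.mem_source] at h1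
  refine mem_closure_of_tendsto hsymm ?_
  filter_upwards [hw (K.χ.open_target.mem_nhds (K.χ.map_source K.mem_source)),
    self_mem_nhdsWithin] with t ht ht0
  rw [mem_Ioi] at ht0
  rw [mem_preimage] at ht
  ext A
  rw [K.parenthesization_symm _ ht]
  have h1 : ∀ hA : A ∈ parenthesization p.1, (w t).1 (K.D ⟨A, hA⟩) = if A ∉ P then t else 0 := by
    intro hA
    have h2 : (K.χ p).1 (K.D ⟨A, hA⟩) = 0 :=
      ((K.mem_parenthesization_iff K.mem_source A).1 hA).2
    have h3 : (∃ B, K.D ⟨A, hA⟩ = K.D B ∧ B.1 ∉ P) ↔ A ∉ P :=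
      ⟨fun ⟨B, hB, h⟩ => by rwa [← K.injective_D hB] at h, fun h => ⟨_, rfl, h⟩⟩
    simp only [w, PiLp.add_apply, PiLp.smul_apply, h2, max_eq_left ht0.le, zero_add, smul_eq_mul,
      h3, mul_ite, mul_one, mul_zero]
  constructor
  · rintro ⟨hA, h2⟩
    rw [h1 hA] at h2
    by_contra hAP
    rw [if_pos hAP] at h2
    exact ht0.ne' h2
  · intro hA
    exact ⟨hP hA, by rw [h1, if_neg (not_not.2 hA)]⟩

/-- A corner chart restricts to a chart of the stratum, given by the coordinates which do not vanish
on the stratum. -/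
theorem exists_stratum_chart (hε : IsEmbedding ε) {T : FTree n} (p : stratum ε T)
    (K : CornerChart d p.1) :
    ∃ χ : OpenPartialHomeomorph (stratum ε T) (Euc (n * d - T.numInternal)), p ∈ χ.source ∧
      IsAdaptedChart (𝓡 (n * d - T.numInternal)) (fun q : stratum ε T => coords ε q.1.1) χ := by
  classical
  obtain ⟨S, hS⟩ : ∃ S : Set (Fin (n * d)), S = range K.D := ⟨_, rfl⟩
  have hcard : Nat.card {l // l ∉ S} = n * d - T.numInternal := by
    have h1 : S.ncard = T.numInternal := by
      rw [hS, ← Nat.card_coe_set_eq, Nat.card_range_of_injective K.injective_D, Nat.card_coe_set_eq,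
        p.2, T.ncard_parenthesization]
    have h2 := ncard_add_ncard_compl S
    rw [h1, Nat.card_fin] at h2
    have h3 : Nat.card {l // l ∉ S} = Sᶜ.ncard := Nat.card_coe_set_eq _
    omega
  let ι := Finite.equivFinOfCardEq hcard
  let ext : Euc (n * d - T.numInternal) →L[ℝ] Euc (n * d) := LinearMap.toContinuousLinearMap
    { toFun := fun v => WithLp.toLp 2 fun l => if h : l ∈ S then 0 else v (ι ⟨l, h⟩)
      map_add' := fun v w => by
        ext l
        by_cases h : l ∈ S <;> simp [h]
      map_smul' := fun r v => by
        ext l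
        by_cases h : l ∈ S <;> simp [h] }
  let restr : Euc (n * d) → Euc (n * d - T.numInternal) := fun z =>
    WithLp.toLp 2 fun e => z (ι.symm e).1
  have hext : ∀ v l, ext v l = if h : l ∈ S then 0 else v (ι ⟨l, h⟩) := fun v l => rfl
  have hext0 : ∀ v A, ext v (K.D A) = 0 := fun v A => by
    rw [hext, dif_pos (hS ▸ mem_range_self A)]
  have hre : ∀ v, restr (ext v) = v := by
    intro v
    ext e
    change ext v (ι.symm e).1 = v e
    rw [hext, dif_neg (ι.symm e).2]
    simp
  have her : ∀ z : Euc (n * d), (∀ A, z (K.D A) = 0) → ext (restr z) = z := by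
    intro z hz
    ext l
    rw [hext]
    split_ifs with h
    · obtain ⟨A, rfl⟩ := hS ▸ h
      exact (hz A).symm
    · change z (ι.symm (ι ⟨l, h⟩)).1 = z l
      rw [Equiv.symm_apply_apply]
  have hemb : IsEmbedding fun q : stratum ε T => coords ε q.1.1 :=
    ((isEmbedding_coords hε).comp IsEmbedding.subtypeVal).comp IsEmbedding.subtypeVal
  have : Nonempty (stratum ε T) := ⟨p⟩
  have hzero : ∀ q : stratum ε T, q.1 ∈ K.χ.source → ∀ A, (K.χ q.1).1 (K.D A) = 0 := by
    intro q hq A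
    have h1 : A.1 ∈ parenthesization q.1.1 := by
      rw [q.2, ← p.2]
      exact A.2
    exact ((K.mem_parenthesization_iff hq A.1).1 h1).2
  have hpoint : ∀ v, ext v ∈ K.O → ∃ h ∈ K.χ.target, h.1 = ext v := by
    intro v hv
    refine ⟨⟨ext v, fun l => ?_⟩, (K.mem_target _).2 hv, rfl⟩
    by_cases h : l ∈ range K.D
    · obtain ⟨A, rfl⟩ := h
      exact (hext0 v A).ge
    · exact (K.pos _ hv l h).le
  obtain ⟨χ, hχs, hχt, -, hχ⟩ := exists_chart_of_inverse (e := fun q : stratum ε T => coords ε q.1.1)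
    (I := fun v : Euc (n * d - T.numInternal) => v) (V := {q : stratum ε T | q.1 ∈ K.χ.source})
    (O := ext ⁻¹' K.O) (g := fun q => restr (K.χ q.1).1) (f := K.f ∘ ext) hemb IsEmbedding.id
    (K.χ.open_source.preimage continuous_subtype_val) (K.isOpen_O.preimage ext.continuous)
    (by
      have h1 : Continuous restr := by fun_prop
      have h2 : ContinuousOn (fun q : stratum ε T => (K.χ q.1).1)
          {q : stratum ε T | q.1 ∈ K.χ.source} :=
        continuous_subtype_val.comp_continuousOn
          (K.χ.continuousOn.comp continuous_subtype_val.continuousOn fun q hq => hq)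
      exact h1.comp_continuousOn h2)
    (K.contDiffOn_f.continuousOn.comp ext.continuous.continuousOn fun v hv => hv)
    (fun q hq => by
      have h1 := K.χ.map_source hq
      have h2 := her _ (hzero q hq)
      refine ⟨?_, ?_, _, rfl⟩
      · rw [mem_preimage, h2]
        exact (K.mem_target _).1 h1
      · rw [Function.comp_apply, h2, ← K.coords_symm _ h1, K.χ.left_inv hq])
    (fun v hv => by
      obtain ⟨h, hh, hhv⟩ := hpoint v hv
      refine ⟨⟨K.χ.symm h, ?_⟩, K.χ.map_target hh, ?_, ?_⟩
      · change parenthesization (K.χ.symm h).1 = T.parenthesization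
        rw [← p.2]
        ext A
        rw [K.parenthesization_symm h hh, hhv]
        exact ⟨fun h => h.1, fun hA => ⟨hA, hext0 v _⟩⟩
      · exact (K.coords_symm h hh).trans (congrArg K.f hhv)
      · rw [K.χ.right_inv hh, hhv, hre])
  refine ⟨χ, ?_, ext ⁻¹' K.O, K.f ∘ ext, K.isOpen_O.preimage ext.continuous,
    K.contDiffOn_f.comp ext.contDiff.contDiffOn fun v hv => hv, fun v hv => ?_⟩
  · rw [hχs]
    exact K.mem_source
  · have hv' : ext v ∈ K.O := by
      rw [hχt] at hv
      exact hv
    refine ⟨hv', ?_, hχ v hv'⟩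
    obtain ⟨h, hh, hhv⟩ := hpoint v hv'
    have h1 : DifferentiableAt ℝ K.f (ext v) :=
      (K.contDiffOn_f.contDiffAt (K.isOpen_O.mem_nhds hv')).differentiableAt (by simp)
    have h2 := (h1.hasFDerivAt.comp v ext.hasFDerivAt).fderiv
    change Function.Injective (fderiv ℝ (K.f ∘ ext) v)
    rw [h2]
    have h3 := K.injective_fderiv h hh
    rw [hhv] at h3
    exact h3.comp (Function.LeftInverse.injective hre)

end CornerChart

/-! ### The action of the symmetric group -/

/-- The map induced by a permutation on the tuples of distinct indices. -/
def Conf.map {k : ℕ} {X : Type*} (σ : Equiv.Perm X) (t : Conf k X) : Conf k X :=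
  ⟨σ ∘ t.1, σ.injective.comp t.2⟩

/-- The action of a permutation on the ambient space, by relabelling all indices. -/
def relabel {A B C : Type*} (σ : Equiv.Perm (Fin n))
    (q : (Fin n → A) × (Conf 2 (Fin n) → B) × (Conf 3 (Fin n) → C)) :
    (Fin n → A) × (Conf 2 (Fin n) → B) × (Conf 3 (Fin n) → C) :=
  (fun i => q.1 (σ⁻¹ i), fun e => q.2.1 (e.map σ⁻¹), fun t => q.2.2 (t.map σ⁻¹))

theorem continuous_relabel {A B C : Type*} [TopologicalSpace A] [TopologicalSpace B]
    [TopologicalSpace C] (σ : Equiv.Perm (Fin n)) :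
    Continuous (relabel (A := A) (B := B) (C := C) σ) := by
  unfold relabel
  fun_prop

theorem contDiff_relabel (σ : Equiv.Perm (Fin n)) :
    ContDiff ℝ ∞ (relabel σ : CoordSpace n m → CoordSpace n m) := by
  unfold relabel
  fun_prop

theorem relabel_mem_closure (σ : Equiv.Perm (Fin n)) {q : Ambient n m M}
    (hq : q ∈ closure (range (alpha n ε))) : relabel σ q ∈ closure (range (alpha n ε)) := by
  refine map_mem_closure (continuous_relabel σ) hq ?_
  rintro _ ⟨x, rfl⟩
  exact ⟨σ • x, rfl⟩

variable (ε) in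
/-- The action of the symmetric group on the compactification. -/
abbrev relabelAction : MulAction (Equiv.Perm (Fin n)) (CompactConf n ε) where
  smul σ q := ⟨relabel σ q.1, relabel_mem_closure σ q.2⟩
  one_smul _ := rfl
  mul_smul _ _ _ := rfl

omit [TopologicalSpace M] in
theorem excludes_relabel {σ : Equiv.Perm (Fin n)} {q : Ambient n m M} {i j k : Fin n} :
    Excludes (relabel σ q) (σ i) (σ j) (σ k) ↔ Excludes q i j k := by
  constructor
  · rintro ⟨t, h1, h2, h3, h⟩
    refine ⟨t.map σ⁻¹, ?_, ?_, ?_, h⟩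
    · exact (congrArg _ h1).trans (σ.symm_apply_apply i)
    · exact (congrArg _ h2).trans (σ.symm_apply_apply j)
    · exact (congrArg _ h3).trans (σ.symm_apply_apply k)
  · rintro ⟨t, h1, h2, h3, h⟩
    refine ⟨t.map σ, congrArg σ h1, congrArg σ h2, congrArg σ h3, ?_⟩
    have : (t.map σ).map σ⁻¹ = t := Subtype.ext (funext fun a => σ.symm_apply_apply _)
    change q.2.2 ((t.map σ).map σ⁻¹) = 0
    rw [this]
    exact h

omit [TopologicalSpace M] in
theorem mem_parenthesization_relabel {σ : Equiv.Perm (Fin n)} {q : Ambient n m M}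
    {A : Set (Fin n)} : A ∈ parenthesization (relabel σ q) ↔ σ ⁻¹' A ∈ parenthesization q := by
  have key : ∀ (σ : Equiv.Perm (Fin n)) (q : Ambient n m M) (A : Set (Fin n)),
      A ∈ parenthesization (relabel σ q) → σ ⁻¹' A ∈ parenthesization q := by
    intro σ q A
    rintro (⟨i, k, ⟨j, hj⟩, rfl⟩ | ⟨hn, h, rfl⟩)
    · obtain ⟨i, rfl⟩ := σ.surjective i
      obtain ⟨j, rfl⟩ := σ.surjective j
      obtain ⟨k, rfl⟩ := σ.surjective k
      refine Or.inl ⟨i, k, ⟨j, excludes_relabel.1 hj⟩, ?_⟩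
      ext l
      simp [excludes_relabel]
    · refine Or.inr ⟨hn, fun i j => ?_, preimage_univ⟩
      have h1 := h (σ i) (σ j)
      simpa [relabel] using h1
  refine ⟨key σ q A, fun h => ?_⟩
  have h1 : σ ⁻¹' A ∈ parenthesization (relabel σ⁻¹ (relabel σ q)) := by
    have h2 : relabel σ⁻¹ (relabel σ q) = q := by
      have h3 : relabel σ⁻¹ (relabel σ q) = relabel (σ⁻¹ * σ) q := rfl
      rw [h3, inv_mul_cancel]
      rfl
    rwa [h2]
  have h2 := key σ⁻¹ _ _ h1
  rwa [← preimage_comp, ← Equiv.Perm.coe_mul, mul_inv_cancel, Equiv.Perm.coe_one, preimage_id]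
    at h2

/-- The action is free: if `σ⁻¹` moved `i` while fixing a point, then the unit vectors which point
from each element of the orbit of `i` to the next one would all be equal, although the corresponding
differences add up to zero. -/
theorem eq_one_of_relabel_eq {σ : Equiv.Perm (Fin n)} {p : Ambient n m M}
    (hp : p ∈ closure (range (alpha n ε))) (hε : IsEmbedding ε) (h : relabel σ p = p) : σ = 1 := by
  by_contra hσ
  obtain ⟨i, hi⟩ : ∃ i, σ⁻¹ i ≠ i := by
    by_contra! h'
    exact hσ (inv_eq_one.1 (Equiv.ext h'))
  let s : ℕ → Fin n := fun l => ((σ⁻¹) ^ l) i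
  have hs : ∀ l, s (l + 1) = σ⁻¹ (s l) := fun l => by
    simp only [s, pow_succ', Equiv.Perm.mul_apply]
  have hne : ∀ l, s l ≠ s (l + 1) := by
    intro l
    induction l with
    | zero => exact hi.symm
    | succ l ih =>
      rw [hs, hs (l + 1)]
      exact fun e => ih (σ⁻¹.injective e)
  let u : Euc m := p.2.1 (pair (s 0) (s 1) (hne 0))
  have hu : ∀ l, (p.2.1 (pair (s l) (s (l + 1)) (hne l)) : Euc m) = u := by
    intro l
    induction l with
    | zero => rfl
    | succ l ih =>
      rw [← ih]
      have h1 := congrArg (fun q : Ambient n m M => q.2.1 (pair (s l) (s (l + 1)) (hne l))) h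
      have h2 : (pair (s l) (s (l + 1)) (hne l)).map σ⁻¹ =
          pair (s (l + 1)) (s (l + 1 + 1)) (hne (l + 1)) := by
        apply Subtype.ext
        funext a
        fin_cases a
        · exact (hs l).symm
        · exact (hs (l + 1)).symm
      rw [← h1]
      change ((p.2.1 _ : Metric.sphere (0 : Euc m) 1) : Euc m) = p.2.1 (Conf.map σ⁻¹ _)
      rw [h2]
  have hu1 : ‖u‖ = 1 := mem_sphere_zero_iff_norm.1 (p.2.1 _).2
  let r := orderOf (σ⁻¹)
  have hr : 0 < r := orderOf_pos _
  have := neBot_approach hp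
  have hev : ∀ᶠ x in approach ε p, ∀ l ∈ Finset.range r,
      0 < inner ℝ u (ε (x.1 (s l)) - ε (x.1 (s (l + 1)))) := by
    rw [Finset.eventually_all]
    intro l _
    have hc : Continuous fun q : CoordSpace n m => inner ℝ u (dirVec (s l) (s (l + 1)) q) := by
      have : (fun q : CoordSpace n m => dirVec (s l) (s (l + 1)) q) =
          fun q => q.2.1 (pair _ _ (hne l)) := by
        funext q
        rw [dirVec, dif_pos (hne l)]
      have h1 : Continuous fun q : CoordSpace n m => dirVec (s l) (s (l + 1)) q := by
        rw [this]
        fun_prop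
      fun_prop
    have h1 := (hc.tendsto _).comp (tendsto_coords_approach (p := p) hε)
    have h2 : inner ℝ u (dirVec (s l) (s (l + 1)) (coords ε p)) = 1 := by
      have : dirVec (s l) (s (l + 1)) (coords ε p) = u := by
        rw [dirVec, dif_pos (hne l)]
        exact hu l
      rw [this, real_inner_self_eq_norm_sq, hu1, one_pow]
    rw [h2] at h1
    filter_upwards [h1.eventually_const_lt one_pos] with x hx
    have h3 := gap_pos (ε := ε) (hne l) x
    rw [Function.comp_apply, dirVec_alpha ε (hne l), real_inner_smul_right] at hx
    exact (mul_pos_iff_of_pos_left (inv_pos.2 h3)).1 hx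
  obtain ⟨x, hx⟩ := hev.exists
  have h1 : 0 < ∑ l ∈ Finset.range r, inner ℝ u (ε (x.1 (s l)) - ε (x.1 (s (l + 1)))) :=
    Finset.sum_pos hx (Finset.nonempty_range_iff.2 hr.ne')
  rw [← inner_sum, Finset.sum_range_sub' (fun l => ε (x.1 (s l)))] at h1
  have h2 : s r = s 0 := by
    simp only [s, r, pow_orderOf_eq_one, pow_zero]
  rw [h2, sub_self, inner_zero_right] at h1
  exact lt_irrefl _ h1

end FM

namespace FM

open Set Topology Filter

/-! ### Nonemptiness of the strata -/

section Leading

variable {n : ℕ} {P : Finset (Set (Fin n))} {i j k : Fin n}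

open scoped Classical in
variable (P) in
/-- The members of a laminar family and the singletons. -/
noncomputable def nodes : Finset (Set (Fin n)) := {C | C ∈ P ∨ ∃ i, C = {i}}

open scoped Classical in
variable (P) in
/-- The nodes which contain `i` but not `j`. -/
noncomputable def sepNodes (i j : Fin n) : Finset (Set (Fin n)) := {C ∈ nodes P | i ∈ C ∧ j ∉ C}

open scoped Classical in
variable (P) in
/-- A configuration of points on a line which come together according to the laminar family `P` when
the parameter `τ` tends to zero: each node `C` contributes the term `y C` with exponent the number
of members of `P` which are larger than `C`. -/
noncomputable def spread (y : Set (Fin n) → ℝ) (τ : ℝ) (i : Fin n) : ℝ :=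
  ∑ C ∈ nodes P with i ∈ C, y C * τ ^ (sabove P C).card

variable (P) in
/-- The difference of two points of `spread`, divided by the appropriate power of `τ`. -/
noncomputable def spreadDiff (y : Set (Fin n) → ℝ) (τ : ℝ) (i j : Fin n) : ℝ :=
  ∑ C ∈ sepNodes P i j, y C * τ ^ ((sabove P C).card - (common P i j).card) -
    ∑ C ∈ sepNodes P j i, y C * τ ^ ((sabove P C).card - (common P i j).card)

theorem mem_sepNodes {C : Set (Fin n)} :
    C ∈ sepNodes P i j ↔ (C ∈ P ∨ ∃ i, C = {i}) ∧ i ∈ C ∧ j ∉ C := by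
  simp [sepNodes, nodes]

namespace IsLaminar

variable (hP : IsLaminar P)
include hP

theorem common_subset_sabove {C : Set (Fin n)} (hC : C ∈ sepNodes P i j) :
    common P i j ⊆ sabove P C := by
  obtain ⟨hC, hi, hj⟩ := mem_sepNodes.1 hC
  intro B hB
  obtain ⟨hB, hiB, hjB⟩ := mem_common.1 hB
  refine mem_sabove.2 ⟨hB, ?_, fun h => hj (h hjB)⟩
  rcases hC with hC | ⟨l, rfl⟩
  · exact (hP.nested C hC B hB i hi hiB).resolve_right fun h => hj (h hjB)
  · rw [mem_singleton_iff] at hi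
    exact hi ▸ singleton_subset_iff.2 hiB

theorem spread_sub (y : Set (Fin n) → ℝ) (τ : ℝ) (i j : Fin n) :
    spread P y τ i - spread P y τ j = τ ^ (common P i j).card * spreadDiff P y τ i j := by
  classical
  have h1 : ∀ i j, {C ∈ nodes P | i ∈ C} \ {C ∈ nodes P | j ∈ C} = sepNodes P i j := by
    intro i j
    ext C
    simp only [sepNodes, Finset.mem_sdiff, Finset.mem_filter]
    tauto
  have h2 : ∀ i j : Fin n, ∑ C ∈ sepNodes P i j, y C * τ ^ (sabove P C).card =
      τ ^ (common P i j).card *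
        ∑ C ∈ sepNodes P i j, y C * τ ^ ((sabove P C).card - (common P i j).card) := by
    intro i j
    rw [Finset.mul_sum]
    refine Finset.sum_congr rfl fun C hC => ?_
    rw [mul_left_comm, ← pow_add,
      Nat.add_sub_cancel' (Finset.card_le_card (hP.common_subset_sabove hC))]
  rw [spread, spread, ← Finset.sum_sdiff_sub_sum_sdiff, h1, h1, h2 i j, h2 j i, spreadDiff,
    common_comm (i := j) (j := i), mul_sub]

/-- The leading term comes from the largest node which contains `i` but not `j`. -/
theorem exists_leading (y : Set (Fin n) → ℝ) (hij : i ≠ j) : ∃ C, i ∈ C ∧ j ∉ C ∧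
    ∑ C ∈ sepNodes P i j, y C * 0 ^ ((sabove P C).card - (common P i j).card) = y C := by
  obtain ⟨C, hC, hmax⟩ := (sepNodes P i j).exists_maximal
    ⟨{i}, mem_sepNodes.2 ⟨Or.inr ⟨i, rfl⟩, rfl, fun h => hij (mem_singleton_iff.1 h).symm⟩⟩
  obtain ⟨hCn, hiC, hjC⟩ := mem_sepNodes.1 hC
  have hab : sabove P C = common P i j := by
    refine Finset.Subset.antisymm (fun B hB => ?_) (hP.common_subset_sabove hC)
    obtain ⟨hB, hCB⟩ := mem_sabove.1 hB
    refine mem_common.2 ⟨hB, hCB.1 hiC, ?_⟩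
    by_contra hjB
    exact hCB.2 (hmax (mem_sepNodes.2 ⟨Or.inl hB, hCB.1 hiC, hjB⟩) hCB.1)
  refine ⟨C, hiC, hjC, ?_⟩
  rw [Finset.sum_eq_single_of_mem C hC, hab, Nat.sub_self, pow_zero, mul_one]
  intro C' hC' hne
  rw [zero_pow, mul_zero]
  intro h0
  obtain ⟨hC'n, hiC', hjC'⟩ := mem_sepNodes.1 hC'
  have hab' : common P i j = sabove P C' :=
    Finset.eq_of_subset_of_card_le (hP.common_subset_sabove hC') (Nat.sub_eq_zero_iff_le.1 h0)
  have hlt : C' ⊂ C := by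
    refine LE.le.ssubset_of_ne ?_ hne
    rcases hC'n with h1 | ⟨l, rfl⟩
    · rcases hCn with h2 | ⟨l, rfl⟩
      · exact (hP.nested C' h1 C h2 i hiC' hiC).elim id fun h => hmax hC' h
      · rw [mem_singleton_iff] at hiC
        exact hmax hC' (singleton_subset_iff.2 (hiC ▸ hiC'))
    · rw [mem_singleton_iff] at hiC'
      exact singleton_subset_iff.2 (hiC' ▸ hiC)
  have hCP : C ∈ P := by
    rcases hCn with h2 | ⟨l, rfl⟩
    · exact h2
    · rw [ssubset_singleton_iff] at hlt
      rw [hlt] at hiC'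
      exact absurd hiC' (notMem_empty _)
  have : C ∈ common P i j := hab' ▸ mem_sabove.2 ⟨hCP, hlt⟩
  exact hjC (mem_common.1 this).2.2

theorem spreadDiff_zero_ne {y : Set (Fin n) → ℝ} (hy : Function.Injective y) (hij : i ≠ j) :
    spreadDiff P y 0 i j ≠ 0 := by
  obtain ⟨C, hiC, -, h1⟩ := hP.exists_leading y hij
  obtain ⟨C', -, hiC', h2⟩ := hP.exists_leading y hij.symm
  rw [common_comm (i := j) (j := i)] at h2
  rw [spreadDiff, h1, h2]
  exact sub_ne_zero.2 fun h => hiC' (hy h ▸ hiC)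

omit hP in
theorem continuous_spreadDiff (y : Set (Fin n) → ℝ) (i j : Fin n) :
    Continuous fun τ => spreadDiff P y τ i j := by
  unfold spreadDiff
  fun_prop

omit hP in
theorem continuous_spread (y : Set (Fin n) → ℝ) (i : Fin n) :
    Continuous fun τ => spread P y τ i := by
  unfold spread
  fun_prop

theorem card_common_lt_iff : (common P i k).card < (common P i j).card ↔
    ∃ A ∈ P, i ∈ A ∧ j ∈ A ∧ k ∉ A := by
  constructor
  · intro h
    by_contra! h'
    refine absurd h (not_lt.2 (Finset.card_le_card fun A hA => ?_))
    obtain ⟨hA, hi, hj⟩ := mem_common.1 hA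
    exact mem_common.2 ⟨hA, hi, h' A hA hi hj⟩
  · rintro ⟨A, hA, hi, hj, hk⟩
    refine Finset.card_lt_card ⟨fun B hB => ?_, fun h => hk ?_⟩
    · obtain ⟨hB, hiB, hkB⟩ := mem_common.1 hB
      have h1 := (hP.nested A hA B hB i hi hiB).resolve_right fun h => hk (h hkB)
      exact mem_common.2 ⟨hB, hiB, h1 hj⟩
    · exact (mem_common.1 (h (mem_common.2 ⟨hA, hi, hj⟩))).2.2

end IsLaminar

end Leading

variable {n d m : ℕ} {M : Type*} [TopologicalSpace M] {ε : M ↪ Euc m}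

/-- Every laminar family is the parenthesization of a point of the compactification. -/
theorem exists_parenthesization_eq [ChartedSpace (Euc d) M] [IsManifold (𝓡 d) ∞ M] [Nonempty M]
    (hd : 0 < d) (hε : Manifold.IsSmoothEmbedding (𝓡 d) (𝓡 m) ∞ ε) {P : Finset (Set (Fin n))}
    (hP : IsLaminar P) : ∃ q : CompactConf n ε, parenthesization q.1 = P := by
  have hemb : IsEmbedding ε := hε.isEmbedding
  obtain ⟨a⟩ := ‹Nonempty M›
  obtain ⟨L⟩ := nonempty_localParam hε a
  obtain ⟨y, hy⟩ : ∃ y : Set (Fin n) → ℝ, Function.Injective y := by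
    have := Finite.to_countable (α := Set (Fin n))
    obtain ⟨f, hf⟩ := exists_injective_nat (Set (Fin n))
    exact ⟨fun C => f C, Nat.cast_injective.comp hf⟩
  let e : Euc d := EuclideanSpace.single ⟨0, hd⟩ 1
  have he : e ≠ 0 := by simp [e]
  -- the points are moved along a short segment inside of the chart
  obtain ⟨κ, hκ0, hκ⟩ : ∃ κ : ℝ, κ ≠ 0 ∧
      ∀ i, L.ψ a + (κ * spread P y 0 i) • e ∈ L.ψ.target := by
    have h1 : ∀ᶠ κ in 𝓝 (0 : ℝ), ∀ i, L.ψ a + (κ * spread P y 0 i) • e ∈ L.ψ.target := by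
      rw [eventually_all]
      intro i
      have h2 : Continuous fun κ : ℝ => L.ψ a + (κ * spread P y 0 i) • e := by fun_prop
      refine (h2.tendsto 0) (L.ψ.open_target.mem_nhds ?_)
      rw [zero_mul, zero_smul, add_zero]
      exact L.ψ.map_source L.mem
    obtain ⟨κ, hκ, hκ0⟩ :=
      ((h1.filter_mono (nhdsWithin_le_nhds (s := {0}ᶜ))).and self_mem_nhdsWithin).exists
    exact ⟨κ, hκ0, hκ⟩
  let u : ℝ → Fin n → Euc d := fun τ i => L.ψ a + (κ * spread P y τ i) • e
  let N : Fin n → Fin n → ℕ := fun i j => (common P i j).card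
  let w : ℝ → Fin n → Fin n → Euc d := fun τ i j => (κ * spreadDiff P y τ i j) • e
  let G : ℝ → Fin n → Fin n → Euc m := fun τ i j => L.Dφ (u τ i, u τ j) (w τ i j)
  have hu : ∀ i, Continuous fun τ => u τ i := fun i => by
    have := IsLaminar.continuous_spread (P := P) y i
    fun_prop
  have hw : ∀ i j, Continuous fun τ => w τ i j := fun i j => by
    have := IsLaminar.continuous_spreadDiff (P := P) y i j
    fun_prop
  have huw : ∀ τ i j, u τ i - u τ j = τ ^ N i j • w τ i j := fun τ i j => by
    simp only [u, w]
    rw [add_sub_add_left_eq_sub, ← sub_smul, ← mul_sub, hP.spread_sub, smul_smul, mul_left_comm]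
  have hG : ∀ i j, Continuous fun τ => G τ i j := fun i j =>
    (L.contDiff_Dφ.continuous.comp ((hu i).prodMk (hu j))).clm_apply (hw i j)
  have hφG : ∀ τ i j, L.φ (u τ i) - L.φ (u τ j) = τ ^ N i j • G τ i j := fun τ i j => by
    rw [L.φ_sub, huw, map_smul]
  have hev : ∀ᶠ τ in 𝓝[>] (0 : ℝ), ∀ i, u τ i ∈ L.ψ.target := by
    rw [eventually_all]
    exact fun i => nhdsWithin_le_nhds ((hu i).tendsto 0 (L.ψ.open_target.mem_nhds (hκ i)))
  have hφ : ∀ v ∈ L.ψ.target, ε (L.ψ.symm v) = L.φ v ∧ L.χ (L.φ v) = v := fun v hv => by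
    have h1 := L.φ_ψ _ (L.ψ.map_target hv)
    have h2 := L.χ_ε _ (L.ψ.map_target hv)
    rw [L.ψ.right_inv hv] at h1 h2
    exact ⟨h1.symm, by rw [h1, h2]⟩
  have hG0 : ∀ i j, i ≠ j → G 0 i j ≠ 0 := by
    intro i j hij h0
    have h1 : Continuous fun τ => L.Dχ (L.φ (u τ i), L.φ (u τ j)) (G τ i j) :=
      (L.contDiff_Dχ.continuous.comp ((L.contDiff_φ.continuous.comp (hu i)).prodMk
        (L.contDiff_φ.continuous.comp (hu j)))).clm_apply (hG i j)
    have h2 : L.Dχ (L.φ (u 0 i), L.φ (u 0 j)) (G 0 i j) = w 0 i j := by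
      refine tendsto_nhds_unique ((h1.tendsto 0).mono_left (nhdsWithin_le_nhds (s := Ioi 0)))
        ((((hw i j).tendsto 0).mono_left nhdsWithin_le_nhds).congr' ?_)
      filter_upwards [hev, self_mem_nhdsWithin] with τ hτ hτ0
      have h3 := L.χ_sub (L.φ (u τ i)) (L.φ (u τ j))
      rw [(hφ _ (hτ i)).2, (hφ _ (hτ j)).2, hφG, map_smul, huw] at h3
      exact smul_right_injective _ (pow_ne_zero _ (ne_of_gt hτ0)) h3
    rw [h0, map_zero] at h2
    exact smul_ne_zero (mul_ne_zero hκ0 (hP.spreadDiff_zero_ne hy hij)) he h2.symm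
  -- the coordinates of the configuration, in a form which makes sense for `τ = 0`
  let num : ℝ → Fin n → Fin n → Fin n → ℝ := fun τ i j k => τ ^ (N i j - N i k) * ‖G τ i j‖
  have hnum : ∀ i j k, Continuous fun τ => num τ i j k := fun i j k => by
    have := hG i j
    fun_prop
  have hnum0 : ∀ i j k, i ≠ j → i ≠ k → 0 < num 0 i j k + num 0 i k j := by
    have hnn : ∀ i j k, 0 ≤ num 0 i j k := fun i j k => by positivity
    intro i j k hij hik
    rcases le_total (N i j) (N i k) with h | h
    · have h1 : num 0 i j k = ‖G 0 i j‖ := by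
        simp only [num]
        rw [Nat.sub_eq_zero_of_le h, pow_zero, one_mul]
      exact add_pos_of_pos_of_nonneg (h1 ▸ norm_pos_iff.2 (hG0 i j hij)) (hnn _ _ _)
    · have h1 : num 0 i k j = ‖G 0 i k‖ := by
        simp only [num]
        rw [Nat.sub_eq_zero_of_le h, pow_zero, one_mul]
      exact add_pos_of_nonneg_of_pos (hnn _ _ _) (h1 ▸ norm_pos_iff.2 (hG0 i k hik))
  let F : ℝ → CoordSpace n m := fun τ => (fun i => L.φ (u τ i),
    fun q => ‖G τ (q.1 0) (q.1 1)‖⁻¹ • G τ (q.1 0) (q.1 1),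
    fun t => num τ (t.1 0) (t.1 1) (t.1 2) /
      (num τ (t.1 0) (t.1 1) (t.1 2) + num τ (t.1 0) (t.1 2) (t.1 1)))
  have hF : Tendsto F (𝓝[>] 0) (𝓝 (F 0)) := by
    refine Tendsto.mono_left ?_ nhdsWithin_le_nhds
    refine ContinuousAt.prodMk (continuousAt_pi.2 fun i =>
      (L.contDiff_φ.continuous.comp (hu i)).continuousAt) (ContinuousAt.prodMk
        (continuousAt_pi.2 fun q => ?_) (continuousAt_pi.2 fun t => ?_))
    · exact ((hG _ _).norm.continuousAt.inv₀
        (norm_ne_zero_iff.2 (hG0 _ _ (q.ne (by decide))))).smul (hG _ _).continuousAt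
    · exact (hnum _ _ _).continuousAt.div ((hnum _ _ _).add (hnum _ _ _)).continuousAt
        (hnum0 _ _ _ (t.ne (by decide)) (t.ne (by decide))).ne'
  have hFα : ∀ᶠ τ in 𝓝[>] (0 : ℝ), F τ ∈ coords ε '' range (alpha n ε) := by
    have hGev : ∀ᶠ τ in 𝓝[>] (0 : ℝ), ∀ q : Conf 2 (Fin n), G τ (q.1 0) (q.1 1) ≠ 0 := by
      rw [eventually_all]
      exact fun q => nhdsWithin_le_nhds
        (((hG _ _).tendsto 0).eventually_ne (hG0 _ _ (q.ne (by decide))))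
    filter_upwards [hev, hGev, self_mem_nhdsWithin] with τ hτ hGτ hτ0
    rw [mem_Ioi] at hτ0
    let x : Fin n → M := fun i => L.ψ.symm (u τ i)
    have hx : ∀ i j, ε (x i) - ε (x j) = τ ^ N i j • G τ i j := fun i j => by
      rw [(hφ _ (hτ i)).1, (hφ _ (hτ j)).1, hφG]
    have hinj : Function.Injective x := by
      intro i j hij
      by_contra hne
      have h1 := hx i j
      rw [hij, sub_self] at h1
      exact smul_ne_zero (pow_ne_zero _ hτ0.ne') (hGτ (pair i j hne)) h1.symm
    refine ⟨_, ⟨⟨x, hinj⟩, rfl⟩, ?_⟩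
    rw [coords_alpha]
    refine Prod.ext (funext fun i => (hφ _ (hτ i)).1) (Prod.ext (funext fun q => ?_)
      (funext fun t => ?_))
    · change ‖ε (x (q.1 0)) - ε (x (q.1 1))‖⁻¹ • (ε (x (q.1 0)) - ε (x (q.1 1))) =
        ‖G τ (q.1 0) (q.1 1)‖⁻¹ • G τ (q.1 0) (q.1 1)
      have h0 : (0 : ℝ) < τ ^ N (q.1 0) (q.1 1) := by positivity
      rw [hx, norm_smul, Real.norm_of_nonneg h0.le, smul_smul, mul_inv, mul_comm (_ * _),
        ← mul_assoc, mul_inv_cancel₀ h0.ne', one_mul]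
    · have key : ∀ i j k, dist (ε (x i)) (ε (x j)) = τ ^ min (N i j) (N i k) * num τ i j k := by
        intro i j k
        rw [dist_eq_norm, hx, norm_smul, norm_pow, Real.norm_of_nonneg hτ0.le, ← mul_assoc,
          ← pow_add]
        congr 2
        omega
      change dist (ε (x (t.1 0))) (ε (x (t.1 1))) / (dist (ε (x (t.1 0))) (ε (x (t.1 1))) +
        dist (ε (x (t.1 0))) (ε (x (t.1 2)))) = _
      rw [key _ _ (t.1 2), key (t.1 0) (t.1 2) (t.1 1), min_comm (N (t.1 0) (t.1 2)), ← mul_add,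
        mul_div_mul_left _ _ (pow_ne_zero _ hτ0.ne')]
  have hint : ∀ t : Conf 3 (Fin n), ∃ b, intervalCoord b = (F 0).2.2 t := fun t => by
    have h1 : ∀ i j k, 0 ≤ num 0 i j k := fun i j k => by positivity
    exact exists_intervalCoord_eq (div_nonneg (h1 _ _ _) (add_nonneg (h1 _ _ _) (h1 _ _ _)))
      (div_le_one_of_le₀ (le_add_of_nonneg_right (h1 _ _ _)) (add_nonneg (h1 _ _ _) (h1 _ _ _)))
  choose b hb using hint
  have hnorm : ∀ q : Conf 2 (Fin n), ‖(F 0).2.1 q‖ = 1 := fun q => by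
    change ‖‖G 0 (q.1 0) (q.1 1)‖⁻¹ • G 0 (q.1 0) (q.1 1)‖ = 1
    rw [norm_smul, norm_inv, norm_norm,
      inv_mul_cancel₀ (norm_ne_zero_iff.2 (hG0 _ _ (q.ne (by decide))))]
  let p : Ambient n m M := (fun i => L.ψ.symm (u 0 i),
    fun q => ⟨(F 0).2.1 q, mem_sphere_zero_iff_norm.2 (hnorm q)⟩, b)
  have hp : coords ε p = F 0 :=
    Prod.ext (funext fun i => (hφ _ (hκ i)).1) (Prod.ext rfl (funext hb))
  have hpc : p ∈ closure (range (alpha n ε)) := by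
    rw [(isEmbedding_coords hemb).isInducing.closure_eq_preimage_closure_image, mem_preimage, hp]
    exact mem_closure_of_tendsto hF hFα
  have hdist : ∀ i j, i ≠ j → (p.1 i = p.1 j ↔ ∃ A ∈ P, i ∈ A ∧ j ∈ A) := by
    intro i j hij
    have h1 : ∀ l, ε (p.1 l) = L.φ (u 0 l) := fun l => (hφ _ (hκ l)).1
    rw [← ε.injective.eq_iff, ← sub_eq_zero, h1, h1, hφG, smul_eq_zero_iff_left (hG0 i j hij),
      pow_eq_zero_iff', and_iff_right rfl, Finset.card_ne_zero]
    exact ⟨fun ⟨A, hA⟩ => ⟨A, mem_common.1 hA⟩, fun ⟨A, hA⟩ => ⟨A, mem_common.2 hA⟩⟩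
  refine ⟨⟨p, hpc⟩, parenthesization_eq hP (fun i j k h1 h2 h3 => ?_) fun hn =>
    ⟨fun h => hP.univ_mem hn fun i j hij => (hdist i j hij).1 (h i j), fun h i j => ?_⟩⟩
  · have h4 : intervalCoord (p.2.2 (triple i j k h1 h2 h3)) =
        num 0 i j k / (num 0 i j k + num 0 i k j) := hb (triple i j k h1 h2 h3)
    rw [excludes_iff h1 h2 h3, ← intervalCoord_injective.eq_iff, intervalCoord_zero, h4,
      div_eq_zero_iff, or_iff_left (hnum0 i j k h1 h2).ne', mul_eq_zero,
      or_iff_left (norm_ne_zero_iff.2 (hG0 i j h1)), pow_eq_zero_iff', and_iff_right rfl,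
      Nat.sub_ne_zero_iff_lt]
    exact hP.card_common_lt_iff
  · by_cases hij : i = j
    · rw [hij]
    · exact (hdist i j hij).2 ⟨univ, h, mem_univ i, mem_univ j⟩

end FM

namespace FM

open Set Topology Filter

/-! ### The quotient and its stratification -/

/-- The chart of the orbit space at a point is, up to a local inverse of the projection, the chart
of a representative. -/
theorem exists_chartAt_quotient_eq {H X G : Type*} [TopologicalSpace H] [TopologicalSpace X]
    [ChartedSpace H X] [Group G] [MulAction G X]
    (hπ : IsLocalHomeomorph (Quotient.mk (MulAction.orbitRel G X)))
    (q : Quotient (MulAction.orbitRel G X)) :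
    letI := hπ.chartedSpace (H := H) Quotient.mk_surjective
    ∃ x : X, Quotient.mk (MulAction.orbitRel G X) x = q ∧ chartAt H q q = chartAt H x x := by
  let := hπ.chartedSpace (H := H) Quotient.mk_surjective
  let g := (Quotient.mk_surjective (s := MulAction.orbitRel G X)).hasRightInverse.choose
  have hg : Quotient.mk (MulAction.orbitRel G X) (g q) = q :=
    (Quotient.mk_surjective (s := MulAction.orbitRel G X)).hasRightInverse.choose_spec q
  refine ⟨g q, hg, ?_⟩
  have h1 := hπ.localInverseAt_apply_self (x := g q)
  rw [hg] at h1
  exact congrArg (chartAt H (g q)) h1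

variable {n d m : ℕ} {M : Type*} [TopologicalSpace M] {ε : M ↪ Euc m}

theorem isEmbedding_coords_compactConf (hε : IsEmbedding ε) :
    IsEmbedding fun q : CompactConf n ε => coords ε q.1 :=
  (isEmbedding_coords hε).comp IsEmbedding.subtypeVal

theorem isEmbedding_coords_stratum (hε : IsEmbedding ε) (T : FTree n) :
    IsEmbedding fun q : stratum ε T => coords ε q.1.1 :=
  (isEmbedding_coords_compactConf hε).comp IsEmbedding.subtypeVal

section Action

attribute [local instance] relabelAction

theorem parenthesization_smul_eq_iff {σ : Equiv.Perm (Fin n)} {q : CompactConf n ε} {T : FTree n} :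
    parenthesization (σ • q).1 = (σ • T).parenthesization ↔
      parenthesization q.1 = T.parenthesization := by
  have h1 : ∀ A, A ∈ parenthesization (σ • q).1 ↔ σ ⁻¹' A ∈ parenthesization q.1 :=
    fun A => mem_parenthesization_relabel
  rw [Set.ext_iff, Set.ext_iff]
  simp only [h1, FTree.mem_smul_parenthesization]
  exact ⟨fun h A => by simpa using h (σ '' A), fun h A => h _⟩

theorem smul_mem_stratum {σ : Equiv.Perm (Fin n)} {q : CompactConf n ε} {T : FTree n}
    (hq : q ∈ stratum ε T) : σ • q ∈ stratum ε (σ • T) :=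
  parenthesization_smul_eq_iff.2 hq

theorem continuousConstSMul_compactConf :
    ContinuousConstSMul (Equiv.Perm (Fin n)) (CompactConf n ε) :=
  ⟨fun σ => ((continuous_relabel σ).comp continuous_subtype_val).subtype_mk _⟩

/-- The action is free, in the form of cancellation. -/
theorem isCancelSMul_compactConf (hε : IsEmbedding ε) :
    IsCancelSMul (Equiv.Perm (Fin n)) (CompactConf n ε) where
  right_cancel' σ τ q h := by
    have h1 : (τ⁻¹ * σ) • q = q := by rw [mul_smul, h, inv_smul_smul]
    exact (inv_mul_eq_one.1 (eq_one_of_relabel_eq q.2 hε (congrArg Subtype.val h1))).symm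

/-- Since the action on the ambient vector space is smooth, so is the action on an embedded
submanifold with corners. -/
theorem contMDiff_smul_compactConf [ChartedSpace (EuclideanQuadrant (n * d)) (CompactConf n ε)]
    [IsManifold (Corners (n * d)) ∞ (CompactConf n ε)]
    (h : Manifold.IsSmoothEmbedding (Corners (n * d)) 𝓘(ℝ, CoordSpace n m) ∞
      (fun p : CompactConf n ε => coords ε p.1)) (σ : Equiv.Perm (Fin n)) :
    ContMDiff (Corners (n * d)) (Corners (n * d)) ∞ (fun p : CompactConf n ε => σ • p) :=
  (ContMDiff.iff_comp_isImmersion h.isImmersion).2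
    ⟨((continuous_relabel σ).comp continuous_subtype_val).subtype_mk _,
      (contDiff_relabel σ).contMDiff.comp h.contMDiff⟩

/-- A permutation induces a smooth map from a stratum to the stratum of the relabelled tree. -/
theorem contMDiff_smul_stratum {k l : ℕ} {T T' : FTree n} [ChartedSpace (Euc k) (stratum ε T)]
    [ChartedSpace (Euc l) (stratum ε T')] [IsManifold (𝓡 k) ∞ (stratum ε T)]
    [IsManifold (𝓡 l) ∞ (stratum ε T')]
    (h : Manifold.IsSmoothEmbedding (𝓡 k) 𝓘(ℝ, CoordSpace n m) ∞
      (fun p : stratum ε T => coords ε p.1.1))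
    (h' : Manifold.IsSmoothEmbedding (𝓡 l) 𝓘(ℝ, CoordSpace n m) ∞
      (fun p : stratum ε T' => coords ε p.1.1)) (σ : Equiv.Perm (Fin n))
    {φ : stratum ε T → stratum ε T'} (hφ : ∀ p, (φ p).1 = σ • p.1) : ContMDiff (𝓡 k) (𝓡 l) ∞ φ := by
  have h1 : (fun p : stratum ε T' => coords ε p.1.1) ∘ φ =
      relabel σ ∘ fun p : stratum ε T => coords ε p.1.1 := by
    funext p
    change coords ε (φ p).1.1 = _
    rw [hφ]
    rfl
  refine (ContMDiff.iff_comp_isImmersion h'.isImmersion).2 ⟨?_, ?_⟩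
  · rw [h'.isEmbedding.continuous_iff, h1]
    exact (continuous_relabel σ).comp h.isEmbedding.continuous
  · rw [h1]
    exact (contDiff_relabel σ).contMDiff.comp h.contMDiff

theorem exists_diffeomorph_stratum {k : FTree n → ℕ} [∀ T, ChartedSpace (Euc (k T)) (stratum ε T)]
    (hm : ∀ T, IsManifold (𝓡 (k T)) ∞ (stratum ε T))
    (h : ∀ T, Manifold.IsSmoothEmbedding (𝓡 (k T)) 𝓘(ℝ, CoordSpace n m) ∞
      (fun p : stratum ε T => coords ε p.1.1)) (σ : Equiv.Perm (Fin n)) (T : FTree n) :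
    ∃ Φ : Diffeomorph (𝓡 (k T)) (𝓡 (k (σ • T))) (stratum ε T) (stratum ε (σ • T)) ∞,
      ∀ p : stratum ε T, (Φ p).1 = σ • p.1 :=
  ⟨{ toFun := fun p => ⟨σ • p.1, smul_mem_stratum p.2⟩
     invFun := fun p => ⟨σ⁻¹ • p.1, by
       have := smul_mem_stratum (σ := σ⁻¹) p.2
       rwa [inv_smul_smul] at this⟩
     left_inv := fun p => Subtype.ext (inv_smul_smul σ p.1)
     right_inv := fun p => Subtype.ext (smul_inv_smul σ p.1)
     contMDiff_toFun := contMDiff_smul_stratum (h T) (h _) σ fun _ => rfl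
     contMDiff_invFun := contMDiff_smul_stratum (h _) (h T) σ⁻¹ fun _ => rfl }, fun _ => rfl⟩

theorem orbitMap_mem_orbitStratum {q : CompactConf n ε} {T : FTree n} :
    orbitMap n q ∈ orbitStratum ε T ↔
      ∃ σ : Equiv.Perm (Fin n), parenthesization q.1 = (σ • T).parenthesization := by
  constructor
  · rintro ⟨p, hp, hpq⟩
    obtain ⟨σ, hσ⟩ : ∃ σ : Equiv.Perm (Fin n), σ • q = p := Quotient.exact hpq
    refine ⟨σ⁻¹, ?_⟩
    rw [← parenthesization_smul_eq_iff (σ := σ), smul_inv_smul, hσ]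
    exact hp
  · rintro ⟨σ, hσ⟩
    refine ⟨σ⁻¹ • q, ?_, Quotient.sound ⟨σ⁻¹, rfl⟩⟩
    change parenthesization (σ⁻¹ • q).1 = T.parenthesization
    rw [← parenthesization_smul_eq_iff (σ := σ), smul_inv_smul, hσ]

theorem exists_parenthesization_eq_tree (hε : IsEmbedding ε) (q : CompactConf n ε) :
    ∃ T : FTree n, parenthesization q.1 = T.parenthesization := by
  have h1 := isLaminar_parenthesization q.2 hε
  obtain ⟨T, hT⟩ := IsLaminar.exists_tree (P := (toFinite (parenthesization q.1)).toFinset)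
    ⟨fun A hA => h1.1 A (by simpa using hA), fun A hA B hB => h1.2 A (by simpa using hA) B
      (by simpa using hB)⟩
  exact ⟨T, by rw [hT, Finite.coe_toFinset]⟩

section Charts

variable (hch : ∀ p : CompactConf n ε, Nonempty (CornerChart d p))
include hch

theorem isClosed_setOf_subset_parenthesization (P : Set (Set (Fin n))) :
    IsClosed {q : CompactConf n ε | P ⊆ parenthesization q.1} := by
  rw [← isOpen_compl_iff, isOpen_iff_eventually]
  intro q hq
  filter_upwards [(hch q).some.eventually_parenthesization_subset] with q' h h'
  exact hq (h'.trans h)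

theorem isOpen_setOf_ncard_parenthesization_le (k : ℕ) :
    IsOpen {q : CompactConf n ε | (parenthesization q.1).ncard ≤ k} := by
  rw [isOpen_iff_eventually]
  intro q hq
  filter_upwards [(hch q).some.eventually_parenthesization_subset] with q' h
  exact (ncard_le_ncard h (toFinite _)).trans hq

/-- The closure of a stratum consists of the points whose parenthesization contains the given
one. -/
theorem closure_setOf_parenthesization_eq (P : Set (Set (Fin n))) :
    closure {q : CompactConf n ε | parenthesization q.1 = P} =
      {q : CompactConf n ε | P ⊆ parenthesization q.1} :=
  Subset.antisymm (closure_minimal (fun _ h => (Eq.symm h).subset)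
    (isClosed_setOf_subset_parenthesization hch P)) fun q hq => (hch q).some.mem_closure hq

theorem orbitMap_mem_closure {q : CompactConf n ε} {T : FTree n} :
    orbitMap n q ∈ closure (orbitStratum ε T) ↔
      ∃ σ : Equiv.Perm (Fin n), (σ • T).parenthesization ⊆ parenthesization q.1 := by
  have := continuousConstSMul_compactConf (n := n) (ε := ε)
  have hπ := MulAction.isOpenQuotientMap_quotientMk (Γ := Equiv.Perm (Fin n)) (T := CompactConf n ε)
  have h1 : orbitMap n ⁻¹' orbitStratum ε T = ⋃ σ : Equiv.Perm (Fin n),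
      {q : CompactConf n ε | parenthesization q.1 = (σ • T).parenthesization} := by
    ext q
    rw [mem_preimage, orbitMap_mem_orbitStratum, mem_iUnion]
    rfl
  have h2 : orbitMap n ⁻¹' closure (orbitStratum ε T) = closure (orbitMap n ⁻¹' orbitStratum ε T) :=
    hπ.isOpenMap.preimage_closure_eq_closure_preimage hπ.continuous _
  rw [← mem_preimage, h2, h1, closure_iUnion_of_finite, mem_iUnion]
  simp only [closure_setOf_parenthesization_eq hch]
  rfl

variable (hne : ∀ T : FTree n, (stratum ε T).Nonempty)
include hne

/-- The closure relation between the strata of the orbit space is the contraction relation of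
trees. -/
theorem orbitStratum_subset_closure_iff {T T' : FTree n} :
    orbitStratum ε T ⊆ closure (orbitStratum ε T') ↔
      UnlabelledFTree.Hom T.unlabelled T'.unlabelled := by
  rw [FTree.hom_iff]
  constructor
  · intro h
    obtain ⟨q, hq⟩ := hne T
    have h1 := (orbitMap_mem_closure hch).1 (h ⟨q, hq, rfl⟩)
    rwa [show parenthesization q.1 = _ from hq] at h1
  · rintro h _ ⟨q, hq, rfl⟩
    rw [orbitMap_mem_closure hch, show parenthesization q.1 = _ from hq]
    exact h

omit hch hne in
theorem orbitStratum_eq_of_mem {T T' : FTree n} {x : OrbitSpace n (CompactConf n ε)}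
    (h : x ∈ orbitStratum ε T) (h' : x ∈ orbitStratum ε T') : T.unlabelled = T'.unlabelled := by
  obtain ⟨q, hq, rfl⟩ := h
  obtain ⟨σ, hσ⟩ := orbitMap_mem_orbitStratum.1 h'
  exact FTree.unlabelled_eq_iff.2 ⟨σ, by rw [← hσ]; exact hq⟩

omit hch hne in
theorem orbitStratum_eq_of_unlabelled_eq {T T' : FTree n} (h : T.unlabelled = T'.unlabelled) :
    orbitStratum ε T = orbitStratum ε T' := by
  have key : ∀ {T T' : FTree n}, T.unlabelled = T'.unlabelled →
      orbitStratum ε T ⊆ orbitStratum ε T' := by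
    rintro T T' h _ ⟨q, hq, rfl⟩
    obtain ⟨σ, hσ⟩ := FTree.unlabelled_eq_iff.1 h
    exact orbitMap_mem_orbitStratum.2 ⟨σ, by rw [hσ]; exact hq⟩
  exact Subset.antisymm (key h) (key h.symm)

theorem isStratification_orbitStrata (hε : IsEmbedding ε) :
    IsStratification (orbitStrata (n := n) ε) where
  finite := by
    refine (finite_range fun P : Set (Set (Fin n)) =>
      orbitMap n '' {q : CompactConf n ε | parenthesization q.1 = P}).subset ?_
    rintro _ ⟨T, rfl⟩
    exact ⟨T.parenthesization, rfl⟩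
  nonempty := by
    rintro _ ⟨T, rfl⟩
    exact (hne T).image _
  disjoint := by
    rintro _ ⟨T, rfl⟩ _ ⟨T', rfl⟩ hTT'
    refine disjoint_left.2 fun x hx hx' => hTT' ?_
    exact orbitStratum_eq_of_unlabelled_eq (orbitStratum_eq_of_mem hx hx')
  cover := by
    refine eq_univ_of_forall fun x => ?_
    obtain ⟨q, rfl⟩ := Quotient.mk_surjective x
    obtain ⟨T, hT⟩ := exists_parenthesization_eq_tree hε q
    exact ⟨_, ⟨T, rfl⟩, q, hT, rfl⟩
  isLocallyClosed := by
    rintro _ ⟨T, rfl⟩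
    have := continuousConstSMul_compactConf (n := n) (ε := ε)
    have hπ := MulAction.isOpenQuotientMap_quotientMk (Γ := Equiv.Perm (Fin n))
      (T := CompactConf n ε)
    -- within its closure, a stratum consists of the points with the smallest parenthesizations
    refine ⟨orbitMap n '' {q | (parenthesization q.1).ncard ≤ T.numInternal}, _,
      hπ.isOpenMap _ (isOpen_setOf_ncard_parenthesization_le hch _),
      isClosed_closure (s := orbitStratum ε T), ?_⟩
    refine Subset.antisymm (subset_inter (image_mono fun q hq => ?_) subset_closure) ?_
    · change (parenthesization q.1).ncard ≤ _
      rw [show parenthesization q.1 = _ from hq, T.ncard_parenthesization]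
    · rintro _ ⟨⟨q, hq, rfl⟩, hq'⟩
      obtain ⟨σ, hσ⟩ := (orbitMap_mem_closure hch).1 hq'
      refine orbitMap_mem_orbitStratum.2 ⟨σ, (eq_of_subset_of_ncard_le hσ ?_ (toFinite _)).symm⟩
      rw [(σ • T).ncard_parenthesization]
      exact hq
  closure_eq := by
    rintro _ ⟨T, rfl⟩
    refine ⟨{B ∈ orbitStrata (n := n) ε | B ⊆ closure (orbitStratum ε T)}, sep_subset _ _,
      Subset.antisymm (fun x hx => ?_) (sUnion_subset fun B hB => hB.2)⟩
    obtain ⟨q, rfl⟩ := Quotient.mk_surjective x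
    obtain ⟨T', hT'⟩ := exists_parenthesization_eq_tree hε q
    refine ⟨orbitStratum ε T', ⟨⟨T', rfl⟩, ?_⟩, q, hT', rfl⟩
    rw [orbitStratum_subset_closure_iff hch hne, FTree.hom_iff, ← hT']
    exact (orbitMap_mem_closure hch).1 hx

theorem exists_relIso_orbitStrata :
    ∃ e : RelIso (UnlabelledFTree.Hom (n := n)) (StrataHom (orbitStrata (n := n) ε)),
      ∀ T : FTree n, (e T.unlabelled).1 = orbitStratum ε T := by
  let g := Function.surjInv (FTree.unlabelled_surjective (n := n))
  have hg : ∀ a, (g a).unlabelled = a := Function.surjInv_eq _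
  let f : UnlabelledFTree n → orbitStrata (n := n) ε := fun a => ⟨orbitStratum ε (g a), g a, rfl⟩
  have hf : ∀ T : FTree n, (f T.unlabelled).1 = orbitStratum ε T := fun T =>
    orbitStratum_eq_of_unlabelled_eq (hg _)
  have hbij : Function.Bijective f := by
    constructor
    · intro a b hab
      obtain ⟨q, hq⟩ := hne (g a)
      have h1 : orbitMap n q ∈ orbitStratum ε (g a) := ⟨q, hq, rfl⟩
      have h2 : orbitMap n q ∈ orbitStratum ε (g b) := by
        rwa [show orbitStratum ε (g a) = orbitStratum ε (g b) from congrArg Subtype.val hab] at h1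
      rw [← hg a, ← hg b]
      exact orbitStratum_eq_of_mem h1 h2
    · rintro ⟨_, T, rfl⟩
      exact ⟨T.unlabelled, Subtype.ext (hf T)⟩
  refine ⟨⟨Equiv.ofBijective f hbij, fun {a b} => ?_⟩, hf⟩
  change orbitStratum ε (g a) ⊆ closure (orbitStratum ε (g b)) ↔ _
  rw [orbitStratum_subset_closure_iff hch hne, hg, hg]

end Charts

end Action

end FM

theorem mainTheorem11 {n d m : ℕ} {M : Type*} [TopologicalSpace M]
    [ChartedSpace (EuclideanSpace ℝ (Fin d)) M] [IsManifold (𝓡 d) ∞ M] [Nonempty M] (hd : 0 < d)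
    (ε : M ↪ EuclideanSpace ℝ (Fin m)) (hε : Manifold.IsSmoothEmbedding (𝓡 d) (𝓡 m) ∞ ε) :
    ∃ (_ : MulAction (Equiv.Perm (Fin n)) (CompactConf n ε))
      (_ : ChartedSpace (EuclideanQuadrant (n * d)) (CompactConf n ε))
      (_ : ∀ T : FTree n,
        ChartedSpace (EuclideanSpace ℝ (Fin (n * d - T.numInternal))) (stratum ε T))
      (_ : ChartedSpace (EuclideanQuadrant (n * d)) (OrbitSpace n (CompactConf n ε))),
      -- `C_n[M]` and its strata have the smooth structures induced from `A_n[M]`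
      IsManifold (Corners (n * d)) ∞ (CompactConf n ε) ∧
      Manifold.IsSmoothEmbedding (Corners (n * d)) 𝓘(ℝ, CoordSpace n m) ∞
        (fun p : CompactConf n ε => coords ε p.1) ∧
      (∀ T : FTree n, IsManifold (𝓡 (n * d - T.numInternal)) ∞ (stratum ε T) ∧
        Manifold.IsSmoothEmbedding (𝓡 (n * d - T.numInternal)) 𝓘(ℝ, CoordSpace n m) ∞
          (fun p : stratum ε T => coords ε p.1.1)) ∧
      -- the action extends the one on `C_n(M)`, is smooth and is free
      (∀ (σ : Equiv.Perm (Fin n)) (x : Conf n M), σ • inclusion ε x = inclusion ε (σ • x)) ∧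
      (∀ σ : Equiv.Perm (Fin n), ContMDiff (Corners (n * d)) (Corners (n * d)) ∞
        (fun p : CompactConf n ε => σ • p)) ∧
      (∀ (σ : Equiv.Perm (Fin n)) (p : CompactConf n ε), σ • p = p → σ = 1) ∧
      -- it permutes the strata by diffeomorphisms according to the action on trees
      (∀ (σ : Equiv.Perm (Fin n)) (T : FTree n),
        ∃ Φ : Diffeomorph (𝓡 (n * d - T.numInternal)) (𝓡 (n * d - (σ • T).numInternal))
            (stratum ε T) (stratum ε (σ • T)) ∞,
          ∀ p : stratum ε T, (Φ p).1 = σ • p.1) ∧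
      -- the quotient is a manifold with corners
      T2Space (OrbitSpace n (CompactConf n ε)) ∧
      SecondCountableTopology (OrbitSpace n (CompactConf n ε)) ∧
      IsManifold (Corners (n * d)) ∞ (OrbitSpace n (CompactConf n ε)) ∧
      IsLocalDiffeomorph (Corners (n * d)) (Corners (n * d)) ∞
        (fun p : CompactConf n ε => orbitMap n p) ∧
      -- it is stratified, as a manifold with corners, by the images of the strata of `C_n[M]`
      IsStratification (orbitStrata (n := n) ε) ∧
      (∀ (T : FTree n), ∀ q ∈ orbitStratum ε T, cornerCodim (n * d) q = T.numInternal) ∧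
      -- its category of strata is isomorphic to the category of unlabelled `f`-trees
      ∃ e : RelIso (UnlabelledFTree.Hom (n := n)) (StrataHom (orbitStrata (n := n) ε)),
        ∀ T : FTree n, (e T.unlabelled).1 = orbitStratum ε T := by
  have hemb : Topology.IsEmbedding ε := hε.isEmbedding
  have hch : ∀ p : CompactConf n ε, Nonempty (CornerChart d p) := nonempty_cornerChart hd hε
  have hne : ∀ T : FTree n, (stratum ε T).Nonempty := fun T => by
    obtain ⟨q, hq⟩ := exists_parenthesization_eq hd hε T.isLaminar_family
    exact ⟨q, hq.trans T.coe_family⟩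
  let K : ∀ p : CompactConf n ε, CornerChart d p := fun p => (hch p).some
  let cX := chartedSpaceOfCharts (fun p => (K p).χ) fun p => (K p).mem_source
  have hX : IsManifold (Corners (n * d)) ∞ (CompactConf n ε) :=
    isManifold_of_isAdaptedChart _ _ fun p => (K p).isAdaptedChart
  have hXe : Manifold.IsSmoothEmbedding (Corners (n * d)) 𝓘(ℝ, CoordSpace n m) ∞
      (fun p : CompactConf n ε => coords ε p.1) :=
    isSmoothEmbedding_of_isAdaptedChart (isEmbedding_coords_compactConf hemb) _ _
      fun p => (K p).isAdaptedChart
  choose χ hχ hχa using fun (T : FTree n) (p : stratum ε T) =>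
    (K p.1).exists_stratum_chart hemb p
  let cS := fun T : FTree n => chartedSpaceOfCharts (χ T) (hχ T)
  have hS : ∀ T : FTree n, IsManifold (𝓡 (n * d - T.numInternal)) ∞ (stratum ε T) := fun T =>
    isManifold_of_isAdaptedChart (χ T) (hχ T) (hχa T)
  have hSe : ∀ T : FTree n, Manifold.IsSmoothEmbedding (𝓡 (n * d - T.numInternal))
      𝓘(ℝ, CoordSpace n m) ∞ (fun p : stratum ε T => coords ε p.1.1) := fun T =>
    isSmoothEmbedding_of_isAdaptedChart (isEmbedding_coords_stratum hemb T) (χ T) (hχ T) (hχa T)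
  let act : MulAction (Equiv.Perm (Fin n)) (CompactConf n ε) := relabelAction ε
  have hsm := contMDiff_smul_compactConf hXe
  have := continuousConstSMul_compactConf (n := n) (ε := ε)
  have := isCancelSMul_compactConf (n := n) hemb
  have : T2Space (CompactConf n ε) := (isEmbedding_coords_compactConf hemb).t2Space
  have : SecondCountableTopology (CompactConf n ε) :=
    (isEmbedding_coords_compactConf hemb).secondCountableTopology
  have : LocallyCompactSpace (CompactConf n ε) :=
    Manifold.locallyCompact_of_finiteDimensional (Corners (n * d))
  have hπ : IsLocalHomeomorph
      (Quotient.mk (MulAction.orbitRel (Equiv.Perm (Fin n)) (CompactConf n ε))) :=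
    isQuotientCoveringMap_quotientMk_of_properlyDiscontinuousSMul.isCoveringMap.isLocalHomeomorph
  let cQ := hπ.chartedSpace (H := EuclideanQuadrant (n * d)) Quotient.mk_surjective
  refine ⟨act, cX, cS, cQ, hX, hXe, fun T => ⟨hS T, hSe T⟩, fun _ _ => rfl, hsm,
    fun σ p h => eq_one_of_relabel_eq p.2 hemb (congrArg Subtype.val h),
    exists_diffeomorph_stratum hS hSe, t2Space_of_properlyDiscontinuousSMul_of_t2Space,
    ContinuousConstSMul.secondCountableTopology, isManifold_quotient hsm hπ,
    isLocalDiffeomorph_quotientMk hsm hπ, isStratification_orbitStrata hch hne hemb,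
    fun T q hq => ?_, exists_relIso_orbitStrata hch hne⟩
  -- the codimension at a point of the quotient is the one at the representative used for its chart
  obtain ⟨p, rfl, hp⟩ := exists_chartAt_quotient_eq (H := EuclideanQuadrant (n * d)) hπ q
  obtain ⟨σ, hσ⟩ := orbitMap_mem_orbitStratum.1 hq
  rw [cornerCodim, hp]
  exact (K p).ncard_zero.trans
    ((congrArg Set.ncard hσ).trans (σ • T).ncard_parenthesization)
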